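/- Let $\mathbb{T}^2=(\mathbb{R}/\mathbb{Z})^2$, with points represented by $(x,y)\in(-\tfrac12,\tfrac12]^2$. Let $\mathrm{sgn}(t)=1$ for $t>0$ and $\mathrm{sgn}(t)=-1$ for $t\le 0$. Let $\psi_0=\Delta^{-1}[\mathrm{sgn}(x)\,\mathrm{sgn}(y)]$ be the stream function of the Bahouri--Chemin patch, where $\Delta^{-1}$ is the inverse Laplacian on $\mathbb{T}^2$ with values in mean-zero functions (the Fourier multiplier $-1/(4\pi^2|k|^2)$ for $k\neq0$, and $0$ for $k=0$). Fix a smooth, non-negative, even function $K:\mathbb{R}\to\mathbb{R}$ supported in $(-1,1)$ with $\int_{\mathbb{R}}K=1$, put $K_\epsilon(t)=\frac1\epsilon K(\frac t\epsilon)$ and $F_\epsilon=-\,\mathrm{sgn}*K_\epsilon$. A function on $\mathbb{T}^2$ is odd-odd if it is odd in $x$ and odd in $y$, i.e. $\psi(x,y)=\psi(-x,-y)=-\psi(-x,y)=-\psi(x,-y)$. Theorem. For every constant $C_1>0$ there is $\epsilon_0>0$ (depending only on $K$ and $C_1$) such that the following holds for all $0<\epsilon<\epsilon_0$. Let $\psi_\epsilon\in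 C^1(\mathbb{T}^2)$ be an odd-odd function which satisfies $$\Delta\psi_\epsilon=F_\epsilon(\psi_\epsilon)\ \text{ on }\mathbb{T}^2\text{ (in the sense of distributions)},\qquad \|\psi_\epsilon-\psi_0\|_{C^1(\mathbb{T}^2)}<C_1\sqrt{\epsilon}\,\sqrt{-\ln\epsilon}\;\ln(-\ln\epsilon).$$ Then the linearized operator $u\mapsto\Delta u-F_\epsilon'(\psi_\epsilon)\,u$ is an isomorphism (a bounded linear bijection with bounded inverse) (a) from $H^2(\mathbb{T}^2)\cap\{u \text{ odd-odd}\}$ onto $L^2(\mathbb{T}^2)\cap\{u\text{ odd-odd}\}$, and (b) from $H^2(\mathbb{T}^2)\cap\{u \text{ odd-odd},\ u(x,y)=u(y,x)\}$ onto $L^2(\mathbb{T}^2)\cap\{u\text{ odd-odd},\ u(x,y)=u(y,x)\}$. -/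

import Mathlib

open MeasureTheory Set
open scoped ENNReal ContDiff

noncomputable section

namespace TorusEuler

/-- The flat two-dimensional torus `(ℝ/ℤ)²`. -/
abbrev T2 : Type := UnitAddTorus (Fin 2)

/-- Lebesgue (Haar) measure on the torus, of total mass one. -/
abbrev torusMeasure : Measure T2 := Measure.pi fun _ : Fin 2 => AddCircle.haarAddCircle

/-- The real Hilbert space `L²(T2)`. -/
abbrev L2 : Type := Lp ℝ 2 torusMeasure

/-! ### Functions on the torus -/

/-- The projection `ℝ² → T2`. -/
def proj (x : Fin 2 → ℝ) : T2 := fun i => (x i : UnitAddCircle)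

/-- A function on the torus is of class `C^n` if its periodic lift to the plane is. -/
def TorusContDiff (n : ℕ∞ω) (f : T2 → ℝ) : Prop := ContDiff ℝ n fun x : Fin 2 → ℝ => f (proj x)

/-- The partial derivative in the `i`-th coordinate. -/
def pd (i : Fin 2) (f : T2 → ℝ) (p : T2) : ℝ :=
  deriv (fun t : ℝ => f (p + Pi.single i (t : UnitAddCircle))) 0

/-- The mixed partial derivative `∂₁^m ∂₂^n f`. -/
def pdIter (m n : ℕ) (f : T2 → ℝ) : T2 → ℝ := (pd 0)^[m] ((pd 1)^[n] f)

/-- The `C¹` norm `sup |f| + sup |∂₁ f| + sup |∂₂ f|`, with values in `[0, ∞]`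
(used for `C¹` functions only). -/
def c1Norm (f : T2 → ℝ) : ℝ≥0∞ := (⨆ p, ‖f p‖ₑ) + ∑ i, ⨆ p, ‖pd i f p‖ₑ

/-- `(x, y) ↦ (-x, y)` -/
def reflX (p : T2) : T2 := ![-p 0, p 1]

/-- `(x, y) ↦ (x, -y)` -/
def reflY (p : T2) : T2 := ![p 0, -p 1]

/-- `(x, y) ↦ (y, x)` -/
def swapXY (p : T2) : T2 := ![p 1, p 0]

/-- Oddness in each of the two variables. -/
def IsOddOdd (f : T2 → ℝ) : Prop := ∀ p, f (reflX p) = -f p ∧ f (reflY p) = -f p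

/-- `Δ f = g` on the torus in the sense of distributions. -/
def IsWeakLaplacian (f g : T2 → ℝ) : Prop :=
  ∀ φ : T2 → ℝ, TorusContDiff ∞ φ →
    ∫ p, f p * (pdIter 2 0 φ p + pdIter 0 2 φ p) ∂torusMeasure = ∫ p, g p * φ p ∂torusMeasure

/-! ### The Bahouri-Chemin stream function and the nonlinearity -/

/-- The sign function, with value `-1` at `0`. -/
def sgn (x : ℝ) : ℝ := if 0 < x then 1 else -1

/-- The sign of the representative in `(-1/2, 1/2]` of a point of the circle. -/
def sgnCircle (θ : UnitAddCircle) : ℝ := sgn (AddCircle.equivIoc (1 : ℝ) (-1 / 2) θ : ℝ)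

/-- The inverse Laplacian on the torus: the Fourier multiplier `-1 / (4 π² |k|²)` for `k ≠ 0`,
and `0` for `k = 0`. For `w` in `L²` the series converges absolutely, and its sum is the
mean-zero solution `u` of `Δ u = w - ∫ w`. -/
def invLaplacian (w : T2 → ℝ) (p : T2) : ℝ :=
  (∑' k : Fin 2 → ℤ,
    ((-1 / (4 * Real.pi ^ 2 * ((k 0 : ℝ) ^ 2 + (k 1 : ℝ) ^ 2)) : ℝ) : ℂ) *
      UnitAddTorus.mFourierCoeff (fun q => (w q : ℂ)) k * UnitAddTorus.mFourier k p).re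

/-- The stream function `ψ₀ = Δ⁻¹ [sgn x sgn y]` of the Bahouri-Chemin patch. -/
def psi0 : T2 → ℝ := invLaplacian fun p => sgnCircle (p 0) * sgnCircle (p 1)

/-- A smooth even mollifier supported in the unit ball. -/
structure IsMollifier (K : ℝ → ℝ) : Prop where
  smooth : ContDiff ℝ ∞ K
  nonneg : ∀ x, 0 ≤ K x
  even : ∀ x, K (-x) = K x
  support : Function.support K ⊆ Metric.ball 0 1
  integral_eq_one : ∫ x, K x = 1

/-- `K_δ(x) = K(x / δ) / δ` -/
def rescale (K : ℝ → ℝ) (δ x : ℝ) : ℝ := (1 / δ) * K (x / δ)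

/-- The nonlinearity `F_ε = - sgn * K_ε` (convolution on the line). -/
def nonlin (K : ℝ → ℝ) (ε x : ℝ) : ℝ :=
  -(convolution sgn (rescale K ε) (ContinuousLinearMap.mul ℝ ℝ) volume x)

/-! ### Calculus facts needed to see that `H²` is a linear space -/

theorem isOpenQuotientMap_proj : IsOpenQuotientMap proj :=
  IsOpenQuotientMap.piMap (f := fun (_ : Fin 2) (x : ℝ) => (x : UnitAddCircle))
    fun _ => QuotientAddGroup.isOpenQuotientMap_mk

theorem TorusContDiff.continuous {n : ℕ∞ω} {f : T2 → ℝ} (hf : TorusContDiff n f) :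
    Continuous f :=
  isOpenQuotientMap_proj.isQuotientMap.continuous_iff.2 (ContDiff.continuous hf)

theorem pd_proj {f : T2 → ℝ} (hf : TorusContDiff 1 f) (i : Fin 2) (x : Fin 2 → ℝ) :
    pd i f (proj x) = fderiv ℝ (fun y : Fin 2 → ℝ => f (proj y)) x (Pi.single i 1) := by
  have h1 : HasFDerivAt (fun y : Fin 2 → ℝ => f (proj y))
      (fderiv ℝ (fun y : Fin 2 → ℝ => f (proj y)) x) (x + (0 : ℝ) • Pi.single i (1 : ℝ)) := by
    simpa using (ContDiff.differentiable hf one_ne_zero x).hasFDerivAt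
  have h2 : HasDerivAt (fun t : ℝ => x + t • (Pi.single i (1 : ℝ) : Fin 2 → ℝ))
      (Pi.single i (1 : ℝ)) 0 := by
    simpa using ((hasDerivAt_id (0 : ℝ)).smul_const
      (Pi.single i (1 : ℝ) : Fin 2 → ℝ)).const_add x
  have h3 := h1.comp_hasDerivAt (0 : ℝ) h2
  rw [pd, ← h3.deriv]
  congr 1
  funext t
  simp only [Function.comp_apply]
  congr 1
  funext j
  by_cases h : j = i
  · subst h; simp [proj]
  · simp [proj, h]

theorem TorusContDiff.pd {f : T2 → ℝ} (hf : TorusContDiff ∞ f) (i : Fin 2) :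
    TorusContDiff ∞ (pd i f) := by
  have h1 : TorusContDiff 1 f := ContDiff.of_le hf (by exact_mod_cast le_top)
  have h2 : (fun x : Fin 2 → ℝ => TorusEuler.pd i f (proj x)) =
      fun x => fderiv ℝ (fun y : Fin 2 → ℝ => f (proj y)) x (Pi.single i 1) :=
    funext fun x => pd_proj h1 i x
  unfold TorusContDiff
  rw [h2]
  exact (ContDiff.fderiv_right (m := ∞) hf (by simp)).clm_apply contDiff_const

theorem TorusContDiff.pdIter {f : T2 → ℝ} (hf : TorusContDiff ∞ f) (m n : ℕ) :
    TorusContDiff ∞ (pdIter m n f) := by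
  have key : ∀ (i : Fin 2) (k : ℕ) (g : T2 → ℝ), TorusContDiff ∞ g →
      TorusContDiff ∞ ((TorusEuler.pd i)^[k] g) := by
    intro i k
    induction k with
    | zero => intro g hg; simpa using hg
    | succ k ih => intro g hg; rw [Function.iterate_succ_apply]; exact ih _ (hg.pd i)
  exact key 0 m _ (key 1 n _ hf)

theorem integrable_mul_of_continuous (u : L2) {φ : T2 → ℝ} (hφ : Continuous φ) :
    Integrable (fun p => u p * φ p) torusMeasure := by
  have hu : Integrable (u : T2 → ℝ) torusMeasure := (Lp.memLp u).integrable (by norm_num)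
  obtain ⟨C, hC⟩ := isCompact_univ.exists_bound_of_continuousOn hφ.continuousOn
  exact hu.mul_bdd (c := C) hφ.aestronglyMeasurable (ae_of_all _ fun p => hC p (mem_univ p))

/-! ### Sobolev space `H²(T2)` -/

/-- Multi-indices `α = (α₁, α₂)` with `|α| ≤ 2`. -/
abbrev MultiIndex : Type := {α : Fin 3 × Fin 3 // (α.1 : ℕ) + (α.2 : ℕ) ≤ 2}

/-- The multi-index `(0,0)`. -/
def ix00 : MultiIndex := ⟨(0, 0), by decide⟩
/-- The multi-index `(2,0)`. -/
def ix20 : MultiIndex := ⟨(2, 0), by decide⟩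
/-- The multi-index `(0,2)`. -/
def ix02 : MultiIndex := ⟨(0, 2), by decide⟩

/-- `v` is the weak derivative `∂₁^m ∂₂^n u`. -/
def IsWeakDeriv (m n : ℕ) (u v : L2) : Prop :=
  ∀ φ : T2 → ℝ, TorusContDiff ∞ φ →
    ∫ p, u p * pdIter m n φ p ∂torusMeasure = (-1) ^ (m + n) * ∫ p, v p * φ p ∂torusMeasure

theorem IsWeakDeriv.add {m n : ℕ} {u v u' v' : L2} (h : IsWeakDeriv m n u v)
    (h' : IsWeakDeriv m n u' v') : IsWeakDeriv m n (u + u') (v + v') := by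
  intro φ hφ
  have aux : ∀ (a b : L2) (χ : T2 → ℝ), Continuous χ →
      ∫ p, (a + b : L2) p * χ p ∂torusMeasure =
        ∫ p, a p * χ p ∂torusMeasure + ∫ p, b p * χ p ∂torusMeasure := by
    intro a b χ hχ
    rw [← integral_add (integrable_mul_of_continuous a hχ) (integrable_mul_of_continuous b hχ)]
    refine integral_congr_ae ?_
    filter_upwards [Lp.coeFn_add a b] with p hp
    rw [hp, Pi.add_apply, add_mul]
  rw [aux _ _ _ (hφ.pdIter m n).continuous, aux _ _ _ hφ.continuous, h φ hφ, h' φ hφ, mul_add]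

theorem IsWeakDeriv.smul {m n : ℕ} {u v : L2} (c : ℝ) (h : IsWeakDeriv m n u v) :
    IsWeakDeriv m n (c • u) (c • v) := by
  intro φ hφ
  have aux : ∀ (a : L2) (χ : T2 → ℝ), ∫ p, (c • a : L2) p * χ p ∂torusMeasure =
      c * ∫ p, a p * χ p ∂torusMeasure := by
    intro a χ
    rw [← integral_const_mul]
    refine integral_congr_ae ?_
    filter_upwards [Lp.coeFn_smul c a] with p hp
    rw [hp, Pi.smul_apply, smul_eq_mul, mul_assoc]
  rw [aux, aux, h φ hφ]
  ring

theorem IsWeakDeriv.zero (m n : ℕ) : IsWeakDeriv m n 0 0 := by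
  simpa using IsWeakDeriv.smul (m := m) (n := n) (u := 0) (v := 0) 0
    (fun φ hφ => by
      have : ∀ χ : T2 → ℝ, ∫ p, (0 : L2) p * χ p ∂torusMeasure = 0 := by
        intro χ
        refine integral_eq_zero_of_ae ?_
        filter_upwards [Lp.coeFn_zero ℝ 2 torusMeasure] with p hp
        simp
      rw [this, this, mul_zero])

/-- The Sobolev space `H²(T2)`. An element is stored as the family `(∂^α u)_{|α| ≤ 2}` of the
`L²` function `u` and its weak derivatives, which are determined by `u`; the norm inherited from
the `ℓ²`-sum of copies of `L²` is the `H²` norm `(∑_{|α| ≤ 2} ‖∂^α u‖²)^{1/2}`. -/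
def H2 : Submodule ℝ (PiLp 2 fun _ : MultiIndex => L2) where
  carrier := {U | ∀ α : MultiIndex, IsWeakDeriv α.1.1 α.1.2 (U ix00) (U α)}
  add_mem' := fun hU hV α => (hU α).add (hV α)
  zero_mem' := fun α => IsWeakDeriv.zero _ _
  smul_mem' := fun c _ hU α => (hU α).smul c

/-- The `L²` function underlying an element of `H²`. -/
def H2.toL2 : H2 →ₗ[ℝ] L2 where
  toFun U := U.1 ix00
  map_add' _ _ := rfl
  map_smul' _ _ := rfl

/-- The Laplacian `H² → L²`. -/
def H2.laplacian : H2 →ₗ[ℝ] L2 where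
  toFun U := U.1 ix20 + U.1 ix02
  map_add' U V := by simp only [Submodule.coe_add, PiLp.add_apply]; abel
  map_smul' c U := by simp

/-! ### Symmetry classes -/

theorem measurePreserving_reflX : MeasurePreserving reflX torusMeasure torusMeasure := by
  have h := measurePreserving_pi (fun _ : Fin 2 => (AddCircle.haarAddCircle : Measure UnitAddCircle))
    (fun _ : Fin 2 => (AddCircle.haarAddCircle : Measure UnitAddCircle))
    (f := ![fun x => -x, id]) (fun i => by
      fin_cases i
      · exact Measure.measurePreserving_neg _
      · exact MeasurePreserving.id _)
  have e : reflX = fun a i => (![fun x => -x, id] : Fin 2 → UnitAddCircle → UnitAddCircle) i (a i) := by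
    funext p i
    fin_cases i <;> rfl
  rw [e]
  exact h

theorem measurePreserving_reflY : MeasurePreserving reflY torusMeasure torusMeasure := by
  have h := measurePreserving_pi (fun _ : Fin 2 => (AddCircle.haarAddCircle : Measure UnitAddCircle))
    (fun _ : Fin 2 => (AddCircle.haarAddCircle : Measure UnitAddCircle))
    (f := ![id, fun x => -x]) (fun i => by
      fin_cases i
      · exact MeasurePreserving.id _
      · exact Measure.measurePreserving_neg _)
  have e : reflY = fun a i => (![id, fun x => -x] : Fin 2 → UnitAddCircle → UnitAddCircle) i (a i) := by
    funext p i
    fin_cases i <;> rfl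
  rw [e]
  exact h

theorem measurePreserving_swapXY : MeasurePreserving swapXY torusMeasure torusMeasure := by
  have h := measurePreserving_piCongrLeft
    (fun _ : Fin 2 => (AddCircle.haarAddCircle : Measure UnitAddCircle)) (Equiv.swap 0 1)
  have e : swapXY = ⇑(MeasurableEquiv.piCongrLeft (fun _ : Fin 2 => UnitAddCircle)
      (Equiv.swap (0 : Fin 2) 1)) := by
    funext p i
    rw [MeasurableEquiv.coe_piCongrLeft]
    fin_cases i
    · exact (Equiv.piCongrLeft_apply_apply (fun _ : Fin 2 => UnitAddCircle)
        (Equiv.swap (0 : Fin 2) 1) p 1).symm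
    · exact (Equiv.piCongrLeft_apply_apply (fun _ : Fin 2 => UnitAddCircle)
        (Equiv.swap (0 : Fin 2) 1) p 0).symm
  rw [e]
  exact h

/-- `L²` functions with `u(x,y) = u(-x,-y) = -u(-x,y) = -u(x,-y)` almost everywhere. -/
def L2OddOdd : Submodule ℝ L2 :=
  LinearMap.eqLocus (Lp.compMeasurePreservingₗ ℝ reflX measurePreserving_reflX)
      (-LinearMap.id : L2 →ₗ[ℝ] L2) ⊓
    LinearMap.eqLocus (Lp.compMeasurePreservingₗ ℝ reflY measurePreserving_reflY)
      (-LinearMap.id : L2 →ₗ[ℝ] L2)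

/-- `L²` functions with `u(x,y) = u(-x,-y) = -u(-x,y) = -u(x,-y) = u(y,x)` almost everywhere. -/
def L2Sym : Submodule ℝ L2 :=
  L2OddOdd ⊓
    LinearMap.eqLocus (Lp.compMeasurePreservingₗ ℝ swapXY measurePreserving_swapXY)
      (LinearMap.id : L2 →ₗ[ℝ] L2)

theorem mem_L2OddOdd_iff (u : L2) : u ∈ L2OddOdd ↔
    ∀ᵐ p ∂torusMeasure, u (reflX p) = -u p ∧ u (reflY p) = -u p := by
  have aux : ∀ (r : T2 → T2) (hr : MeasurePreserving r torusMeasure torusMeasure),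
      Lp.compMeasurePreservingₗ ℝ r hr u = (-LinearMap.id : L2 →ₗ[ℝ] L2) u ↔
        ∀ᵐ p ∂torusMeasure, u (r p) = -u p := by
    intro r hr
    rw [Lp.ext_iff]
    have h1 : ⇑(Lp.compMeasurePreservingₗ ℝ r hr u) =ᵐ[torusMeasure] u ∘ r :=
      Lp.coeFn_compMeasurePreserving u hr
    have h2 : ⇑((-LinearMap.id : L2 →ₗ[ℝ] L2) u) =ᵐ[torusMeasure] -u := Lp.coeFn_neg u
    constructor
    · intro h
      filter_upwards [h1.symm.trans (h.trans h2)] with p hp using hp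
    · intro h
      exact h1.trans (Filter.EventuallyEq.trans (by filter_upwards [h] with p hp using hp) h2.symm)
  rw [Filter.eventually_and, ← aux _ measurePreserving_reflX, ← aux _ measurePreserving_reflY]
  rfl

theorem mem_L2Sym_iff (u : L2) : u ∈ L2Sym ↔
    ∀ᵐ p ∂torusMeasure, (u (reflX p) = -u p ∧ u (reflY p) = -u p) ∧ u (swapXY p) = u p := by
  rw [Filter.eventually_and, ← mem_L2OddOdd_iff]
  refine and_congr Iff.rfl ?_
  change Lp.compMeasurePreservingₗ ℝ swapXY measurePreserving_swapXY u = u ↔ _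
  rw [Lp.ext_iff]
  have h1 : ⇑(Lp.compMeasurePreservingₗ ℝ swapXY measurePreserving_swapXY u)
      =ᵐ[torusMeasure] u ∘ swapXY := Lp.coeFn_compMeasurePreserving u measurePreserving_swapXY
  exact ⟨fun h => h1.symm.trans h, fun h => h1.trans h⟩

/-- `H²` functions with `u(x,y) = u(-x,-y) = -u(-x,y) = -u(x,-y)`. -/
def H2OddOdd : Submodule ℝ H2 := L2OddOdd.comap H2.toL2

/-- `H²` functions with `u(x,y) = u(-x,-y) = -u(-x,y) = -u(x,-y) = u(y,x)`. -/
def H2Sym : Submodule ℝ H2 := L2Sym.comap H2.toL2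

/-- `Δ - V` (with `V` acting by multiplication) maps the subspace `X` of `H²` isomorphically, as a
topological vector space, onto the subspace `Y` of `L²`. -/
def IsIsoLaplacianSub (V : T2 → ℝ) (X : Submodule ℝ H2) (Y : Submodule ℝ L2) : Prop :=
  ∃ e : X ≃L[ℝ] Y, ∀ U : X,
    (((e U : Y) : L2) : T2 → ℝ) =ᵐ[torusMeasure]
      fun p => H2.laplacian (U : H2) p - V p * H2.toL2 (U : H2) p

end TorusEuler

end

open TorusEuler

open Filter Topology
open scoped RealInnerProductSpace

noncomputable section

namespace TorusEuler

/-! ### Absolutely convergent double sine series -/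

/-! The potential is `F_ε'(ψ) = -2 K_ε(ψ)`. It is non-positive, at most `2M/ε` in size if `K ≤ M`,
and zero wherever `|ψ| ≥ ε`. The point is that `{|ψ_ε| < ε}` lies in a strip of width `τ`, much
smaller than `√ε`, around the lines `x ∈ ½ℤ` and `y ∈ ½ℤ` on which odd-odd functions vanish. On that
strip odd-odd functions obey the Poincaré inequality `∫_strip u² ≤ 4τ² ∫ |∇u|²`
(`integral_strip_le_dirichlet`), so the potential costs at most half of the Dirichlet energy
(`integral_potential_le`). Injectivity of `Δ - V` follows by pairing with `u`, surjectivity from a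
Neumann series for `√(-V) (-Δ)⁻¹ √(-V)` (`exists_laplacianSub_eq`), and the bounded inverse from the
open mapping theorem.

The width of the strip comes from the logarithm in `ψ₀`. If `n ≤ m` are the distances to the two
families of lines, `|ψ₀|` is at least `n m log (1/m²)` up to constants, while an odd-odd
perturbation of `C¹` size `δ` is at most `δ n`, because it vanishes on the lines
(`exists_bounds_of_notMem_strip`). With `ε = e²`, `-ln ε = r⁴` and `τ = e / r`, the comparison after
division by `n` reads `4 C₁ e r² log r + e r ≤ e r³ / 52`, which holds for large `r`
(`exists_strip_width`).

The lower bound on `ψ₀` is a comparison argument. The function `-ψ₀` is a double sine series with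
square-wave coefficients. Averaging the square wave over intervals of radius `h` makes the series
twice differentiable term by term, and the minimum principle compares it with the barrier `xy log (κ
(x² + y² + h²))` on a square (`sineSeries_trapezoid_ge`); then `h → 0`.

Part (b) needs `ψ_ε(x,y) = ψ_ε(y,x)`, which is not assumed. The difference `d` of the two sides
solves `Δd = F_ε'(ξ) d` with `ξ` between two values of `ψ_ε`. Since `ψ₀` is symmetric, off the strip
both values lie on the same side of zero at distance at least `ε`, so `F_ε'(ξ) = 0` there and the
energy estimate gives `d = 0` (`comp_swapXY_eq`). Uniqueness then makes solutions with symmetric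
data symmetric. -/

/-- The summable majorant `|k|^{-3/2} |l|^{-3/2}` on `ℤ × ℤ`. -/
def latticeMajorant (k : ℤ × ℤ) : ℝ := |(k.1 : ℝ)| ^ (-(3 / 2) : ℝ) * |(k.2 : ℝ)| ^ (-(3 / 2) : ℝ)

theorem latticeMajorant_nonneg (k : ℤ × ℤ) : 0 ≤ latticeMajorant k := by
  unfold latticeMajorant; positivity

theorem summable_latticeMajorant : Summable latticeMajorant :=
  (Real.summable_abs_int_rpow (b := 3 / 2) (by norm_num)).mul_of_nonneg
    (Real.summable_abs_int_rpow (b := 3 / 2) (by norm_num))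
    (fun _ => by positivity) (fun _ => by positivity)

/-- With `|k| = a²` and `|l| = b²` this is `a³ b ≤ a⁴ + b⁴`, multiplied by `b²`. The column `k = 0`
is a genuine exception: there the majorant is `0`, since `0 ^ (-3/2) = 0`. -/
theorem inv_mul_inv_sq_add_sq_le (k l : ℤ) :
    |(l : ℝ)|⁻¹ * ((k : ℝ) ^ 2 + (l : ℝ) ^ 2)⁻¹ ≤ latticeMajorant (k, l) ∨ k = 0 := by
  by_cases hk : k = 0
  · exact Or.inr hk
  left
  by_cases hl : l = 0
  · subst hl; simpa using latticeMajorant_nonneg (k, 0)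
  have hk' : 0 < |(k : ℝ)| := by positivity
  have hl' : 0 < |(l : ℝ)| := by positivity
  obtain ⟨a, ha, hka⟩ : ∃ a : ℝ, 0 < a ∧ |(k : ℝ)| = a ^ 2 :=
    ⟨√|(k : ℝ)|, Real.sqrt_pos.2 hk', (Real.sq_sqrt hk'.le).symm⟩
  obtain ⟨b, hb, hlb⟩ : ∃ b : ℝ, 0 < b ∧ |(l : ℝ)| = b ^ 2 :=
    ⟨√|(l : ℝ)|, Real.sqrt_pos.2 hl', (Real.sq_sqrt hl'.le).symm⟩
  have e : ∀ c : ℝ, 0 < c → (c ^ 2) ^ (-(3 / 2) : ℝ) = (c ^ 3)⁻¹ := by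
    intro c hc
    rw [← Real.rpow_natCast, ← Real.rpow_natCast, ← Real.rpow_mul hc.le, ← Real.rpow_neg hc.le]
    norm_num
  have h1 : (k : ℝ) ^ 2 = a ^ 4 := by rw [← sq_abs, hka]; ring
  have h2 : (l : ℝ) ^ 2 = b ^ 4 := by rw [← sq_abs, hlb]; ring
  rw [latticeMajorant, h1, h2, hka, hlb, e a ha, e b hb, ← mul_inv, ← mul_inv]
  apply inv_anti₀ (by positivity)
  have h3 : a ^ 3 * b ≤ a ^ 4 + b ^ 4 := by
    rcases le_total a b with h | h
    · have : a ^ 3 * b ≤ b ^ 3 * b := by gcongr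
      nlinarith [pow_pos ha 4]
    · have : a ^ 3 * b ≤ a ^ 3 * a := by gcongr
      nlinarith [pow_pos hb 4]
  nlinarith [mul_le_mul_of_nonneg_left h3 (sq_nonneg b)]

/-- The coefficient `β_k β_l / (4 π² (k² + l²))`. -/
def sineCoeff (β : ℤ → ℝ) (k : ℤ × ℤ) : ℝ :=
  β k.1 * β k.2 / (4 * Real.pi ^ 2 * ((k.1 : ℝ) ^ 2 + (k.2 : ℝ) ^ 2))

/-- The double series `∑ β_k β_l / (4 π² (k² + l²)) sin (2πkx) sin (2πly)`. -/
def sineSeries (β : ℤ → ℝ) (x y : ℝ) : ℝ :=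
  ∑' k : ℤ × ℤ, sineCoeff β k *
    (Real.sin (2 * Real.pi * k.1 * x) * Real.sin (2 * Real.pi * k.2 * y))

theorem sineCoeff_swap (β : ℤ → ℝ) (k : ℤ × ℤ) : sineCoeff β k.swap = sineCoeff β k := by
  simp only [sineCoeff, Prod.fst_swap, Prod.snd_swap]
  rw [mul_comm (β k.2), add_comm ((k.2 : ℝ) ^ 2)]

theorem sineSeries_comm (β : ℤ → ℝ) (x y : ℝ) : sineSeries β x y = sineSeries β y x := by
  unfold sineSeries
  rw [← (Equiv.prodComm ℤ ℤ).tsum_eq]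
  refine tsum_congr fun k => ?_
  rw [Equiv.coe_prodComm, sineCoeff_swap]
  simp only [Prod.fst_swap, Prod.snd_swap]
  ring

section Bounds

variable {β : ℤ → ℝ} {C : ℝ}

/-- The decay of `β k` pays for one power of `|k|`, so series with coefficients `O(1/k)`, in
particular that of the square wave itself, may be differentiated once term by term. -/
theorem abs_sineCoeff_mul_le (hβ : ∀ k, |β k| ≤ C * |(k : ℝ)|⁻¹) (k : ℤ × ℤ) :
    |sineCoeff β k| * |(k.1 : ℝ)| ≤ C ^ 2 * latticeMajorant k := by
  obtain ⟨k, l⟩ := k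
  have hC : 0 ≤ C := by simpa using (abs_nonneg _).trans (hβ 1)
  by_cases hk : k = 0
  · subst hk
    simpa using mul_nonneg (sq_nonneg C) (latticeMajorant_nonneg (0, l))
  have h := (inv_mul_inv_sq_add_sq_le k l).resolve_right hk
  have hk' : (k : ℝ) ≠ 0 := by exact_mod_cast hk
  have hq : 0 < (k : ℝ) ^ 2 + (l : ℝ) ^ 2 := by positivity
  have hpi : (1 : ℝ) ≤ 4 * Real.pi ^ 2 := by nlinarith [Real.pi_gt_three]
  simp only [sineCoeff]
  rw [abs_div, abs_mul, abs_of_pos (show 0 < 4 * Real.pi ^ 2 * ((k : ℝ) ^ 2 + (l : ℝ) ^ 2) by positivity)]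
  calc |β k| * |β l| / (4 * Real.pi ^ 2 * ((k : ℝ) ^ 2 + (l : ℝ) ^ 2)) * |(k : ℝ)|
      ≤ (C * |(k : ℝ)|⁻¹) * (C * |(l : ℝ)|⁻¹) / (1 * ((k : ℝ) ^ 2 + (l : ℝ) ^ 2)) * |(k : ℝ)| := by
        gcongr
        · exact hβ k
        · exact hβ l
    _ = C ^ 2 * (|(l : ℝ)|⁻¹ * ((k : ℝ) ^ 2 + (l : ℝ) ^ 2)⁻¹) := by
        field_simp
    _ ≤ _ := by gcongr

theorem abs_sineCoeff_le (hβ : ∀ k, |β k| ≤ C * |(k : ℝ)|⁻¹) (k : ℤ × ℤ) :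
    |sineCoeff β k| ≤ C ^ 2 * latticeMajorant k := by
  by_cases hk : k.1 = 0
  · have : β 0 = 0 := by simpa using hβ 0
    simpa [sineCoeff, hk, this] using mul_nonneg (sq_nonneg C) (latticeMajorant_nonneg k)
  refine le_trans ?_ (abs_sineCoeff_mul_le hβ k)
  have : (1 : ℝ) ≤ |(k.1 : ℝ)| := by exact_mod_cast Int.one_le_abs hk
  nlinarith [abs_nonneg (sineCoeff β k)]

theorem abs_mul_sin_mul_le (a s t : ℝ) (hs : |s| ≤ 1) (ht : |t| ≤ 1) : |a * (s * t)| ≤ |a| := by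
  rw [abs_mul, abs_mul]
  have : |s| * |t| ≤ 1 := mul_le_one₀ hs (abs_nonneg _) ht
  nlinarith [abs_nonneg a]

theorem summable_sineSeries (hβ : ∀ k, |β k| ≤ C * |(k : ℝ)|⁻¹) (x y : ℝ) :
    Summable fun k : ℤ × ℤ => sineCoeff β k *
      (Real.sin (2 * Real.pi * k.1 * x) * Real.sin (2 * Real.pi * k.2 * y)) :=
  Summable.of_norm_bounded (summable_latticeMajorant.mul_left (C ^ 2)) fun k =>
    (abs_mul_sin_mul_le _ _ _ (Real.abs_sin_le_one _) (Real.abs_sin_le_one _)).trans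
      (abs_sineCoeff_le hβ k)

theorem continuous_sineSeries (hβ : ∀ k, |β k| ≤ C * |(k : ℝ)|⁻¹) :
    Continuous fun p : ℝ × ℝ => sineSeries β p.1 p.2 :=
  continuous_tsum (fun k => by fun_prop) (summable_latticeMajorant.mul_left (C ^ 2)) fun k p =>
    (abs_mul_sin_mul_le _ _ _ (Real.abs_sin_le_one _) (Real.abs_sin_le_one _)).trans
      (abs_sineCoeff_le hβ k)

theorem hasDerivAt_sineSeries (hβ : ∀ k, |β k| ≤ C * |(k : ℝ)|⁻¹) (x y : ℝ) :
    HasDerivAt (fun s => sineSeries β s y)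
      (∑' k : ℤ × ℤ, sineCoeff β k * (2 * Real.pi * k.1) *
        (Real.cos (2 * Real.pi * k.1 * x) * Real.sin (2 * Real.pi * k.2 * y))) x := by
  refine hasDerivAt_tsum (𝕜 := ℝ) (F := ℝ)
    (g := fun (k : ℤ × ℤ) s => sineCoeff β k *
      (Real.sin (2 * Real.pi * k.1 * s) * Real.sin (2 * Real.pi * k.2 * y)))
    (g' := fun (k : ℤ × ℤ) s => sineCoeff β k * (2 * Real.pi * k.1) *
      (Real.cos (2 * Real.pi * k.1 * s) * Real.sin (2 * Real.pi * k.2 * y)))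
    (u := fun k => 2 * Real.pi * (C ^ 2 * latticeMajorant k)) (y₀ := 0)
    ((summable_latticeMajorant.mul_left _).mul_left _) (fun k s => ?_) (fun k s => ?_)
    (summable_sineSeries hβ 0 y) x
  · have h : HasDerivAt (fun s : ℝ => 2 * Real.pi * k.1 * s) (2 * Real.pi * k.1) s := by
      simpa using (hasDerivAt_id s).const_mul (2 * Real.pi * (k.1 : ℝ))
    exact ((h.sin.mul_const (Real.sin (2 * Real.pi * k.2 * y))).const_mul
      (sineCoeff β k)).congr_deriv (by ring)
  · refine (abs_mul_sin_mul_le _ _ _ (Real.abs_cos_le_one _) (Real.abs_sin_le_one _)).trans ?_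
    rw [abs_mul, abs_mul, abs_of_pos Real.two_pi_pos]
    nlinarith [abs_sineCoeff_mul_le hβ k, Real.two_pi_pos]

/-- A second derivative costs another power of `|k|`, hence the extra hypothesis of decay `k⁻²`. It
is available only for the averaged square wave. -/
theorem abs_sineCoeff_mul_sq_le (hβ : ∀ k, |β k| ≤ C * |(k : ℝ)|⁻¹)
    (hβ2 : ∀ k, |β k| ≤ C * |(k : ℝ)|⁻¹ ^ 2) (k : ℤ × ℤ) :
    |sineCoeff β k| * |(k.1 : ℝ)| ^ 2 ≤ C ^ 2 * latticeMajorant k := by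
  obtain ⟨k, l⟩ := k
  have hC : 0 ≤ C := by simpa using (abs_nonneg _).trans (hβ 1)
  by_cases hk : k = 0
  · subst hk
    simpa using mul_nonneg (sq_nonneg C) (latticeMajorant_nonneg (0, l))
  have h := (inv_mul_inv_sq_add_sq_le k l).resolve_right hk
  have hk' : (k : ℝ) ≠ 0 := by exact_mod_cast hk
  have hq : 0 < (k : ℝ) ^ 2 + (l : ℝ) ^ 2 := by positivity
  have hpi : (1 : ℝ) ≤ 4 * Real.pi ^ 2 := by nlinarith [Real.pi_gt_three]
  simp only [sineCoeff]
  rw [abs_div, abs_mul, abs_of_pos (show 0 < 4 * Real.pi ^ 2 * ((k : ℝ) ^ 2 + (l : ℝ) ^ 2) by positivity)]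
  calc |β k| * |β l| / (4 * Real.pi ^ 2 * ((k : ℝ) ^ 2 + (l : ℝ) ^ 2)) * |(k : ℝ)| ^ 2
      ≤ (C * |(k : ℝ)|⁻¹ ^ 2) * (C * |(l : ℝ)|⁻¹) / (1 * ((k : ℝ) ^ 2 + (l : ℝ) ^ 2)) *
          |(k : ℝ)| ^ 2 := by
        gcongr
        · exact hβ2 k
        · exact hβ l
    _ = C ^ 2 * (|(l : ℝ)|⁻¹ * ((k : ℝ) ^ 2 + (l : ℝ) ^ 2)⁻¹) := by
        field_simp
    _ ≤ _ := by gcongr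

theorem hasDerivAt_deriv_sineSeries (hβ : ∀ k, |β k| ≤ C * |(k : ℝ)|⁻¹)
    (hβ2 : ∀ k, |β k| ≤ C * |(k : ℝ)|⁻¹ ^ 2) (x y : ℝ) :
    HasDerivAt (deriv fun s => sineSeries β s y)
      (∑' k : ℤ × ℤ, -(sineCoeff β k * (2 * Real.pi * k.1) ^ 2 *
        (Real.sin (2 * Real.pi * k.1 * x) * Real.sin (2 * Real.pi * k.2 * y)))) x := by
  have hC : 0 ≤ C := by simpa using (abs_nonneg _).trans (hβ 1)
  have e : (deriv fun s => sineSeries β s y) = fun s => ∑' k : ℤ × ℤ,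
      sineCoeff β k * (2 * Real.pi * k.1) *
        (Real.cos (2 * Real.pi * k.1 * s) * Real.sin (2 * Real.pi * k.2 * y)) :=
    funext fun s => (hasDerivAt_sineSeries hβ s y).deriv
  rw [e]
  refine hasDerivAt_tsum (𝕜 := ℝ) (F := ℝ)
    (g := fun (k : ℤ × ℤ) s => sineCoeff β k * (2 * Real.pi * k.1) *
      (Real.cos (2 * Real.pi * k.1 * s) * Real.sin (2 * Real.pi * k.2 * y)))
    (g' := fun (k : ℤ × ℤ) s => -(sineCoeff β k * (2 * Real.pi * k.1) ^ 2 *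
        (Real.sin (2 * Real.pi * k.1 * s) * Real.sin (2 * Real.pi * k.2 * y))))
    (u := fun k => (2 * Real.pi) ^ 2 * (C ^ 2 * latticeMajorant k)) (y₀ := 0)
    ((summable_latticeMajorant.mul_left _).mul_left _) (fun k s => ?_) (fun k s => ?_)
    ?_ x
  · have h : HasDerivAt (fun s : ℝ => 2 * Real.pi * k.1 * s) (2 * Real.pi * k.1) s := by
      simpa using (hasDerivAt_id s).const_mul (2 * Real.pi * (k.1 : ℝ))
    exact ((h.cos.mul_const (Real.sin (2 * Real.pi * k.2 * y))).const_mul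
      (sineCoeff β k * (2 * Real.pi * k.1))).congr_deriv (by ring)
  · rw [norm_neg]
    refine (abs_mul_sin_mul_le _ _ _ (Real.abs_sin_le_one _) (Real.abs_sin_le_one _)).trans ?_
    obtain ⟨k, l⟩ := k
    rw [abs_mul, abs_pow, abs_mul, abs_of_pos Real.two_pi_pos, mul_pow]
    simp only
    nlinarith [abs_sineCoeff_mul_sq_le hβ hβ2 (k, l), sq_nonneg (2 * Real.pi)]
  · refine Summable.of_norm_bounded ((summable_latticeMajorant.mul_left (C ^ 2)).mul_left
      (2 * Real.pi)) fun k => ?_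
    refine (abs_mul_sin_mul_le _ _ _ (Real.abs_cos_le_one _) (Real.abs_sin_le_one _)).trans ?_
    rw [abs_mul, abs_mul, abs_of_pos Real.two_pi_pos]
    nlinarith [abs_sineCoeff_mul_le hβ k, Real.two_pi_pos]

theorem summable_mul_sin (hβ2 : ∀ k, |β k| ≤ C * |(k : ℝ)|⁻¹ ^ 2) (x : ℝ) :
    Summable fun k : ℤ => ‖β k * Real.sin (2 * Real.pi * k * x)‖ := by
  refine Summable.of_nonneg_of_le (fun _ => norm_nonneg _) (fun k => ?_)
    ((Real.summable_one_div_int_pow (p := 2).2 one_lt_two).mul_left C)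
  rw [norm_mul, Real.norm_eq_abs, Real.norm_eq_abs]
  have h := hβ2 k
  rw [inv_pow, sq_abs] at h
  rw [one_div]
  nlinarith [Real.abs_sin_le_one (2 * Real.pi * k * x), abs_nonneg (β k)]

/-- The Laplacian of the double sine series. -/
theorem laplacian_sineSeries (hβ : ∀ k, |β k| ≤ C * |(k : ℝ)|⁻¹)
    (hβ2 : ∀ k, |β k| ≤ C * |(k : ℝ)|⁻¹ ^ 2) (x y : ℝ) :
    ∃ A B : ℝ, HasDerivAt (deriv fun s => sineSeries β s y) A x ∧
      HasDerivAt (deriv fun s => sineSeries β x s) B y ∧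
      A + B = -((∑' k : ℤ, β k * Real.sin (2 * Real.pi * k * x)) *
        ∑' k : ℤ, β k * Real.sin (2 * Real.pi * k * y)) := by
  have hx := hasDerivAt_deriv_sineSeries hβ hβ2 x y
  have hy := hasDerivAt_deriv_sineSeries hβ hβ2 y x
  simp only [sineSeries_comm β _ x] at hy
  refine ⟨_, _, hx, hy, ?_⟩
  -- Exchanging `k` and `l` in the second series puts the same product of sines in both; the factor
  -- `k² + l²` then cancels the denominator and the sum factors.
  rw [← (Equiv.prodComm ℤ ℤ).tsum_eq (fun k : ℤ × ℤ => -(sineCoeff β k * (2 * Real.pi * k.1) ^ 2 *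
        (Real.sin (2 * Real.pi * k.1 * y) * Real.sin (2 * Real.pi * k.2 * x))))]
  have sx := summable_mul_sin hβ2 x
  have sy := summable_mul_sin hβ2 y
  have hb0 : β 0 = 0 := by simpa using hβ 0
  have hbd : ∀ z w : ℝ, Summable fun k : ℤ × ℤ => -(sineCoeff β k * (2 * Real.pi * k.1) ^ 2 *
      (Real.sin (2 * Real.pi * k.1 * z) * Real.sin (2 * Real.pi * k.2 * w))) := fun z w => by
    refine Summable.of_norm_bounded ((summable_latticeMajorant.mul_left (C ^ 2)).mul_left
      ((2 * Real.pi) ^ 2)) fun k => ?_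
    rw [norm_neg]
    refine (abs_mul_sin_mul_le _ _ _ (Real.abs_sin_le_one _) (Real.abs_sin_le_one _)).trans ?_
    rw [abs_mul, abs_pow, abs_mul, abs_of_pos Real.two_pi_pos, mul_pow]
    nlinarith [abs_sineCoeff_mul_sq_le hβ hβ2 k, sq_nonneg (2 * Real.pi)]
  have hyx := (Equiv.prodComm ℤ ℤ).summable_iff.2 (hbd y x)
  simp only [Function.comp_def] at hyx
  rw [← (hbd x y).tsum_add hyx,
    tsum_mul_tsum_of_summable_norm sx sy, ← tsum_neg]
  refine tsum_congr fun k => ?_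
  rw [Equiv.coe_prodComm, sineCoeff_swap]
  obtain ⟨k, l⟩ := k
  simp only [Prod.fst_swap, Prod.snd_swap, sineCoeff]
  -- For `k = l = 0` the denominator vanishes; `β 0 = 0` takes care of the whole column.
  by_cases hk : k = 0
  · subst hk; simp [hb0]
  have hk' : (k : ℝ) ≠ 0 := by exact_mod_cast hk
  have hq : 0 < (k : ℝ) ^ 2 + (l : ℝ) ^ 2 := by positivity
  field_simp
  ring

end Bounds

/-! ### The regularized square wave -/

/-- The factor `cos (πk) = (-1)^k` is a translation by half a period. -/
theorem cos_pi_mul_int_mul_cos (k : ℤ) (z : ℝ) :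
    Real.cos (Real.pi * k) * Real.cos (2 * Real.pi * k * z) =
      Real.cos (2 * Real.pi * k * (z + 1 / 2)) := by
  have h : Real.sin (Real.pi * k) = 0 := by rw [mul_comm]; exact Real.sin_int_mul_pi k
  rw [show 2 * Real.pi * k * (z + 1 / 2) = Real.pi * k + 2 * Real.pi * k * z by ring,
    Real.cos_add, h]
  ring

/-- Real part of the Fourier expansion of the Bernoulli polynomial `B₂`. -/
theorem hasSum_cos_div_sq {z : ℝ} (hz : z ∈ Icc (0 : ℝ) 1) :
    HasSum (fun k : ℤ => Real.cos (2 * Real.pi * k * z) / (k : ℝ) ^ 2)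
      (2 * Real.pi ^ 2 * (z ^ 2 - z + 1 / 6)) := by
  have h := Complex.hasSum_re (hasSum_one_div_pow_mul_fourier_mul_bernoulliFun le_rfl hz)
  convert! h using 1
  · funext k
    rw [fourier_coe_apply]
    have e1 : (2 * Real.pi * Complex.I * k * z / (1 : ℝ) : ℂ) =
        ((2 * Real.pi * k * z : ℝ) : ℂ) * Complex.I := by push_cast; ring
    have e2 : (1 / (k : ℂ) ^ 2) = ((1 / (k : ℝ) ^ 2 : ℝ) : ℂ) := by push_cast; ring
    rw [e1, e2, Complex.re_ofReal_mul, Complex.exp_ofReal_mul_I_re]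
    ring
  · have hb : bernoulliFun 2 z = z ^ 2 - z + 1 / 6 := by
      simp [bernoulliFun, Polynomial.bernoulli, Finset.sum_range_succ, bernoulli,
        Polynomial.eval_add, bernoulli'_two]
      ring
    rw [hb]
    have e : (-(2 * Real.pi * Complex.I) ^ 2 / ((Nat.factorial 2 : ℕ) : ℂ) *
        ((z ^ 2 - z + 1 / 6 : ℝ) : ℂ)) = ((2 * Real.pi ^ 2 * (z ^ 2 - z + 1 / 6) : ℝ) : ℂ) := by
      rw [mul_pow, Complex.I_sq]
      push_cast [Nat.factorial]
      ring
    rw [e, Complex.ofReal_re]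

/-- The triangle wave is the difference of two copies of `B₂` half a period apart. Working with
`|z|` keeps both arguments in `[0, 1]`. -/
theorem hasSum_triangle {z : ℝ} (hz : |z| ≤ 1 / 2) :
    HasSum (fun k : ℤ => (1 - Real.cos (Real.pi * k)) * Real.cos (2 * Real.pi * k * z) /
      (k : ℝ) ^ 2) (2 * Real.pi ^ 2 * (1 / 4 - |z|)) := by
  have h1 := (hasSum_cos_div_sq (z := |z|) ⟨abs_nonneg z, by linarith⟩).sub
    (hasSum_cos_div_sq (z := |z| + 1 / 2) ⟨by positivity, by linarith⟩)
  convert! h1 using 1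
  · funext k
    rw [← cos_pi_mul_int_mul_cos]
    have : Real.cos (2 * Real.pi * k * |z|) = Real.cos (2 * Real.pi * k * z) := by
      rcases abs_choice z with h | h <;> rw [h]
      rw [mul_neg, Real.cos_neg]
    rw [this]
    ring
  · ring

/-- The Fourier sine coefficients of the square wave `sgn`. -/
def squareCoeff (k : ℤ) : ℝ := (1 - Real.cos (Real.pi * k)) / (Real.pi * k)

/-- The Fourier sine coefficients of the square wave averaged over intervals of radius `h`. -/
def trapezoidCoeff (h : ℝ) (k : ℤ) : ℝ := squareCoeff k * Real.sinc (2 * Real.pi * k * h)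

/-- Averaging over radius `h` is a difference quotient of the primitive, and the primitive of the
square wave is a triangle wave; on coefficients this is the product formula for sines. -/
theorem trapezoidCoeff_mul_sin {h : ℝ} (hh : 0 < h) (k : ℤ) (x : ℝ) :
    trapezoidCoeff h k * Real.sin (2 * Real.pi * k * x) =
      (1 / (4 * Real.pi ^ 2 * h)) *
        ((1 - Real.cos (Real.pi * k)) * Real.cos (2 * Real.pi * k * (x - h)) / (k : ℝ) ^ 2 -
        (1 - Real.cos (Real.pi * k)) * Real.cos (2 * Real.pi * k * (x + h)) / (k : ℝ) ^ 2) := by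
  by_cases hk : k = 0
  · subst hk; simp
  have hk' : (k : ℝ) ≠ 0 := by exact_mod_cast hk
  have hpi := Real.pi_ne_zero
  rw [trapezoidCoeff, squareCoeff, Real.sinc_of_ne_zero (by positivity),
    show 2 * Real.pi * k * (x - h) = 2 * Real.pi * k * x - 2 * Real.pi * k * h by ring,
    show 2 * Real.pi * k * (x + h) = 2 * Real.pi * k * x + 2 * Real.pi * k * h by ring,
    Real.cos_sub, Real.cos_add]
  field_simp
  ring

/-- The right side is `min x h / h`: the rising ramp and the plateau of the trapezoid. -/
theorem tsum_trapezoid {h x : ℝ} (hh : 0 < h) (hx : 0 ≤ x) (hxh : x + h ≤ 1 / 2) :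
    ∑' k : ℤ, trapezoidCoeff h k * Real.sin (2 * Real.pi * k * x) =
      (x + h - |x - h|) / (2 * h) := by
  have h1 : |x - h| ≤ 1 / 2 := by rw [abs_le]; constructor <;> linarith
  have h2 : |x + h| ≤ 1 / 2 := by rw [abs_of_nonneg (by linarith)]; exact hxh
  simp only [trapezoidCoeff_mul_sin hh]
  rw [(((hasSum_triangle h1).sub (hasSum_triangle h2)).mul_left _).tsum_eq,
    abs_of_nonneg (show 0 ≤ x + h by linarith)]
  have hpi := Real.pi_ne_zero
  field_simp
  ring

theorem tsum_trapezoid' {h x : ℝ} (hh : 0 < h) (hx : h ≤ x) (hx2 : x ≤ 1 / 2)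
    (hxh : 1 / 2 ≤ x + h) :
    ∑' k : ℤ, trapezoidCoeff h k * Real.sin (2 * Real.pi * k * x) = (1 / 2 - x) / h := by
  have h1 : |x - h| ≤ 1 / 2 := by rw [abs_le]; constructor <;> linarith
  have h2 : |x + h - 1| ≤ 1 / 2 := by rw [abs_le]; constructor <;> linarith
  -- Here `x + h` has left the interval where the triangle formula applies, so it is moved back by
  -- one period.
  have e : ∀ k : ℤ, Real.cos (2 * Real.pi * k * (x + h)) =
      Real.cos (2 * Real.pi * k * (x + h - 1)) := fun k => by
    rw [show 2 * Real.pi * k * (x + h) = 2 * Real.pi * k * (x + h - 1) + k * (2 * Real.pi) by ring,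
      Real.cos_add_int_mul_two_pi]
  simp only [trapezoidCoeff_mul_sin hh, e]
  rw [(((hasSum_triangle h1).sub (hasSum_triangle h2)).mul_left _).tsum_eq,
    abs_of_nonneg (show 0 ≤ x - h by linarith), abs_of_nonpos (show x + h - 1 ≤ 0 by linarith)]
  have hpi := Real.pi_ne_zero
  field_simp
  ring

theorem tsum_trapezoid_pos {h x : ℝ} (hh : 0 < h) (hh8 : h ≤ 1 / 8) (hx : 0 < x) (hx2 : x < 1 / 2) :
    0 < ∑' k : ℤ, trapezoidCoeff h k * Real.sin (2 * Real.pi * k * x) := by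
  rcases le_total (x + h) (1 / 2) with h1 | h1
  · rw [tsum_trapezoid hh hx.le h1]
    have : |x - h| < x + h := by rw [abs_lt]; constructor <;> linarith
    exact div_pos (by linarith) (by linarith)
  · rw [tsum_trapezoid' hh (by linarith) hx2.le h1]
    exact div_pos (by linarith) hh

theorem abs_squareCoeff_le (k : ℤ) : |squareCoeff k| ≤ 1 * |(k : ℝ)|⁻¹ := by
  have h1 := Real.cos_le_one (Real.pi * k)
  have h2 := Real.neg_one_le_cos (Real.pi * k)
  rw [squareCoeff, abs_div, abs_mul, abs_of_pos Real.pi_pos, abs_of_nonneg (by linarith), one_mul,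
    div_mul_eq_div_div, div_eq_mul_inv _ |(k : ℝ)|]
  have : (1 - Real.cos (Real.pi * k)) / Real.pi ≤ 1 := by
    rw [div_le_one Real.pi_pos]; linarith [Real.pi_gt_three]
  nlinarith [inv_nonneg.2 (abs_nonneg (k : ℝ))]

theorem abs_trapezoidCoeff_le_squareCoeff (h : ℝ) (k : ℤ) :
    |trapezoidCoeff h k| ≤ |squareCoeff k| := by
  rw [trapezoidCoeff, abs_mul]
  have := Real.abs_sinc_le_one (2 * Real.pi * k * h)
  nlinarith [abs_nonneg (squareCoeff k)]

/-- The constant `h⁻¹` is wasteful, but `laplacian_sineSeries` takes a single constant for both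
decay rates and `h⁻¹` is the one for `k⁻²`. -/
theorem abs_trapezoidCoeff_le {h : ℝ} (hh : 0 < h) (hh1 : h ≤ 1) (k : ℤ) :
    |trapezoidCoeff h k| ≤ h⁻¹ * |(k : ℝ)|⁻¹ := by
  refine (abs_trapezoidCoeff_le_squareCoeff h k).trans ((abs_squareCoeff_le k).trans ?_)
  gcongr
  exact (one_le_inv₀ hh).2 hh1

theorem abs_trapezoidCoeff_le_sq {h : ℝ} (hh : 0 < h) (k : ℤ) :
    |trapezoidCoeff h k| ≤ h⁻¹ * |(k : ℝ)|⁻¹ ^ 2 := by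
  by_cases hk : k = 0
  · subst hk; simp [trapezoidCoeff, squareCoeff]
  have hk' : (k : ℝ) ≠ 0 := by exact_mod_cast hk
  rw [trapezoidCoeff, abs_mul, Real.sinc_of_ne_zero (by positivity), abs_div, abs_mul _ h,
    abs_mul _ (k : ℝ), abs_of_pos Real.two_pi_pos, abs_of_pos hh]
  calc |squareCoeff k| * (|Real.sin (2 * Real.pi * k * h)| / (2 * Real.pi * |(k : ℝ)| * h))
      ≤ (1 * |(k : ℝ)|⁻¹) * (1 / (1 * |(k : ℝ)| * h)) := by
        gcongr
        · exact abs_squareCoeff_le k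
        · exact Real.abs_sin_le_one _
        · linarith [Real.pi_gt_three]
    _ = _ := by field_simp

/-! ### A minimum principle on the square -/

/-- A negative second derivative at the critical point would make it a local maximum too; then `f`
is locally constant and the second derivative is zero after all. -/
theorem deriv_deriv_nonneg_of_isLocalMin {f : ℝ → ℝ} {x : ℝ} (hf : IsLocalMin f x)
    (hc : ContinuousAt f x) : 0 ≤ deriv (deriv f) x := by
  by_contra! h
  have hmax := isLocalMax_of_deriv_deriv_neg h hf.deriv_eq_zero hc
  have heq : f =ᶠ[𝓝 x] fun _ => f x := by
    filter_upwards [hf, hmax] with y h1 h2 using le_antisymm h2 h1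
  have h2 := heq.deriv.deriv_eq
  simp at h2
  linarith

/-- Because the Laplacian is strictly negative inside, a minimum there contradicts the
one-dimensional second derivative test in each variable, without any perturbation of `v`. -/
theorem nonneg_of_superharmonic_square {v : ℝ → ℝ → ℝ} {a : ℝ}
    (hv : Continuous fun p : ℝ × ℝ => v p.1 p.2)
    (hΔ : ∀ x y, 0 < x → x < a → 0 < y → y < a →
      deriv (deriv fun s => v s y) x + deriv (deriv fun s => v x s) y < 0)
    (hb : ∀ x y, 0 ≤ x → x ≤ a → 0 ≤ y → y ≤ a → (x = 0 ∨ x = a ∨ y = 0 ∨ y = a) → 0 ≤ v x y)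
    {x y : ℝ} (hx0 : 0 ≤ x) (hxa : x ≤ a) (hy0 : 0 ≤ y) (hya : y ≤ a) : 0 ≤ v x y := by
  obtain ⟨⟨x₀, y₀⟩, hp, hmin⟩ := (isCompact_Icc (a := (0 : ℝ)) (b := a)).prod
    (isCompact_Icc (a := (0 : ℝ)) (b := a)) |>.exists_isMinOn ⟨(x, y), ⟨hx0, hxa⟩, hy0, hya⟩
    hv.continuousOn
  obtain ⟨⟨h1, h2⟩, h3, h4⟩ := hp
  have hle : ∀ s t, s ∈ Icc 0 a → t ∈ Icc 0 a → v x₀ y₀ ≤ v s t :=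
    fun s t hs ht => hmin (show (s, t) ∈ _ from ⟨hs, ht⟩)
  refine le_trans ?_ (hle x y ⟨hx0, hxa⟩ ⟨hy0, hya⟩)
  by_cases hbd : x₀ = 0 ∨ x₀ = a ∨ y₀ = 0 ∨ y₀ = a
  · exact hb _ _ h1 h2 h3 h4 hbd
  push Not at hbd
  obtain ⟨b1, b2, b3, b4⟩ := hbd
  have hx := And.intro (lt_of_le_of_ne h1 (Ne.symm b1)) (lt_of_le_of_ne h2 b2)
  have hy := And.intro (lt_of_le_of_ne h3 (Ne.symm b3)) (lt_of_le_of_ne h4 b4)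
  exfalso
  have k1 : IsLocalMin (fun s => v s y₀) x₀ := by
    filter_upwards [Ioo_mem_nhds hx.1 hx.2] with s hs
    exact hle _ _ (Ioo_subset_Icc_self hs) ⟨h3, h4⟩
  have k2 : IsLocalMin (fun s => v x₀ s) y₀ := by
    filter_upwards [Ioo_mem_nhds hy.1 hy.2] with s hs
    exact hle _ _ ⟨h1, h2⟩ (Ioo_subset_Icc_self hs)
  have c1 : Continuous fun s => v s y₀ := hv.comp (by fun_prop : Continuous fun s : ℝ => (s, y₀))
  have c2 : Continuous fun s => v x₀ s := hv.comp (by fun_prop : Continuous fun s : ℝ => (x₀, s))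
  have := hΔ x₀ y₀ hx.1 hx.2 hy.1 hy.2
  linarith [deriv_deriv_nonneg_of_isLocalMin k1 c1.continuousAt,
    deriv_deriv_nonneg_of_isLocalMin k2 c2.continuousAt]

/-! ### Logarithmic lower bound -/

theorem sineSeries_zero_left (β : ℤ → ℝ) (y : ℝ) : sineSeries β 0 y = 0 := by simp [sineSeries]

theorem sineSeries_half_left (β : ℤ → ℝ) (y : ℝ) : sineSeries β (1 / 2) y = 0 := by
  have : ∀ k : ℤ, Real.sin (2 * Real.pi * k * (1 / 2)) = 0 := fun k => by
    rw [show 2 * Real.pi * k * (1 / 2) = k * Real.pi by ring, Real.sin_int_mul_pi]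
  simp only [sineSeries, this]
  simp

/-- The series vanishes on the boundary of `[0, 1/2]²`, and its Laplacian is minus a product of two
trapezoids, positive inside. -/
theorem sineSeries_trapezoid_nonneg {h : ℝ} (hh : 0 < h) (hh8 : h ≤ 1 / 8) {x y : ℝ}
    (hx0 : 0 ≤ x) (hxa : x ≤ 1 / 2) (hy0 : 0 ≤ y) (hya : y ≤ 1 / 2) :
    0 ≤ sineSeries (trapezoidCoeff h) x y := by
  have b1 := abs_trapezoidCoeff_le hh (by linarith)
  refine nonneg_of_superharmonic_square (continuous_sineSeries b1) (fun x y x1 x2 y1 y2 => ?_)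
    (fun x y _ _ _ _ hb => ?_) hx0 hxa hy0 hya
  · obtain ⟨A, B, hA, hB, hAB⟩ := laplacian_sineSeries b1 (abs_trapezoidCoeff_le_sq hh) x y
    rw [hA.deriv, hB.deriv, hAB]
    exact neg_neg_of_pos (mul_pos (tsum_trapezoid_pos hh hh8 x1 x2)
      (tsum_trapezoid_pos hh hh8 y1 y2))
  · refine le_of_eq ?_
    rcases hb with rfl | rfl | rfl | rfl
    · rw [sineSeries_zero_left]
    · rw [sineSeries_half_left]
    · rw [sineSeries_comm, sineSeries_zero_left]
    · rw [sineSeries_comm, sineSeries_half_left]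

/-- `xy log (κ (x² + y² + h²))` -/
def logBarrier (κ h x y : ℝ) : ℝ := x * y * Real.log (κ * (x ^ 2 + y ^ 2 + h ^ 2))

theorem hasDerivAt_deriv_logBarrier {κ h : ℝ} (hκ : 0 < κ) (hh : 0 < h) (x y : ℝ) :
    HasDerivAt (fun s => logBarrier κ h s y) (y * Real.log (κ * (x ^ 2 + y ^ 2 + h ^ 2)) +
      2 * x ^ 2 * y / (x ^ 2 + y ^ 2 + h ^ 2)) x ∧
    HasDerivAt (deriv fun s => logBarrier κ h s y)
      (6 * x * y / (x ^ 2 + y ^ 2 + h ^ 2) - 4 * x ^ 3 * y / (x ^ 2 + y ^ 2 + h ^ 2) ^ 2) x := by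
  have hq : ∀ s : ℝ, 0 < s ^ 2 + y ^ 2 + h ^ 2 := fun s => by positivity
  have dq : ∀ s : ℝ, HasDerivAt (fun s : ℝ => s ^ 2 + y ^ 2 + h ^ 2) (2 * s) s := fun s => by
    simpa using ((hasDerivAt_pow 2 s).add_const (y ^ 2)).add_const (h ^ 2)
  have dlog : ∀ s : ℝ, HasDerivAt (fun s : ℝ => Real.log (κ * (s ^ 2 + y ^ 2 + h ^ 2)))
      (2 * s / (s ^ 2 + y ^ 2 + h ^ 2)) s := fun s => by
    have := ((dq s).const_mul κ).log (mul_pos hκ (hq s)).ne'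
    refine this.congr_deriv ?_
    have := (hq s).ne'
    field_simp
  have d1 : ∀ s, HasDerivAt (fun s => logBarrier κ h s y)
      (y * Real.log (κ * (s ^ 2 + y ^ 2 + h ^ 2)) +
        2 * s ^ 2 * y / (s ^ 2 + y ^ 2 + h ^ 2)) s := fun s => by
    refine (((hasDerivAt_id s).mul_const y).mul (dlog s)).congr_deriv ?_
    simp only [id]
    ring
  refine ⟨d1 x, ?_⟩
  rw [show (deriv fun s => logBarrier κ h s y) = _ from funext fun s => (d1 s).deriv]
  refine (((dlog x).const_mul y).add ((((hasDerivAt_pow 2 x).const_mul 2).mul_const y).div (dq x)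
    (hq x).ne')).congr_deriv ?_
  have := (hq x).ne'
  push_cast
  field_simp
  ring

theorem logBarrier_comm (κ h x y : ℝ) : logBarrier κ h x y = logBarrier κ h y x := by
  rw [logBarrier, logBarrier, mul_comm x, add_comm (x ^ 2)]

/-- The left side dominates the Laplacian of `1/13` of the barrier: each of its two second
derivatives contributes at most `6xy / (x² + y² + h²)`. Any denominator above `12` would leave room
for the strict inequality. -/
theorem mul_div_lt_trapezoid {h x y : ℝ} (hh : 0 < h) (hx : 0 < x) (hy : 0 < y) :
    12 / 13 * (x * y / (x ^ 2 + y ^ 2 + h ^ 2)) <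
      (x + h - |x - h|) / (2 * h) * ((y + h - |y - h|) / (2 * h)) := by
  have hq : 0 < x ^ 2 + y ^ 2 + h ^ 2 := by positivity
  have e : ∀ z : ℝ, (z ≤ h → (z + h - |z - h|) / (2 * h) = z / h) ∧
      (h ≤ z → (z + h - |z - h|) / (2 * h) = 1) := fun z => by
    constructor
    · intro hz; rw [abs_of_nonpos (by linarith)]; field_simp; ring
    · intro hz; rw [abs_of_nonneg (by linarith)]; field_simp; ring
  have hpos : 0 < x * y / (x ^ 2 + y ^ 2 + h ^ 2) := by positivity
  refine lt_of_lt_of_le (b := x * y / (x ^ 2 + y ^ 2 + h ^ 2)) (by linarith) ?_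
  rcases le_total x h with h1 | h1 <;> rcases le_total y h with h2 | h2
  · rw [(e x).1 h1, (e y).1 h2, div_mul_div_comm]
    gcongr
    nlinarith
  · rw [(e x).1 h1, (e y).2 h2, mul_one, div_le_div_iff₀ hq hh]
    have : y * h ≤ y * y := by gcongr
    nlinarith [mul_le_mul_of_nonneg_left this hx.le, pow_pos hx 3, mul_pos hx (pow_pos hh 2)]
  · rw [(e x).2 h1, (e y).1 h2, one_mul, div_le_div_iff₀ hq hh]
    have : x * h ≤ x * x := by gcongr
    nlinarith [mul_le_mul_of_nonneg_left this hy.le, pow_pos hy 3, mul_pos hy (pow_pos hh 2)]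
  · rw [(e x).2 h1, (e y).2 h2, one_mul, div_le_one hq]
    nlinarith [sq_nonneg (x - y), sq_nonneg h]

theorem deriv_deriv_add_const_mul {f g : ℝ → ℝ} {c A B x : ℝ} (hf : Differentiable ℝ f)
    (hg : Differentiable ℝ g) (hA : HasDerivAt (deriv f) A x) (hB : HasDerivAt (deriv g) B x) :
    deriv (deriv fun s => f s + c * g s) x = A + c * B := by
  have : (deriv fun s => f s + c * g s) = fun s => deriv f s + c * deriv g s :=
    funext fun s => ((hf s).hasDerivAt.add ((hg s).hasDerivAt.const_mul c)).deriv
  rw [this]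
  exact (hA.add (hB.const_mul c)).deriv

/-- The side `3/8` keeps `x + h ≤ 1/2`, away from the falling ramp, and `64/9 = (3/8)⁻²` makes the
logarithm non-negative on the two outer sides. On the axes the barrier vanishes and positivity of
the series suffices. -/
theorem sineSeries_trapezoid_ge {h : ℝ} (hh : 0 < h) (hh8 : h ≤ 1 / 8) {x y : ℝ}
    (hx0 : 0 ≤ x) (hxa : x ≤ 3 / 8) (hy0 : 0 ≤ y) (hya : y ≤ 3 / 8) :
    0 ≤ sineSeries (trapezoidCoeff h) x y + 1 / 13 * logBarrier (64 / 9) h x y := by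
  have b1 := abs_trapezoidCoeff_le hh (by linarith)
  have cl : Continuous fun p : ℝ × ℝ => logBarrier (64 / 9) h p.1 p.2 := by
    unfold logBarrier
    refine (by fun_prop : Continuous fun p : ℝ × ℝ => p.1 * p.2).mul
      (Continuous.log (by fun_prop) fun p => ?_)
    positivity
  refine nonneg_of_superharmonic_square
    (v := fun x y => sineSeries (trapezoidCoeff h) x y + 1 / 13 * logBarrier (64 / 9) h x y)
    ((continuous_sineSeries b1).add (cl.const_mul _)) (fun x y x1 x2 y1 y2 => ?_)
    (fun x y x1 x2 y1 y2 hb => ?_) hx0 hxa hy0 hya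
  · obtain ⟨A, B, hA, hB, hAB⟩ := laplacian_sineSeries b1 (abs_trapezoidCoeff_le_sq hh) x y
    have lx := fun s => hasDerivAt_deriv_logBarrier (κ := 64 / 9) (by norm_num) hh s y
    have ly := fun s => hasDerivAt_deriv_logBarrier (κ := 64 / 9) (by norm_num) hh s x
    simp only [logBarrier_comm _ _ _ x] at ly
    have k2 := fun s => hasDerivAt_sineSeries b1 s x
    simp only [sineSeries_comm _ _ x] at k2
    rw [deriv_deriv_add_const_mul (fun s => (hasDerivAt_sineSeries b1 s y).differentiableAt)
        (fun s => (lx s).1.differentiableAt) hA (lx x).2,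
      deriv_deriv_add_const_mul (fun s => (k2 s).differentiableAt)
        (fun s => (ly s).1.differentiableAt) hB (ly y).2]
    rw [tsum_trapezoid hh x1.le (by linarith), tsum_trapezoid hh y1.le (by linarith)] at hAB
    have key := mul_div_lt_trapezoid hh x1 y1
    have n1 : 0 ≤ 4 * x ^ 3 * y / (x ^ 2 + y ^ 2 + h ^ 2) ^ 2 := by positivity
    have n2 : 0 ≤ 4 * y ^ 3 * x / (y ^ 2 + x ^ 2 + h ^ 2) ^ 2 := by positivity
    have e1 : 6 * y * x / (y ^ 2 + x ^ 2 + h ^ 2) = 6 * (x * y / (x ^ 2 + y ^ 2 + h ^ 2)) := by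
      rw [add_comm (y ^ 2)]; ring
    have e2 : 6 * x * y / (x ^ 2 + y ^ 2 + h ^ 2) = 6 * (x * y / (x ^ 2 + y ^ 2 + h ^ 2)) := by ring
    rw [e1, e2]
    linarith
  · have hs := sineSeries_trapezoid_nonneg hh hh8 x1 (by linarith) y1 (by linarith)
    have hl : (x = 3 / 8 ∨ y = 3 / 8) → 0 ≤ logBarrier (64 / 9) h x y := by
      intro hxy
      refine mul_nonneg (mul_nonneg x1 y1) (Real.log_nonneg ?_)
      rcases hxy with rfl | rfl <;> nlinarith [sq_nonneg x, sq_nonneg y, sq_nonneg h]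
    have h0 : (x = 0 ∨ y = 0) → logBarrier (64 / 9) h x y = 0 := by
      rintro (rfl | rfl) <;> simp [logBarrier]
    rcases hb with hb | hb | hb | hb
    · rw [h0 (Or.inl hb)]; linarith
    · linarith [hl (Or.inl hb)]
    · rw [h0 (Or.inr hb)]; linarith
    · linarith [hl (Or.inr hb)]

/-- As `|sinc| ≤ 1` and `sinc 0 = 1`, the averaged coefficients are dominated by those of the square
wave and converge to them. -/
theorem tendsto_sineSeries_trapezoid (x y : ℝ) :
    Tendsto (fun h => sineSeries (trapezoidCoeff h) x y) (𝓝 0) (𝓝 (sineSeries squareCoeff x y)) := by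
  refine tendsto_tsum_of_dominated_convergence
    (bound := fun k => (1 : ℝ) ^ 2 * latticeMajorant k)
    (summable_latticeMajorant.mul_left _) (fun k => ?_) (Eventually.of_forall fun h k => ?_)
  · have : Continuous fun h => sineCoeff (trapezoidCoeff h) k *
        (Real.sin (2 * Real.pi * k.1 * x) * Real.sin (2 * Real.pi * k.2 * y)) := by
      unfold sineCoeff trapezoidCoeff
      have := Real.continuous_sinc
      fun_prop
    have h0 := this.tendsto 0
    simpa [sineCoeff, trapezoidCoeff] using h0
  · exact (abs_mul_sin_mul_le _ _ _ (Real.abs_sin_le_one _) (Real.abs_sin_le_one _)).trans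
      (abs_sineCoeff_le (fun k => (abs_trapezoidCoeff_le_squareCoeff h k).trans
        (abs_squareCoeff_le k)) k)

theorem sineSeries_square_ge {x y : ℝ} (hx0 : 0 < x) (hxa : x ≤ 3 / 8) (hy0 : 0 < y)
    (hya : y ≤ 3 / 8) :
    1 / 13 * (x * y * -Real.log (64 / 9 * (x ^ 2 + y ^ 2))) ≤ sineSeries squareCoeff x y := by
  have h1 : Tendsto (fun h => sineSeries (trapezoidCoeff h) x y +
      1 / 13 * logBarrier (64 / 9) h x y) (𝓝[>] 0)
      (𝓝 (sineSeries squareCoeff x y + 1 / 13 * logBarrier (64 / 9) 0 x y)) := by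
    refine Tendsto.mono_left (Tendsto.add (tendsto_sineSeries_trapezoid x y) ?_)
      nhdsWithin_le_nhds
    refine Tendsto.const_mul _ (ContinuousAt.tendsto ?_)
    unfold logBarrier
    refine ContinuousAt.mul (by fun_prop) (ContinuousAt.log (by fun_prop) ?_)
    positivity
  have h2 : 0 ≤ sineSeries squareCoeff x y + 1 / 13 * logBarrier (64 / 9) 0 x y := by
    refine ge_of_tendsto h1 ?_
    filter_upwards [Ioo_mem_nhdsGT (show (0 : ℝ) < 1 / 8 by norm_num)] with h hh
    exact sineSeries_trapezoid_ge hh.1 hh.2.le hx0.le hxa hy0.le hya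
  rw [logBarrier] at h2
  simp only [ne_eq, OfNat.ofNat_ne_zero, not_false_eq_true, zero_pow, add_zero] at h2
  linarith

/-! ### The Bahouri-Chemin stream function as a sine series -/

theorem sgnCircle_coe {x : ℝ} (hx : x ∈ Ioc (-1 / 2 : ℝ) (1 / 2)) :
    sgnCircle (x : UnitAddCircle) = sgn x := by
  rw [sgnCircle, AddCircle.equivIoc_coe_eq]
  constructor <;> linarith [hx.1, hx.2]

theorem integral_exp_half (k : ℤ) (hk : k ≠ 0) (s : ℝ) :
    ∫ x in (0 : ℝ)..s, Complex.exp (-(2 * Real.pi * Complex.I * k) * x) =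
      (Complex.exp (-(2 * Real.pi * Complex.I * k) * s) - 1) / (-(2 * Real.pi * Complex.I * k)) := by
  have h : (-(2 * Real.pi * Complex.I * k) : ℂ) ≠ 0 := by
    simp [Real.pi_ne_zero, hk]
  rw [integral_exp_mul_complex h]
  simp

theorem fourierCoeff_sgnCircle (k : ℤ) :
    fourierCoeff (fun θ : UnitAddCircle => (sgnCircle θ : ℂ)) k =
      -Complex.I * (squareCoeff k : ℂ) := by
  have hf : ∀ x : ℝ, (fourier (-k) (x : UnitAddCircle) : ℂ) =
      Complex.exp (-(2 * Real.pi * Complex.I * k) * x) := fun x => by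
    rw [fourier_coe_apply]; congr 1; push_cast; ring
  have hc : Continuous fun x : ℝ => Complex.exp (-(2 * Real.pi * Complex.I * k) * x) := by fun_prop
  have e1 : ∫ x in (-1 / 2 : ℝ)..0, (fourier (-k) (x : UnitAddCircle) : ℂ) •
      (sgnCircle (x : UnitAddCircle) : ℂ) =
      ∫ x in (-1 / 2 : ℝ)..0, -Complex.exp (-(2 * Real.pi * Complex.I * k) * x) := by
    refine intervalIntegral.integral_congr_ae (ae_of_all _ fun x hx => ?_)
    rw [uIoc_of_le (by norm_num)] at hx
    rw [sgnCircle_coe ⟨hx.1, by linarith [hx.2]⟩, hf, sgn, if_neg (by linarith [hx.2])]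
    simp
  have e2 : ∫ x in (0 : ℝ)..(1 / 2), (fourier (-k) (x : UnitAddCircle) : ℂ) •
      (sgnCircle (x : UnitAddCircle) : ℂ) =
      ∫ x in (0 : ℝ)..(1 / 2), Complex.exp (-(2 * Real.pi * Complex.I * k) * x) := by
    refine intervalIntegral.integral_congr_ae (ae_of_all _ fun x hx => ?_)
    rw [uIoc_of_le (by norm_num)] at hx
    rw [sgnCircle_coe ⟨by linarith [hx.1], hx.2⟩, hf, sgn, if_pos hx.1]
    simp
  have i1 : IntervalIntegrable (fun x : ℝ => (fourier (-k) (x : UnitAddCircle) : ℂ) •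
      (sgnCircle (x : UnitAddCircle) : ℂ)) volume (-1 / 2) 0 := by
    refine (hc.neg.intervalIntegrable _ _).congr fun x hx => ?_
    rw [uIoc_of_le (by norm_num)] at hx
    rw [sgnCircle_coe ⟨hx.1, by linarith [hx.2]⟩, hf, sgn, if_neg (by linarith [hx.2])]
    simp
  have i2 : IntervalIntegrable (fun x : ℝ => (fourier (-k) (x : UnitAddCircle) : ℂ) •
      (sgnCircle (x : UnitAddCircle) : ℂ)) volume 0 (1 / 2) := by
    refine (hc.intervalIntegrable _ _).congr fun x hx => ?_
    rw [uIoc_of_le (by norm_num)] at hx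
    rw [sgnCircle_coe ⟨by linarith [hx.1], hx.2⟩, hf, sgn, if_pos hx.1]
    simp
  rw [fourierCoeff_eq_intervalIntegral _ k (-1 / 2), show (-1 / 2 + 1 : ℝ) = 1 / 2 by norm_num,
    ← intervalIntegral.integral_add_adjacent_intervals i1 i2, e1, e2, intervalIntegral.integral_neg,
    intervalIntegral.integral_symm, neg_neg]
  rw [show (1 / 1 : ℝ) = 1 by norm_num, one_smul]
  by_cases hk : k = 0
  · subst hk
    simp [squareCoeff]
    norm_num
  rw [integral_exp_half k hk, integral_exp_half k hk]
  have t1 : (-(2 * Real.pi * Complex.I * k) * ((-1 / 2 : ℝ) : ℂ)) =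
      ((Real.pi * k : ℝ) : ℂ) * Complex.I := by push_cast; ring
  have t2 : (-(2 * Real.pi * Complex.I * k) * ((1 / 2 : ℝ) : ℂ)) =
      -((Real.pi * k : ℝ) : ℂ) * Complex.I := by push_cast; ring
  rw [t1, t2, Complex.exp_mul_I, Complex.exp_mul_I, Complex.cos_neg, Complex.sin_neg, squareCoeff]
  have hk' : (k : ℂ) ≠ 0 := by exact_mod_cast hk
  have hpi : (Real.pi : ℂ) ≠ 0 := by exact_mod_cast Real.pi_ne_zero
  push_cast
  field_simp
  linear_combination (2 * (1 - Complex.cos (Real.pi * k))) * Complex.I_sq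

theorem integral_torus_mul {𝕜 : Type*} [RCLike 𝕜] (f g : UnitAddCircle → 𝕜) :
    ∫ q : T2, f (q 0) * g (q 1) ∂torusMeasure =
      (∫ θ, f θ ∂AddCircle.haarAddCircle) * ∫ θ, g θ ∂AddCircle.haarAddCircle := by
  have h := integral_fintype_prod_eq_prod (ι := Fin 2) (𝕜 := 𝕜)
    (μ := fun _ => (AddCircle.haarAddCircle : Measure UnitAddCircle)) ![f, g]
  simp only [Fin.prod_univ_two] at h
  exact h

theorem mFourierCoeff_sgn_mul_sgn (k : Fin 2 → ℤ) :
    UnitAddTorus.mFourierCoeff (fun q : T2 => ((sgnCircle (q 0) * sgnCircle (q 1) : ℝ) : ℂ)) k =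
      -((squareCoeff (k 0) * squareCoeff (k 1) : ℝ) : ℂ) := by
  have h : UnitAddTorus.mFourierCoeff
      (fun q : T2 => ((sgnCircle (q 0) * sgnCircle (q 1) : ℝ) : ℂ)) k =
      ∫ q : T2, (fourier (-k 0) (q 0) • (sgnCircle (q 0) : ℂ)) *
        (fourier (-k 1) (q 1) • (sgnCircle (q 1) : ℂ)) ∂torusMeasure := by
    refine integral_congr_ae (ae_of_all _ fun q => ?_)
    simp only [UnitAddTorus.mFourier, Fin.prod_univ_two, ContinuousMap.coe_mk, Pi.neg_apply,
      smul_eq_mul]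
    push_cast
    ring
  rw [h, integral_torus_mul (fun θ => fourier (-k 0) θ • (sgnCircle θ : ℂ))
    (fun θ => fourier (-k 1) θ • (sgnCircle θ : ℂ))]
  have e := fun i : Fin 2 => fourierCoeff_sgnCircle (k i)
  simp only [fourierCoeff] at e
  rw [e 0, e 1]
  push_cast
  linear_combination (squareCoeff (k 0) : ℂ) * (squareCoeff (k 1)) * Complex.I_sq

theorem tsum_eq_zero_of_odd {f : ℤ × ℤ → ℝ} (h : ∀ k : ℤ × ℤ, f (-k.1, k.2) = -f k) :
    ∑' k, f k = 0 := by
  have e := ((Equiv.neg ℤ).prodCongr (Equiv.refl ℤ)).tsum_eq f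
  have : (fun k : ℤ × ℤ => f (((Equiv.neg ℤ).prodCongr (Equiv.refl ℤ)) k)) = fun k => -f k :=
    funext fun k => h k
  rw [this, tsum_neg] at e
  linarith

theorem squareCoeff_neg (k : ℤ) : squareCoeff (-k) = -squareCoeff k := by
  simp only [squareCoeff, Int.cast_neg, mul_neg, Real.cos_neg, div_neg]

/-- The real part of each exponential is `cos cos - sin sin`. The coefficients are odd in each
frequency, so the cosine products cancel. The term at frequency zero is `0` on both sides. -/
theorem psi0_proj (p : Fin 2 → ℝ) : psi0 (proj p) = -sineSeries squareCoeff (p 0) (p 1) := by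
  have hterm : ∀ k : Fin 2 → ℤ,
      ((-1 / (4 * Real.pi ^ 2 * ((k 0 : ℝ) ^ 2 + (k 1 : ℝ) ^ 2)) : ℝ) : ℂ) *
        UnitAddTorus.mFourierCoeff
          (fun q : T2 => ((sgnCircle (q 0) * sgnCircle (q 1) : ℝ) : ℂ)) k *
          UnitAddTorus.mFourier k (proj p) =
      (sineCoeff squareCoeff (k 0, k 1) : ℂ) *
        Complex.exp (((2 * Real.pi * k 0 * p 0 + 2 * Real.pi * k 1 * p 1 : ℝ) : ℂ) * Complex.I) := by
    intro k
    have e : UnitAddTorus.mFourier k (proj p) =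
        Complex.exp (((2 * Real.pi * k 0 * p 0 + 2 * Real.pi * k 1 * p 1 : ℝ) : ℂ) * Complex.I) := by
      simp only [UnitAddTorus.mFourier, Fin.prod_univ_two, ContinuousMap.coe_mk, proj]
      rw [fourier_coe_apply, fourier_coe_apply, ← Complex.exp_add]
      congr 1
      push_cast
      ring
    rw [mFourierCoeff_sgn_mul_sgn, e]
    congr 1
    rw [sineCoeff]
    push_cast
    ring
  have hs : Summable fun k : ℤ × ℤ => (sineCoeff squareCoeff k : ℂ) *
      Complex.exp (((2 * Real.pi * k.1 * p 0 + 2 * Real.pi * k.2 * p 1 : ℝ) : ℂ) * Complex.I) := by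
    refine Summable.of_norm_bounded (summable_latticeMajorant.mul_left (1 ^ 2)) fun k => ?_
    rw [norm_mul, Complex.norm_exp_ofReal_mul_I, mul_one, Complex.norm_real]
    exact abs_sineCoeff_le abs_squareCoeff_le k
  have hsc : Summable fun k : ℤ × ℤ => sineCoeff squareCoeff k *
      (Real.cos (2 * Real.pi * k.1 * p 0) * Real.cos (2 * Real.pi * k.2 * p 1)) :=
    Summable.of_norm_bounded (summable_latticeMajorant.mul_left (1 ^ 2)) fun k =>
      (abs_mul_sin_mul_le _ _ _ (Real.abs_cos_le_one _) (Real.abs_cos_le_one _)).trans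
        (abs_sineCoeff_le abs_squareCoeff_le k)
  have hzero : ∑' k : ℤ × ℤ, sineCoeff squareCoeff k *
      (Real.cos (2 * Real.pi * k.1 * p 0) * Real.cos (2 * Real.pi * k.2 * p 1)) = 0 := by
    refine tsum_eq_zero_of_odd fun k => ?_
    simp only [sineCoeff, squareCoeff_neg, Int.cast_neg, mul_neg, neg_mul, Real.cos_neg, even_two,
      Even.neg_pow]
    ring
  rw [psi0, invLaplacian, tsum_congr hterm]
  refine Eq.trans (congrArg Complex.re ((finTwoArrowEquiv ℤ).tsum_eq fun k : ℤ × ℤ =>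
    (sineCoeff squareCoeff k : ℂ) * Complex.exp
      (((2 * Real.pi * k.1 * p 0 + 2 * Real.pi * k.2 * p 1 : ℝ) : ℂ) * Complex.I))) ?_
  rw [Complex.re_tsum hs]
  have hre : ∀ k : ℤ × ℤ, ((sineCoeff squareCoeff k : ℂ) *
      Complex.exp (((2 * Real.pi * k.1 * p 0 + 2 * Real.pi * k.2 * p 1 : ℝ) : ℂ) * Complex.I)).re =
      sineCoeff squareCoeff k *
        (Real.cos (2 * Real.pi * k.1 * p 0) * Real.cos (2 * Real.pi * k.2 * p 1)) -
      sineCoeff squareCoeff k *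
        (Real.sin (2 * Real.pi * k.1 * p 0) * Real.sin (2 * Real.pi * k.2 * p 1)) := fun k => by
    rw [Complex.re_ofReal_mul, Complex.exp_ofReal_mul_I_re, Real.cos_add]
    ring
  rw [tsum_congr hre, hsc.tsum_sub (summable_sineSeries abs_squareCoeff_le _ _), hzero, zero_sub]
  rfl

/-! ### Behaviour of the stream function away from the coordinate axes -/

/-- The points of the circle at distance at most `τ` from the half-lattice `{0, 1/2}`. -/
def nearHalfLattice (τ : ℝ) : Set UnitAddCircle :=
  Metric.closedBall 0 τ ∪ Metric.closedBall ((1 / 2 : ℝ) : UnitAddCircle) τ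

/-- The `τ`-neighbourhood of the zero set `{x ∈ ½ℤ} ∪ {y ∈ ½ℤ}` of odd-odd functions. -/
def strip (τ : ℝ) : Set T2 := {p | ∃ i, p i ∈ nearHalfLattice τ}

theorem norm_coe_le_abs (x : ℝ) : ‖(x : UnitAddCircle)‖ ≤ |x| := by
  rw [UnitAddCircle.norm_eq]
  simpa using round_le x 0

theorem coe_neg_half : ((-(1 / 2) : ℝ) : UnitAddCircle) = ((1 / 2 : ℝ) : UnitAddCircle) := by
  rw [← sub_eq_zero, ← AddCircle.coe_sub]
  norm_num

theorem coe_one_half_neg : -((1 / 2 : ℝ) : UnitAddCircle) = ((1 / 2 : ℝ) : UnitAddCircle) := by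
  rw [← AddCircle.coe_neg, coe_neg_half]

/-- The square wave has only odd frequencies, and these sines are symmetric about `x = 1/4`. -/
theorem squareCoeff_mul_sin_half_sub (k : ℤ) (x : ℝ) :
    squareCoeff k * Real.sin (2 * Real.pi * k * (1 / 2 - x)) =
      squareCoeff k * Real.sin (2 * Real.pi * k * x) := by
  have h : Real.sin (k * Real.pi) = 0 := Real.sin_int_mul_pi k
  have h2 : Real.cos (k * Real.pi) ^ 2 = 1 := by
    have := Real.sin_sq_add_cos_sq (k * Real.pi)
    rw [h] at this
    linarith
  rw [show 2 * Real.pi * k * (1 / 2 - x) = k * Real.pi - 2 * Real.pi * k * x by ring, Real.sin_sub,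
    h, squareCoeff, mul_comm Real.pi]
  by_cases hk : k = 0
  · subst hk; simp
  have hk' : (k : ℝ) ≠ 0 := by exact_mod_cast hk
  have hpi := Real.pi_ne_zero
  field_simp
  ring_nf at h2 ⊢
  rw [h2]
  ring

/-- Reduction of a point of the circle to the fundamental interval `(0, 1/4]`. -/
theorem exists_rep_of_notMem_nearHalfLattice {θ : UnitAddCircle} {τ : ℝ}
    (hθ : θ ∉ nearHalfLattice τ) :
    ∃ x a X σ : ℝ, θ = (x : UnitAddCircle) ∧ -(a : UnitAddCircle) = (a : UnitAddCircle) ∧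
      |x - a| = X ∧ τ < X ∧ X ≤ 1 / 4 ∧ |σ| = 1 ∧
      ∀ k : ℤ, squareCoeff k * Real.sin (2 * Real.pi * k * x) =
        σ * (squareCoeff k * Real.sin (2 * Real.pi * k * X)) := by
  obtain ⟨x, hx, rfl⟩ : ∃ x : ℝ, x ∈ Ioc (-1 / 2 : ℝ) (-1 / 2 + 1) ∧ θ = (x : UnitAddCircle) :=
    ⟨_, (AddCircle.equivIoc (1 : ℝ) (-1 / 2) θ).2, AddCircle.coe_equivIoc.symm⟩
  simp only [nearHalfLattice, mem_union, Metric.mem_closedBall, not_or, not_le, dist_eq_norm,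
    sub_zero, ← AddCircle.coe_sub] at hθ
  have h1 : τ < |x| := hθ.1.trans_le (norm_coe_le_abs x)
  have h2 : τ < |x - 1 / 2| := hθ.2.trans_le (norm_coe_le_abs _)
  -- The points `-1/2` and `1/2` agree on the circle, so distance from the latter also controls
  -- representatives near `-1/2`.
  have h3 : τ < |x + 1 / 2| := by
    have e : ((x - 1 / 2 : ℝ) : UnitAddCircle) = ((x + 1 / 2 : ℝ) : UnitAddCircle) := by
      rw [AddCircle.coe_sub, AddCircle.coe_add, ← coe_neg_half, AddCircle.coe_neg, sub_neg_eq_add]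
      rw [coe_one_half_neg]
    rw [e] at hθ
    exact hθ.2.trans_le (norm_coe_le_abs _)
  have sneg : ∀ (k : ℤ) (X : ℝ), squareCoeff k * Real.sin (2 * Real.pi * k * -X) =
      -1 * (squareCoeff k * Real.sin (2 * Real.pi * k * X)) := fun k X => by
    rw [mul_neg, Real.sin_neg]; ring
  rcases le_or_gt 0 x with h0 | h0
  · rcases le_or_gt x (1 / 4) with h4 | h4
    · exact ⟨x, 0, |x|, 1, rfl, by simp, by simp, h1, by rwa [abs_of_nonneg h0], abs_one,
        fun k => by rw [abs_of_nonneg h0, one_mul]⟩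
    · refine ⟨x, 1 / 2, |x - 1 / 2|, 1, rfl, coe_one_half_neg, rfl, h2, ?_, abs_one, fun k => ?_⟩
      · rw [abs_of_nonpos (by linarith [hx.2])]; linarith
      · rw [abs_of_nonpos (by linarith [hx.2]), neg_sub, squareCoeff_mul_sin_half_sub, one_mul]
  · rcases le_or_gt (-(1 / 4)) x with h4 | h4
    · refine ⟨x, 0, |x|, -1, rfl, by simp, by simp, h1, ?_, by simp, fun k => ?_⟩
      · rw [abs_of_neg h0]; linarith
      · rw [abs_of_neg h0, ← sneg, neg_neg]
    · refine ⟨x, -(1 / 2), |x + 1 / 2|, -1, rfl, ?_, by rw [sub_neg_eq_add], h3, ?_, by simp,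
        fun k => ?_⟩
      · rw [coe_neg_half, coe_one_half_neg]
      · rw [abs_of_nonneg (by linarith [hx.1])]; linarith
      · rw [abs_of_nonneg (by linarith [hx.1]), show x + 1 / 2 = 1 / 2 - -x by ring,
          squareCoeff_mul_sin_half_sub, ← sneg, neg_neg]

/-! ### Symmetries of the stream function and its odd-odd `C¹` perturbations -/

theorem proj_surjective : Function.Surjective proj := isOpenQuotientMap_proj.surjective

theorem psi0_swapXY (p : T2) : psi0 (swapXY p) = psi0 p := by
  obtain ⟨x, rfl⟩ := proj_surjective p
  have : swapXY (proj x) = proj ![x 1, x 0] := by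
    funext i; fin_cases i <;> rfl
  rw [this, psi0_proj, psi0_proj, sineSeries_comm]
  rfl

theorem sineSeries_neg_left (β : ℤ → ℝ) (x y : ℝ) : sineSeries β (-x) y = -sineSeries β x y := by
  rw [sineSeries, sineSeries, ← tsum_neg]
  refine tsum_congr fun k => ?_
  rw [mul_neg, Real.sin_neg]
  ring

theorem isOddOdd_psi0 : IsOddOdd psi0 := by
  intro p
  obtain ⟨x, rfl⟩ := proj_surjective p
  have h1 : reflX (proj x) = proj ![-x 0, x 1] := by funext i; fin_cases i <;> rfl
  have h2 : reflY (proj x) = proj ![x 0, -x 1] := by funext i; fin_cases i <;> rfl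
  rw [h1, h2, psi0_proj, psi0_proj, psi0_proj]
  simp only [Matrix.cons_val_zero, Matrix.cons_val_one]
  rw [sineSeries_neg_left, sineSeries_comm _ (x 0) (-x 1), sineSeries_neg_left, sineSeries_comm]
  exact ⟨rfl, rfl⟩

/-- An odd-odd function vanishes on the half-lattice lines. -/
theorem IsOddOdd.eq_zero {f : T2 → ℝ} (hf : IsOddOdd f) (i : Fin 2) {p : T2} (hp : -p i = p i) :
    f p = 0 := by
  fin_cases i
  · have : reflX p = p := by
      funext j; fin_cases j
      · exact hp
      · rfl
    have h := (hf p).1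
    rw [this] at h
    linarith
  · have : reflY p = p := by
      funext j; fin_cases j
      · rfl
      · exact hp
    have h := (hf p).2
    rw [this] at h
    linarith

theorem pd_proj_update (f : T2 → ℝ) (i : Fin 2) (x : Fin 2 → ℝ) (s : ℝ) :
    pd i f (proj (Function.update x i s)) =
      deriv (fun t => f (proj (Function.update x i t))) s := by
  have : (fun t : ℝ => f (proj (Function.update x i s) + Pi.single i (t : UnitAddCircle))) =
      fun t => (fun t => f (proj (Function.update x i t))) (s + t) := by
    funext t
    simp only
    congr 1
    funext j
    by_cases h : j = i
    · subst h; simp [proj]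
    · simp [proj, h]
  rw [pd, this]
  exact (deriv_comp_const_add (fun t => f (proj (Function.update x i t))) s 0).trans (by rw [add_zero])

theorem differentiable_psi0_update (i : Fin 2) (x : Fin 2 → ℝ) :
    Differentiable ℝ fun t => psi0 (proj (Function.update x i t)) := by
  intro s
  simp only [psi0_proj]
  fin_cases i
  · exact (hasDerivAt_sineSeries abs_squareCoeff_le s (x 1)).differentiableAt.neg
  · have h := (hasDerivAt_sineSeries abs_squareCoeff_le s (x 0)).differentiableAt.neg
    simp only [sineSeries_comm _ _ (x 0)] at h
    exact h

theorem enorm_pd_le_c1Norm (f : T2 → ℝ) (i : Fin 2) (p : T2) : ‖pd i f p‖ₑ ≤ c1Norm f :=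
  calc ‖pd i f p‖ₑ ≤ ⨆ p, ‖pd i f p‖ₑ := le_iSup (fun p => ‖pd i f p‖ₑ) p
    _ ≤ ∑ i, ⨆ p, ‖pd i f p‖ₑ :=
      Finset.single_le_sum (f := fun i => ⨆ p, ‖pd i f p‖ₑ) (fun _ _ => zero_le) (Finset.mem_univ i)
    _ ≤ c1Norm f := le_add_self

/-- Along a coordinate line both functions vanish at the half-lattice point `a`, so the bound on the
derivative of their difference integrates to a factor equal to the distance. -/
theorem abs_sub_psi0_le {ψ : T2 → ℝ} (hψ : TorusContDiff 1 ψ) (hodd : IsOddOdd ψ) {δ : ℝ}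
    (hδ : c1Norm (fun p => ψ p - psi0 p) < ENNReal.ofReal δ) (i : Fin 2) (x : Fin 2 → ℝ) {a : ℝ}
    (ha : -(a : UnitAddCircle) = (a : UnitAddCircle)) :
    |ψ (proj x) - psi0 (proj x)| ≤ δ * |x i - a| := by
  -- Strictness in `hδ` forces `δ > 0`, so `ENNReal.ofReal` truncates nothing.
  have hδ0 : 0 < δ := ENNReal.ofReal_pos.1 (bot_le.trans_lt hδ)
  have hd : Differentiable ℝ fun t =>
      ψ (proj (Function.update x i t)) - psi0 (proj (Function.update x i t)) := by
    refine Differentiable.sub ?_ (differentiable_psi0_update i x)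
    exact (ContDiff.differentiable hψ one_ne_zero).comp
      (fun t => (hasFDerivAt_update x t).differentiableAt)
  have hb : ∀ t ∈ (univ : Set ℝ), ‖deriv (fun t =>
      ψ (proj (Function.update x i t)) - psi0 (proj (Function.update x i t))) t‖ ≤ δ := by
    intro t _
    rw [← pd_proj_update (fun p => ψ p - psi0 p)]
    have h := (enorm_pd_le_c1Norm (fun p => ψ p - psi0 p) i
      (proj (Function.update x i t))).trans hδ.le
    rw [← ofReal_norm] at h
    exact (ENNReal.ofReal_le_ofReal_iff hδ0.le).1 h
  have h := convex_univ.norm_image_sub_le_of_norm_deriv_le (fun t _ => hd t) hb (mem_univ a)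
    (mem_univ (x i))
  have hz : -proj (Function.update x i a) i = proj (Function.update x i a) i := by
    simpa [proj] using ha
  simp only [Function.update_eq_self, hodd.eq_zero i hz, isOddOdd_psi0.eq_zero i hz, sub_zero] at h
  exact h

theorem sineSeries_square_congr {x y X Y σ₁ σ₂ : ℝ}
    (hx : ∀ k : ℤ, squareCoeff k * Real.sin (2 * Real.pi * k * x) =
      σ₁ * (squareCoeff k * Real.sin (2 * Real.pi * k * X)))
    (hy : ∀ k : ℤ, squareCoeff k * Real.sin (2 * Real.pi * k * y) =
      σ₂ * (squareCoeff k * Real.sin (2 * Real.pi * k * Y))) :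
    sineSeries squareCoeff x y = σ₁ * σ₂ * sineSeries squareCoeff X Y := by
  rw [sineSeries, sineSeries, ← tsum_mul_left]
  refine tsum_congr fun k => ?_
  simp only [sineCoeff]
  linear_combination (squareCoeff k.2 * Real.sin (2 * Real.pi * k.2 * y) * hx k.1 +
    σ₁ * (squareCoeff k.1 * Real.sin (2 * Real.pi * k.1 * X)) * hy k.2) /
    (4 * Real.pi ^ 2 * ((k.1 : ℝ) ^ 2 + (k.2 : ℝ) ^ 2))

/-- Away from the axes `psi0` is bounded below by `n m log (1 / m)`, up to constants, where `n ≤ m`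
are the distances to the axes, while a `C¹`-small odd-odd perturbation is bounded by `δ n`. -/
theorem exists_bounds_of_notMem_strip {ψ : T2 → ℝ} (hψ : TorusContDiff 1 ψ) (hodd : IsOddOdd ψ)
    {δ τ : ℝ} (hτ : 0 ≤ τ) (hδ : c1Norm (fun p => ψ p - psi0 p) < ENNReal.ofReal δ) {p : T2}
    (hp : p ∉ strip τ) :
    ∃ n m : ℝ, τ < n ∧ n ≤ m ∧ m ≤ 1 / 4 ∧ |ψ p - psi0 p| ≤ δ * n ∧
      1 / 13 * (n * m * -Real.log (128 / 9 * m ^ 2)) ≤ |psi0 p| := by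
  simp only [strip, mem_ofPred_eq, not_exists] at hp
  obtain ⟨x, a, X, σ, hx, ha, hxa, hX, hX4, hσ, hsx⟩ := exists_rep_of_notMem_nearHalfLattice (hp 0)
  obtain ⟨y, b, Y, ρ, hy, hb, hyb, hY, hY4, hρ, hsy⟩ := exists_rep_of_notMem_nearHalfLattice (hp 1)
  have hpr : p = proj ![x, y] := by funext i; fin_cases i <;> assumption
  have d1 := abs_sub_psi0_le hψ hodd hδ 0 ![x, y] ha
  have d2 := abs_sub_psi0_le hψ hodd hδ 1 ![x, y] hb
  simp only [Matrix.cons_val_zero, Matrix.cons_val_one, ← hpr, hxa, hyb] at d1 d2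
  have hX0 : 0 < X := hτ.trans_lt hX
  have hY0 : 0 < Y := hτ.trans_lt hY
  have e : sineSeries squareCoeff X Y ≤ |psi0 p| := by
    rw [hpr, psi0_proj, abs_neg]
    simp only [Matrix.cons_val_zero, Matrix.cons_val_one]
    rw [sineSeries_square_congr hsx hsy, abs_mul, abs_mul, hσ, hρ, one_mul, one_mul]
    exact le_abs_self _
  have key := sineSeries_square_ge hX0 (by linarith) hY0 (by linarith)
  -- Here `X² + Y² ≤ 2m²` turns `64/9` into `128/9`.
  have hlog : ∀ m : ℝ, X ≤ m → Y ≤ m → -Real.log (128 / 9 * m ^ 2) ≤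
      -Real.log (64 / 9 * (X ^ 2 + Y ^ 2)) := fun m h1 h2 => by
    refine neg_le_neg (Real.log_le_log (by positivity) ?_)
    nlinarith
  rcases le_total X Y with h | h
  · refine ⟨X, Y, hX, h, hY4, d1, le_trans ?_ e⟩
    refine le_trans ?_ key
    exact mul_le_mul_of_nonneg_left (mul_le_mul_of_nonneg_left (hlog Y h le_rfl) (by positivity))
      (by norm_num)
  · refine ⟨Y, X, hY, h, hX4, d2, le_trans ?_ e⟩
    refine le_trans ?_ key
    rw [mul_comm Y X]
    exact mul_le_mul_of_nonneg_left (mul_le_mul_of_nonneg_left (hlog X le_rfl h) (by positivity))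
      (by norm_num)

/-! ### Choice of the width of the strip -/

/-- In terms of `r = (-ln ε)^{1/4}` one has `log (-ln ε) = 4 log r`; this is the final comparison
once the powers of `e` and `r` are removed. -/
theorem eventually_log_le (C : ℝ) : ∀ᶠ r : ℝ in atTop, 4 * C * Real.log r + 1 ≤ r / 52 := by
  have h1 := (Real.isLittleO_log_id_atTop.const_mul_left (4 * C)).def
    (show (0 : ℝ) < 1 / 104 by norm_num)
  filter_upwards [h1, eventually_ge_atTop (104 : ℝ)] with r hr hr2
  rw [Real.norm_eq_abs, id, Real.norm_of_nonneg (by linarith)] at hr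
  linarith [le_abs_self (4 * C * Real.log r)]

/-- With `ε = e²`, `-ln ε = r⁴` and `τ = e / r`, the term `A τ² = A ε / r²` is small because `r` is
large, while the powers `r³` and `r² log r` on the two sides of the second claim leave room for the
factor `1 / r` in `τ`. -/
theorem exists_strip_width (C₁ A : ℝ) :
    ∃ ε₀ : ℝ, 0 < ε₀ ∧ ∀ ε : ℝ, 0 < ε → ε < ε₀ → ∃ τ : ℝ, 0 < τ ∧ A * τ ^ 2 ≤ ε ∧
      ∀ n m : ℝ, τ < n → n ≤ m → m ≤ 1 / 4 →
        C₁ * Real.sqrt ε * Real.sqrt (-Real.log ε) * Real.log (-Real.log ε) * n + ε ≤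
          1 / 13 * (n * m * -Real.log (128 / 9 * m ^ 2)) := by
  obtain ⟨r₀, hr₀⟩ := eventually_atTop.1 ((eventually_log_le C₁).and
    ((eventually_ge_atTop (72 : ℝ)).and (eventually_ge_atTop A)))
  refine ⟨Real.exp (-(max r₀ 1) ^ 4), Real.exp_pos _, fun ε hε hε₀ => ?_⟩
  obtain ⟨r, hr0, hL⟩ : ∃ r : ℝ, max r₀ 1 ≤ r ∧ -Real.log ε = r ^ 4 := by
    have h1 : (max r₀ 1) ^ 4 < -Real.log ε := by
      have := Real.log_lt_log hε hε₀
      rw [Real.log_exp] at this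
      linarith
    have h0 : (0 : ℝ) ≤ -Real.log ε := le_trans (by positivity) h1.le
    have h2 : √√(-Real.log ε) ^ 4 = -Real.log ε := by
      rw [show (4 : ℕ) = 2 * 2 from rfl, pow_mul, Real.sq_sqrt (Real.sqrt_nonneg _),
        Real.sq_sqrt h0]
    refine ⟨√√(-Real.log ε), ?_, h2.symm⟩
    by_contra! h
    have := pow_le_pow_left₀ (Real.sqrt_nonneg _) h.le 4
    linarith
  obtain ⟨k1, k2, k3⟩ := hr₀ r ((le_max_left _ _).trans hr0)
  have hr : 0 < r := by linarith
  obtain ⟨e, he, hee⟩ : ∃ e : ℝ, 0 < e ∧ ε = e ^ 2 :=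
    ⟨√ε, Real.sqrt_pos.2 hε, (Real.sq_sqrt hε.le).symm⟩
  have hloge : Real.log e = -(r ^ 4 / 2) := by
    rw [hee, Real.log_pow] at hL
    push_cast at hL
    linarith
  -- Since `e = exp (-r⁴/2)`, the quadratic term of the exponential gives `1/e ≥ r⁸/8`, and `r ≥ 72`
  -- makes this at least `9 r⁷`.
  have hsmall : 9 * e * r ^ 7 ≤ 1 := by
    have h1 : e = Real.exp (-(r ^ 4 / 2)) := by rw [← hloge, Real.exp_log he]
    have h2 := Real.quadratic_le_exp_of_nonneg (show 0 ≤ r ^ 4 / 2 by positivity)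
    rw [h1, Real.exp_neg, mul_right_comm, ← div_eq_mul_inv, div_le_one (Real.exp_pos _)]
    have h3 : 72 * r ^ 7 ≤ r * r ^ 7 := by gcongr
    nlinarith [pow_pos hr 4]
  rw [hL, hee, Real.sqrt_sq he.le, show r ^ 4 = (r ^ 2) ^ 2 by ring, Real.sqrt_sq (by positivity),
    show (r ^ 2) ^ 2 = r ^ 4 by ring, Real.log_pow]
  push_cast
  refine ⟨e / r, by positivity, ?_, fun n m hn hnm hm => ?_⟩
  · rw [div_pow, mul_div_assoc', div_le_iff₀ (by positivity)]
    nlinarith [mul_le_mul_of_nonneg_left (show A ≤ r ^ 2 by nlinarith) (sq_nonneg e)]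
  · have hτ : 0 < e / r := by positivity
    have hn0 : 0 < n := hτ.trans hn
    have hm0 : 0 < m := hn0.trans_le hnm
    -- If `m² ≤ e/r`, the logarithm is at least `r⁴/4` and `m ≥ e/r`. Otherwise `hsmall` gives `m ≥
    -- 3 e r³`, and `m ≤ 1/4` keeps the logarithm at least `1/9`.
    have main : e * r ^ 3 / 52 ≤ 1 / 13 * (m * -Real.log (128 / 9 * m ^ 2)) := by
      rcases le_total (m ^ 2) (e / r) with h | h
      · have hlog : r ^ 4 / 4 ≤ -Real.log (128 / 9 * m ^ 2) := by
          have h1 : Real.log (128 / 9 * m ^ 2) ≤ Real.log (128 / 9 * (e / r)) :=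
            Real.log_le_log (by positivity) (by gcongr)
          rw [Real.log_mul (by norm_num) hτ.ne', Real.log_div he.ne' hr.ne', hloge] at h1
          have h2 : Real.log (128 / 9) ≤ 128 / 9 - 1 := Real.log_le_sub_one_of_pos (by norm_num)
          have h3 : 0 ≤ Real.log r := Real.log_nonneg (by linarith)
          have h4 : (72 : ℝ) ^ 4 ≤ r ^ 4 := by gcongr
          norm_num at h2 h4
          linarith
        have h5 : e / r * (r ^ 4 / 4) ≤ m * -Real.log (128 / 9 * m ^ 2) := by
          apply mul_le_mul (by linarith) hlog (by positivity) hm0.le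
        have h6 : e / r * (r ^ 4 / 4) = e * r ^ 3 / 4 := by field_simp
        linarith
      · have hlog : 1 / 9 ≤ -Real.log (128 / 9 * m ^ 2) := by
          have h1 : Real.log (128 / 9 * m ^ 2) ≤ 128 / 9 * m ^ 2 - 1 :=
            Real.log_le_sub_one_of_pos (by positivity)
          nlinarith
        have h2 : (3 * e * r ^ 3) ^ 2 ≤ m ^ 2 := by
          refine le_trans ?_ h
          rw [le_div_iff₀ hr]
          nlinarith
        have h3 : 3 * e * r ^ 3 ≤ m := le_of_sq_le_sq h2 hm0.le
        nlinarith
    have h1 : C₁ * e * r ^ 2 * (4 * Real.log r) + e * r ≤ e * r ^ 3 / 52 := by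
      have h2 : e * r ^ 2 * (4 * C₁ * Real.log r + 1) ≤ e * r ^ 2 * (r / 52) := by gcongr
      have h3 : e * r ≤ e * r ^ 2 := by gcongr; nlinarith
      nlinarith
    -- The additive `ε` is absorbed into a multiple of `n` because `n > e/r`.
    have h4 : e ^ 2 ≤ e * r * n := by
      have : e ^ 2 = e * r * (e / r) := by field_simp
      rw [this]
      gcongr
    nlinarith [mul_le_mul_of_nonneg_left (h1.trans main) hn0.le]

/-! ### The nonlinearity -/

section Nonlinearity

variable {K : ℝ → ℝ} {ε : ℝ}

theorem IsMollifier.integrable (hK : IsMollifier K) : Integrable K := by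
  by_contra h
  have := hK.integral_eq_one
  rw [integral_undef h] at this
  exact zero_ne_one this

theorem IsMollifier.eq_zero (hK : IsMollifier K) {x : ℝ} (hx : 1 ≤ |x|) : K x = 0 := by
  by_contra h
  have := hK.support h
  rw [mem_ball_zero_iff, Real.norm_eq_abs] at this
  linarith

theorem IsMollifier.exists_bound (hK : IsMollifier K) : ∃ M, 0 < M ∧ ∀ x, K x ≤ M := by
  obtain ⟨C, hC⟩ := (isCompact_Icc (a := (-1 : ℝ)) (b := 1)).exists_bound_of_continuousOn
    hK.smooth.continuous.continuousOn
  refine ⟨max C 1, by positivity, fun x => ?_⟩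
  by_cases hx : |x| ≤ 1
  · exact (le_abs_self _).trans ((hC x (abs_le.1 hx)).trans (le_max_left _ _))
  · rw [hK.eq_zero (not_le.1 hx).le]; positivity

theorem continuous_rescale (hK : IsMollifier K) (ε : ℝ) : Continuous (rescale K ε) := by
  unfold rescale
  have := hK.smooth.continuous
  fun_prop

theorem integrable_rescale (hK : IsMollifier K) (hε : 0 < ε) : Integrable (rescale K ε) :=
  (hK.integrable.comp_div hε.ne').const_mul _

/-- Away from `t = x`, `sgn (x - t) = 2·1_{t ≤ x} - 1`. Hence the nonlinearity is affine in the
distribution function of the mollifier, which gives its derivative; the total mass need not be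
evaluated. -/
theorem nonlin_eq (hK : IsMollifier K) (hε : 0 < ε) (x : ℝ) :
    nonlin K ε x = (∫ t, rescale K ε t) - 2 * ∫ t in Iic x, rescale K ε t := by
  have hi := integrable_rescale hK hε
  rw [nonlin, convolution_eq_swap]
  simp only [ContinuousLinearMap.mul_apply']
  have h : (fun t => sgn (x - t) * rescale K ε t) =ᵐ[volume]
      fun t => 2 * (Iic x).indicator (rescale K ε) t - rescale K ε t := by
    filter_upwards [Measure.ae_ne volume x] with t ht
    by_cases h : t ≤ x
    · rw [indicator_of_mem (mem_Iic.2 h), sgn, if_pos (sub_pos.2 (lt_of_le_of_ne h ht))]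
      ring
    · rw [indicator_of_notMem (by simpa using h), sgn, if_neg (by linarith)]
      ring
  rw [integral_congr_ae h, integral_sub ((hi.indicator measurableSet_Iic).const_mul 2) hi,
    integral_const_mul, integral_indicator measurableSet_Iic]
  ring

theorem hasDerivAt_nonlin (hK : IsMollifier K) (hε : 0 < ε) (x : ℝ) :
    HasDerivAt (nonlin K ε) (-(2 * rescale K ε x)) x := by
  have hi := integrable_rescale hK hε
  have e : nonlin K ε = fun x => (∫ t, rescale K ε t) -
      2 * ((∫ t in Iic 0, rescale K ε t) + ∫ t in (0 : ℝ)..x, rescale K ε t) := by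
    funext x
    rw [nonlin_eq hK hε, ← intervalIntegral.integral_Iic_sub_Iic hi.integrableOn hi.integrableOn,
      add_sub_cancel]
  rw [e]
  have h := intervalIntegral.integral_hasDerivAt_right
    ((continuous_rescale hK ε).intervalIntegrable 0 x)
    ((continuous_rescale hK ε).stronglyMeasurableAtFilter _ _)
    (continuous_rescale hK ε).continuousAt
  refine (((h.const_add _).const_mul 2).const_sub _)

theorem deriv_nonlin (hK : IsMollifier K) (hε : 0 < ε) (x : ℝ) :
    deriv (nonlin K ε) x = -(2 * rescale K ε x) := (hasDerivAt_nonlin hK hε x).deriv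

theorem rescale_neg (hK : IsMollifier K) (x : ℝ) : rescale K ε (-x) = rescale K ε x := by
  rw [rescale, rescale, neg_div, hK.even]

theorem nonlin_neg (hK : IsMollifier K) (hε : 0 < ε) (x : ℝ) :
    nonlin K ε (-x) = -nonlin K ε x := by
  rw [nonlin_eq hK hε, nonlin_eq hK hε]
  have hi := integrable_rescale hK hε
  have h1 := integral_comp_neg_Iic (-x) (rescale K ε)
  rw [neg_neg] at h1
  simp only [rescale_neg hK] at h1
  have h2 := intervalIntegral.integral_Iic_add_Ioi (b := x) hi.integrableOn hi.integrableOn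
  linarith

theorem rescale_nonneg (hK : IsMollifier K) (hε : 0 < ε) (x : ℝ) : 0 ≤ rescale K ε x :=
  mul_nonneg (by positivity) (hK.nonneg _)

theorem rescale_le (hε : 0 < ε) {M : ℝ} (hM : ∀ x, K x ≤ M) (x : ℝ) : rescale K ε x ≤ M / ε := by
  rw [rescale, div_eq_inv_mul M, one_div]
  gcongr
  exact hM _

theorem rescale_eq_zero (hK : IsMollifier K) (hε : 0 < ε) {x : ℝ} (hx : ε ≤ |x|) :
    rescale K ε x = 0 := by
  rw [rescale, hK.eq_zero, mul_zero]
  rwa [abs_div, abs_of_pos hε, one_le_div hε]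

end Nonlinearity

/-! ### Integration by parts on the torus -/

theorem exists_norm_le_of_continuous {f : T2 → ℝ} (hf : Continuous f) : ∃ C, ∀ p, ‖f p‖ ≤ C := by
  obtain ⟨C, hC⟩ := isCompact_univ.exists_bound_of_continuousOn hf.continuousOn
  exact ⟨C, fun p => hC p (mem_univ p)⟩

theorem integrable_of_continuous {f : T2 → ℝ} (hf : Continuous f) : Integrable f torusMeasure := by
  obtain ⟨C, hC⟩ := exists_norm_le_of_continuous hf
  exact Integrable.of_bound hf.aestronglyMeasurable C (ae_of_all _ hC)

theorem TorusContDiff.one_of_top {f : T2 → ℝ} (hf : TorusContDiff ∞ f) : TorusContDiff 1 f :=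
  ContDiff.of_le hf (by exact_mod_cast le_top)

theorem TorusContDiff.mul {n : ℕ∞ω} {f g : T2 → ℝ} (hf : TorusContDiff n f)
    (hg : TorusContDiff n g) : TorusContDiff n fun p => f p * g p := ContDiff.mul hf hg

theorem hasDerivAt_translate {f : T2 → ℝ} (hf : TorusContDiff 1 f) (i : Fin 2) (p : T2) (t : ℝ) :
    HasDerivAt (fun s : ℝ => f (p + Pi.single i (s : UnitAddCircle)))
      (pd i f (p + Pi.single i (t : UnitAddCircle))) t := by
  obtain ⟨x, rfl⟩ := proj_surjective p
  have e : ∀ s : ℝ, proj x + Pi.single i (s : UnitAddCircle) =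
      proj (x + s • (Pi.single i 1 : Fin 2 → ℝ)) := fun s => by
    funext j
    by_cases h : j = i
    · subst h; simp [proj]
    · simp [proj, h]
  simp only [e]
  rw [pd_proj hf]
  have h1 := (ContDiff.differentiable hf one_ne_zero
    (x + t • (Pi.single i 1 : Fin 2 → ℝ))).hasFDerivAt
  have h2 : HasDerivAt (fun s : ℝ => x + s • (Pi.single i (1 : ℝ) : Fin 2 → ℝ))
      (Pi.single i (1 : ℝ)) t := by
    simpa using ((hasDerivAt_id t).smul_const
      (Pi.single i (1 : ℝ) : Fin 2 → ℝ)).const_add x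
  exact h1.comp_hasDerivAt t h2

theorem pd_mul {f g : T2 → ℝ} (hf : TorusContDiff 1 f) (hg : TorusContDiff 1 g) (i : Fin 2)
    (p : T2) : pd i (fun p => f p * g p) p = pd i f p * g p + f p * pd i g p := by
  have := ((hasDerivAt_translate hf i p 0).mul (hasDerivAt_translate hg i p 0)).deriv
  simpa [pd] using! this

/-- By translation invariance `∫ f(p + t eᵢ)` does not depend on `t`; differentiate under the
integral at `t = 0`. -/
theorem integral_pd_eq_zero {f : T2 → ℝ} (hf : TorusContDiff ∞ f) (i : Fin 2) :
    ∫ p, pd i f p ∂torusMeasure = 0 := by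
  have hc : Continuous (pd i f) := (hf.pd i).continuous
  have hcf : Continuous f := hf.continuous
  obtain ⟨C, hC⟩ := exists_norm_le_of_continuous hc
  have hct : ∀ {g : T2 → ℝ}, Continuous g → ∀ t : ℝ,
      Continuous fun p : T2 => g (p + Pi.single i (t : UnitAddCircle)) :=
    fun hg t => hg.comp (continuous_add_const _)
  let F : ℝ → T2 → ℝ := fun t p => f (p + Pi.single i (t : UnitAddCircle))
  let F' : ℝ → T2 → ℝ := fun t p => pd i f (p + Pi.single i (t : UnitAddCircle))
  have h1 : ∀ᶠ t in 𝓝 (0 : ℝ), AEStronglyMeasurable (F t) torusMeasure :=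
    Eventually.of_forall fun t => (hct hcf t).aestronglyMeasurable
  have h2 : Integrable (F 0) torusMeasure := integrable_of_continuous (hct hcf 0)
  have h3 : AEStronglyMeasurable (F' 0) torusMeasure := (hct hc 0).aestronglyMeasurable
  have h4 : ∀ᵐ p ∂torusMeasure, ∀ t ∈ (univ : Set ℝ), ‖F' t p‖ ≤ (fun _ => C) p :=
    ae_of_all _ fun p t _ => hC _
  have h5 : ∀ᵐ p ∂torusMeasure, ∀ t ∈ (univ : Set ℝ), HasDerivAt (fun s => F s p) (F' t p) t :=
    ae_of_all _ fun p t _ => hasDerivAt_translate hf.one_of_top i p t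
  have h := (hasDerivAt_integral_of_dominated_loc_of_deriv_le univ_mem h1 h2 h3 h4
    (integrable_const C) h5).2
  have e : (fun t : ℝ => ∫ p, F t p ∂torusMeasure) = fun _ => ∫ p, f p ∂torusMeasure :=
    funext fun t => integral_add_right_eq_self f _
  rw [e] at h
  have h6 := h.unique (hasDerivAt_const (0 : ℝ) (∫ p, f p ∂torusMeasure))
  simpa [F'] using h6

theorem integral_mul_pd {f g : T2 → ℝ} (hf : TorusContDiff ∞ f) (hg : TorusContDiff ∞ g)
    (i : Fin 2) :
    ∫ p, f p * pd i g p ∂torusMeasure = -∫ p, pd i f p * g p ∂torusMeasure := by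
  have h := integral_pd_eq_zero (hf.mul hg) i
  have i1 : Integrable (fun p => pd i f p * g p) torusMeasure :=
    integrable_of_continuous ((hf.pd i).continuous.mul hg.continuous)
  have i2 : Integrable (fun p => f p * pd i g p) torusMeasure :=
    integrable_of_continuous (hf.continuous.mul (hg.pd i).continuous)
  rw [integral_congr_ae (ae_of_all _ fun p => pd_mul hf.one_of_top hg.one_of_top i p),
    integral_add i1 i2] at h
  linarith

theorem TorusContDiff.pd_iterate {f : T2 → ℝ} (hf : TorusContDiff ∞ f) (i : Fin 2) (n : ℕ) :
    TorusContDiff ∞ ((TorusEuler.pd i)^[n] f) := by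
  induction n with
  | zero => exact hf
  | succ n ih => rw [Function.iterate_succ_apply']; exact ih.pd i

theorem integral_mul_pd_iterate {f g : T2 → ℝ} (hf : TorusContDiff ∞ f) (hg : TorusContDiff ∞ g)
    (i : Fin 2) (n : ℕ) :
    ∫ p, f p * (pd i)^[n] g p ∂torusMeasure =
      (-1) ^ n * ∫ p, (pd i)^[n] f p * g p ∂torusMeasure := by
  induction n generalizing f g with
  | zero => simp
  | succ n ih =>
    rw [Function.iterate_succ_apply, ih hf (hg.pd i), Function.iterate_succ_apply',
      integral_mul_pd (hf.pd_iterate i n) hg]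
    ring

/-- The derivatives land on `f` in reversed order, so no commutation of partial derivatives is
needed. -/
theorem integral_mul_pdIter {f g : T2 → ℝ} (hf : TorusContDiff ∞ f) (hg : TorusContDiff ∞ g)
    (m n : ℕ) :
    ∫ p, f p * pdIter m n g p ∂torusMeasure =
      (-1) ^ (m + n) * ∫ p, (pd 1)^[n] ((pd 0)^[m] f) p * g p ∂torusMeasure := by
  rw [pdIter, integral_mul_pd_iterate hf (hg.pd_iterate 1 n),
    integral_mul_pd_iterate (hf.pd_iterate 0 m) hg]
  ring

/-! ### Trigonometric functions on the circle and the torus -/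

/-- `sin (2πkx + mπ/2)` as a function on the circle. -/
def circleWave (m : ℕ) (k : ℤ) (θ : UnitAddCircle) : ℝ := (Complex.I ^ m * fourier k θ).im

theorem circleWave_coe (m : ℕ) (k : ℤ) (x : ℝ) : circleWave m k (x : UnitAddCircle) =
    (Complex.I ^ m * Complex.exp (2 * Real.pi * Complex.I * k * x)).im := by
  rw [circleWave, fourier_coe_apply]
  norm_num

theorem contDiff_circleWave (m : ℕ) (k : ℤ) :
    ContDiff ℝ ∞ fun x : ℝ => circleWave m k (x : UnitAddCircle) := by
  simp only [circleWave_coe]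
  have h : ContDiff ℝ ∞ fun x : ℝ =>
      Complex.I ^ m * Complex.exp (2 * Real.pi * Complex.I * k * (x : ℂ)) :=
    contDiff_const.mul ((contDiff_const.mul Complex.ofRealCLM.contDiff).cexp)
  exact Complex.imCLM.contDiff.comp h

theorem hasDerivAt_circleWave (m : ℕ) (k : ℤ) (x : ℝ) :
    HasDerivAt (fun x : ℝ => circleWave m k (x : UnitAddCircle))
      (2 * Real.pi * k * circleWave (m + 1) k (x : UnitAddCircle)) x := by
  have h := (hasDerivAt_fourier 1 k x).const_mul (Complex.I ^ m)
  have h2 := Complex.imCLM.hasFDerivAt.comp_hasDerivAt x h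
  refine h2.congr_deriv ?_
  rw [circleWave, Complex.imCLM_apply]
  have : (Complex.I ^ m * (2 * Real.pi * Complex.I * k / (1 : ℝ) * fourier k (x : UnitAddCircle))) =
      ((2 * Real.pi * k : ℝ) : ℂ) * (Complex.I ^ (m + 1) * fourier k (x : UnitAddCircle)) := by
    push_cast
    ring
  rw [this, Complex.im_ofReal_mul]

/-- `sin (2πkx + mπ/2) sin (2πly + nπ/2)` as a function on the torus. -/
def torusWave (m n : ℕ) (k l : ℤ) (p : T2) : ℝ := circleWave m k (p 0) * circleWave n l (p 1)

theorem torusContDiff_torusWave (m n : ℕ) (k l : ℤ) : TorusContDiff ∞ (torusWave m n k l) :=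
  ((contDiff_circleWave m k).comp (contDiff_apply ℝ ℝ (0 : Fin 2))).mul
    ((contDiff_circleWave n l).comp (contDiff_apply ℝ ℝ (1 : Fin 2)))

theorem deriv_circleWave_translate (m : ℕ) (k : ℤ) (θ : UnitAddCircle) :
    HasDerivAt (fun t : ℝ => circleWave m k (θ + (t : UnitAddCircle)))
      (2 * Real.pi * k * circleWave (m + 1) k θ) 0 := by
  obtain ⟨x, rfl⟩ := QuotientAddGroup.mk_surjective θ
  have h := (hasDerivAt_circleWave m k (x + 0)).comp_const_add x 0
  simpa using! h

theorem pd_zero_torusWave (m n : ℕ) (k l : ℤ) : pd 0 (torusWave m n k l) =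
    fun p => 2 * Real.pi * k * torusWave (m + 1) n k l p := by
  funext p
  have h := ((deriv_circleWave_translate m k (p 0)).mul_const (circleWave n l (p 1))).deriv
  simp only [pd, torusWave, Pi.add_apply, Pi.single_eq_same, ne_eq, one_ne_zero, not_false_eq_true,
    Pi.single_eq_of_ne, add_zero]
  rw [h]
  ring

theorem pd_one_torusWave (m n : ℕ) (k l : ℤ) : pd 1 (torusWave m n k l) =
    fun p => 2 * Real.pi * l * torusWave m (n + 1) k l p := by
  funext p
  have h := ((deriv_circleWave_translate n l (p 1)).const_mul (circleWave m k (p 0))).deriv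
  simp only [pd, torusWave, Pi.add_apply, Pi.single_eq_same, ne_eq, zero_ne_one, not_false_eq_true,
    Pi.single_eq_of_ne, add_zero]
  rw [h]
  ring

theorem pd_const_mul (i : Fin 2) (c : ℝ) (f : T2 → ℝ) :
    pd i (fun p => c * f p) = fun p => c * pd i f p := by
  funext p
  exact deriv_const_mul_field c

theorem pd_zero_iterate_torusWave (a m n : ℕ) (k l : ℤ) : (pd 0)^[a] (torusWave m n k l) =
    fun p => (2 * Real.pi * k) ^ a * torusWave (m + a) n k l p := by
  induction a with
  | zero => simp
  | succ a ih =>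
    rw [Function.iterate_succ_apply', ih, pd_const_mul, pd_zero_torusWave]
    funext p
    rw [add_assoc]
    ring

theorem pd_one_iterate_torusWave (b m n : ℕ) (k l : ℤ) : (pd 1)^[b] (torusWave m n k l) =
    fun p => (2 * Real.pi * l) ^ b * torusWave m (n + b) k l p := by
  induction b with
  | zero => simp
  | succ b ih =>
    rw [Function.iterate_succ_apply', ih, pd_const_mul, pd_one_torusWave]
    funext p
    rw [add_assoc]
    ring

theorem pd_iterate_const_mul (i : Fin 2) (b : ℕ) (c : ℝ) (f : T2 → ℝ) :
    (pd i)^[b] (fun p => c * f p) = fun p => c * (pd i)^[b] f p := by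
  induction b with
  | zero => rfl
  | succ b ih => rw [Function.iterate_succ_apply', ih, pd_const_mul, Function.iterate_succ_apply']

theorem integral_torusWave_mul_pdIter (a b : ℕ) (k l : ℤ) {φ : T2 → ℝ} (hφ : TorusContDiff ∞ φ) :
    ∫ p, torusWave 0 0 k l p * pdIter a b φ p ∂torusMeasure =
      (-1) ^ (a + b) * ((2 * Real.pi * k) ^ a * (2 * Real.pi * l) ^ b *
        ∫ p, torusWave a b k l p * φ p ∂torusMeasure) := by
  have e : (pd 1)^[b] ((pd 0)^[a] (torusWave 0 0 k l)) = fun p =>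
      (2 * Real.pi * k) ^ a * (2 * Real.pi * l) ^ b * torusWave a b k l p := by
    rw [pd_zero_iterate_torusWave, pd_iterate_const_mul, pd_one_iterate_torusWave, zero_add,
      zero_add]
    simp only [mul_assoc]
  rw [integral_mul_pdIter (torusContDiff_torusWave 0 0 k l) hφ, e]
  simp only [mul_assoc, integral_const_mul]

theorem circleWave_add_two (m : ℕ) (k : ℤ) (θ : UnitAddCircle) :
    circleWave (m + 2) k θ = -circleWave m k θ := by
  rw [circleWave, circleWave, pow_add, Complex.I_sq]
  simp

/-- The Laplacian of a trigonometric function. -/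
theorem pdIter_two_torusWave (k l : ℤ) (p : T2) :
    pdIter 2 0 (torusWave 0 0 k l) p = -(2 * Real.pi * k) ^ 2 * torusWave 0 0 k l p ∧
    pdIter 0 2 (torusWave 0 0 k l) p = -(2 * Real.pi * l) ^ 2 * torusWave 0 0 k l p := by
  constructor
  · rw [pdIter, Function.iterate_zero, id, pd_zero_iterate_torusWave]
    simp only [torusWave]
    rw [circleWave_add_two]
    ring
  · rw [pdIter, Function.iterate_zero, id, pd_one_iterate_torusWave]
    simp only [torusWave]
    rw [circleWave_add_two]
    ring

theorem integral_fourier (n : ℤ) :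
    ∫ θ : UnitAddCircle, (fourier n θ : ℂ) ∂AddCircle.haarAddCircle = if n = 0 then 1 else 0 := by
  have h := congrFun (fourierCoeff_fourier (T := 1) n) 0
  simp only [fourierCoeff, neg_zero, fourier_zero, one_smul] at h
  rw [h, Pi.single_apply]
  simp [eq_comm]

/-- `Im z Im w = ½ Re (z w̄ - z w)` reduces this to exponentials of frequency `j - k` and `j + k`;
positivity of both frequencies kills the second. -/
theorem integral_circleWave_mul (m : ℕ) {j k : ℤ} (hj : 0 < j) (hk : 0 < k) :
    ∫ θ, circleWave m j θ * circleWave m k θ ∂AddCircle.haarAddCircle =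
      if j = k then 1 / 2 else 0 := by
  have hI : Complex.normSq (Complex.I ^ m) = 1 := by simp
  have e : ∀ θ : UnitAddCircle, circleWave m j θ * circleWave m k θ =
      (1 / 2 * (fourier (j - k) θ - (Complex.I ^ m) ^ 2 * fourier (j + k) θ) : ℂ).re := fun θ => by
    have h1 : (fourier (j - k) θ : ℂ) = (Complex.I ^ m * fourier j θ) *
        (starRingEnd ℂ) (Complex.I ^ m * fourier k θ) := by
      rw [map_mul, ← fourier_neg, sub_eq_add_neg, fourier_add]
      have := Complex.mul_conj (Complex.I ^ m)
      rw [hI, Complex.ofReal_one] at this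
      linear_combination (-(fourier j θ * fourier (-k) θ : ℂ)) * this
    have h2 : (Complex.I ^ m) ^ 2 * fourier (j + k) θ = (Complex.I ^ m * fourier j θ) *
        (Complex.I ^ m * fourier k θ) := by
      rw [fourier_add]; ring
    rw [h1, h2, circleWave, circleWave]
    generalize Complex.I ^ m * fourier j θ = z
    generalize Complex.I ^ m * fourier k θ = w
    have : (1 / 2 : ℂ) = ((1 / 2 : ℝ) : ℂ) := by push_cast; rfl
    rw [this, Complex.re_ofReal_mul]
    simp only [Complex.sub_re, Complex.mul_re, Complex.conj_re, Complex.conj_im]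
    ring
  have hi : ∀ n : ℤ, Integrable (fun θ : UnitAddCircle => (fourier n θ : ℂ))
      AddCircle.haarAddCircle := fun n =>
    Integrable.of_bound (fourier n).continuous.aestronglyMeasurable 1
      (ae_of_all _ fun θ => by rw [fourier_apply, Circle.norm_coe])
  simp only [e]
  have hint : Integrable (fun θ : UnitAddCircle => (1 / 2 * (fourier (j - k) θ -
      (Complex.I ^ m) ^ 2 * fourier (j + k) θ) : ℂ)) AddCircle.haarAddCircle :=
    ((hi _).sub ((hi _).const_mul _)).const_mul _
  have hre := integral_re hint
  simp only [RCLike.re_eq_complex_re] at hre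
  rw [hre, integral_const_mul, integral_sub (hi _) ((hi _).const_mul _), integral_const_mul,
    integral_fourier, integral_fourier, if_neg (show j + k ≠ 0 by omega)]
  by_cases h : j = k
  · subst h; simp
  · simp [h, sub_eq_zero]

theorem integral_torusWave_mul (m n : ℕ) {k l k' l' : ℤ} (hk : 0 < k) (hl : 0 < l) (hk' : 0 < k')
    (hl' : 0 < l') :
    ∫ p, torusWave m n k l p * torusWave m n k' l' p ∂torusMeasure =
      if k = k' ∧ l = l' then 1 / 4 else 0 := by
  have e : ∀ p : T2, torusWave m n k l p * torusWave m n k' l' p =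
      (circleWave m k (p 0) * circleWave m k' (p 0)) *
        (circleWave n l (p 1) * circleWave n l' (p 1)) := fun p => by
    simp only [torusWave]; ring
  simp only [e]
  rw [integral_torus_mul (fun θ => circleWave m k θ * circleWave m k' θ)
    (fun θ => circleWave n l θ * circleWave n l' θ), integral_circleWave_mul m hk hk',
    integral_circleWave_mul n hl hl']
  by_cases h1 : k = k' <;> by_cases h2 : l = l' <;> simp [h1, h2]
  norm_num

/-! ### Continuous functions as elements of `L²` -/

theorem memLp_of_continuous {f : T2 → ℝ} (hf : Continuous f) (q : ℝ≥0∞) :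
    MemLp f q torusMeasure := by
  obtain ⟨C, hC⟩ := exists_norm_le_of_continuous hf
  exact MemLp.of_bound hf.aestronglyMeasurable C (ae_of_all _ hC)

theorem inner_eq_integral (u v : L2) : ⟪u, v⟫ = ∫ p, u p * v p ∂torusMeasure := by
  rw [L2.inner_def]
  refine integral_congr_ae (ae_of_all _ fun p => ?_)
  simp [mul_comm]

theorem inner_toLp (u : L2) {f : T2 → ℝ} (hf : MemLp f 2 torusMeasure) :
    ⟪u, hf.toLp f⟫ = ∫ p, u p * f p ∂torusMeasure := by
  rw [inner_eq_integral]
  refine integral_congr_ae ?_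
  filter_upwards [hf.coeFn_toLp] with p hp
  rw [hp]

/-- A smooth function as an element of `L²`. -/
def smoothL2 {φ : T2 → ℝ} (hφ : TorusContDiff ∞ φ) : L2 := (memLp_of_continuous hφ.continuous 2).toLp φ

theorem inner_smoothL2 (u : L2) {φ : T2 → ℝ} (hφ : TorusContDiff ∞ φ) :
    ⟪u, smoothL2 hφ⟫ = ∫ p, u p * φ p ∂torusMeasure := inner_toLp u _

theorem coeFn_smoothL2 {φ : T2 → ℝ} (hφ : TorusContDiff ∞ φ) :
    smoothL2 hφ =ᵐ[torusMeasure] φ := MemLp.coeFn_toLp _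

theorem isWeakDeriv_iff (m n : ℕ) (u v : L2) : IsWeakDeriv m n u v ↔
    ∀ (φ : T2 → ℝ) (hφ : TorusContDiff ∞ φ),
      ⟪u, smoothL2 (hφ.pdIter m n)⟫ = (-1) ^ (m + n) * ⟪v, smoothL2 hφ⟫ := by
  simp only [inner_smoothL2]
  rfl

theorem mFourier_eq_torusWave (k : Fin 2 → ℤ) (p : T2) :
    UnitAddTorus.mFourier k p =
      ((torusWave 1 1 (k 0) (k 1) p - torusWave 0 0 (k 0) (k 1) p : ℝ) : ℂ) +
        ((torusWave 1 0 (k 0) (k 1) p + torusWave 0 1 (k 0) (k 1) p : ℝ) : ℂ) * Complex.I := by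
  have h : ∀ (l : ℤ) (θ : UnitAddCircle), (fourier l θ : ℂ) =
      (circleWave 1 l θ : ℂ) + (circleWave 0 l θ : ℂ) * Complex.I := fun l θ => by
    rw [circleWave, circleWave]
    simp [Complex.re_add_im]
  simp only [UnitAddTorus.mFourier, Fin.prod_univ_two, ContinuousMap.coe_mk, torusWave]
  rw [h, h]
  push_cast
  linear_combination ((circleWave 0 (k 0) (p 0) : ℂ) * circleWave 0 (k 1) (p 1)) * Complex.I_sq

/-- The real and imaginary parts of every complex exponential are combinations of waves with phases
`m, n ≤ 1`, so completeness of the complex Fourier basis applies. -/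
theorem eq_zero_of_integral_torusWave {v : L2}
    (h : ∀ (m n : ℕ) (k l : ℤ), m ≤ 1 → n ≤ 1 → ∫ p, v p * torusWave m n k l p ∂torusMeasure = 0) :
    v = 0 := by
  have hv : MemLp (fun p => (v p : ℂ)) 2 torusMeasure := (Lp.memLp v).ofReal
  let w : Lp ℂ 2 torusMeasure := hv.toLp _
  have hcoef : ∀ k, UnitAddTorus.mFourierBasis.repr w k = 0 := by
    intro k
    have hw : UnitAddTorus.mFourierBasis.repr w k = UnitAddTorus.mFourierCoeff w k :=
      UnitAddTorus.mFourierBasis_repr w k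
    rw [hw]
    have e1 : UnitAddTorus.mFourierCoeff w k = ∫ p,
        (((v p * torusWave 1 1 (-k 0) (-k 1) p - v p * torusWave 0 0 (-k 0) (-k 1) p : ℝ) : ℂ) +
        ((v p * torusWave 1 0 (-k 0) (-k 1) p + v p * torusWave 0 1 (-k 0) (-k 1) p : ℝ) : ℂ) *
          Complex.I) ∂torusMeasure := by
      refine integral_congr_ae ?_
      filter_upwards [hv.coeFn_toLp] with p hp
      rw [hp, mFourier_eq_torusWave, smul_eq_mul]
      simp only [Pi.neg_apply]
      push_cast
      ring
    have hi : ∀ m n : ℕ, Integrable (fun p => v p * torusWave m n (-k 0) (-k 1) p) torusMeasure :=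
      fun m n => integrable_mul_of_continuous v (torusContDiff_torusWave _ _ _ _).continuous
    have i1 : Integrable (fun p => ((v p * torusWave 1 1 (-k 0) (-k 1) p -
        v p * torusWave 0 0 (-k 0) (-k 1) p : ℝ) : ℂ)) torusMeasure := ((hi 1 1).sub (hi 0 0)).ofReal
    have i2 : Integrable (fun p => ((v p * torusWave 1 0 (-k 0) (-k 1) p +
        v p * torusWave 0 1 (-k 0) (-k 1) p : ℝ) : ℂ) * Complex.I) torusMeasure :=
      (((hi 1 0).add (hi 0 1)).ofReal).mul_const _
    rw [e1, integral_add i1 i2, integral_mul_const, integral_complex_ofReal, integral_complex_ofReal,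
      integral_sub (hi 1 1) (hi 0 0), integral_add (hi 1 0) (hi 0 1), h 1 1 _ _ le_rfl le_rfl,
      h 0 0 _ _ zero_le_one zero_le_one, h 1 0 _ _ le_rfl zero_le_one,
      h 0 1 _ _ zero_le_one le_rfl]
    simp
  have hw0 : w = 0 := by
    apply UnitAddTorus.mFourierBasis.repr.injective
    rw [map_zero]
    ext k
    exact hcoef k
  rw [Lp.eq_zero_iff_ae_eq_zero] at hw0 ⊢
  filter_upwards [hw0, hv.coeFn_toLp] with p h1 h2
  rw [h2] at h1
  simpa using h1

theorem eq_zero_of_forall_smooth {v : L2}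
    (h : ∀ (φ : T2 → ℝ), TorusContDiff ∞ φ → ∫ p, v p * φ p ∂torusMeasure = 0) : v = 0 :=
  eq_zero_of_integral_torusWave fun m n k l _ _ => h _ (torusContDiff_torusWave m n k l)

/-! ### Reflections -/

theorem integral_comp_reflX (f : T2 → ℝ) :
    ∫ p, f (reflX p) ∂torusMeasure = ∫ p, f p ∂torusMeasure := by
  have hinv : Function.Involutive reflX := fun p => by funext i; fin_cases i <;> simp [reflX]
  let e : T2 ≃ᵐ T2 := ⟨hinv.toPerm reflX, measurePreserving_reflX.measurable,
    measurePreserving_reflX.measurable⟩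
  exact measurePreserving_reflX.integral_comp e.measurableEmbedding f

theorem integral_comp_reflY (f : T2 → ℝ) :
    ∫ p, f (reflY p) ∂torusMeasure = ∫ p, f p ∂torusMeasure := by
  have hinv : Function.Involutive reflY := fun p => by funext i; fin_cases i <;> simp [reflY]
  let e : T2 ≃ᵐ T2 := ⟨hinv.toPerm reflY, measurePreserving_reflY.measurable,
    measurePreserving_reflY.measurable⟩
  exact measurePreserving_reflY.integral_comp e.measurableEmbedding f

theorem integral_comp_swapXY (f : T2 → ℝ) :
    ∫ p, f (swapXY p) ∂torusMeasure = ∫ p, f p ∂torusMeasure := by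
  have hinv : Function.Involutive swapXY := fun p => by funext i; fin_cases i <;> simp [swapXY]
  let e : T2 ≃ᵐ T2 := ⟨hinv.toPerm swapXY, measurePreserving_swapXY.measurable,
    measurePreserving_swapXY.measurable⟩
  exact measurePreserving_swapXY.integral_comp e.measurableEmbedding f

theorem circleWave_neg (m : ℕ) (k : ℤ) (θ : UnitAddCircle) :
    circleWave m k (-θ) = circleWave m (-k) θ := by
  rw [circleWave, circleWave, fourier_apply, fourier_apply, smul_neg, neg_smul]

theorem circleWave_zero_neg (k : ℤ) (θ : UnitAddCircle) :
    circleWave 0 (-k) θ = -circleWave 0 k θ := by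
  rw [circleWave, circleWave, fourier_neg]
  simp

theorem circleWave_one_neg (k : ℤ) (θ : UnitAddCircle) :
    circleWave 1 (-k) θ = circleWave 1 k θ := by
  rw [circleWave, circleWave, fourier_neg]
  simp

theorem circleWave_zero_zero (θ : UnitAddCircle) : circleWave 0 0 θ = 0 := by
  simp [circleWave]

/-! ### The sine basis of the odd-odd subspace -/

/-- The product `2 sin (2π(k+1)x + mπ/2) sin (2π(l+1)y + nπ/2)`. -/
def sineBasisFun (m n : ℕ) (k : ℕ × ℕ) (p : T2) : ℝ :=
  2 * torusWave m n ((k.1 : ℤ) + 1) ((k.2 : ℤ) + 1) p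

theorem torusContDiff_sineBasisFun (m n : ℕ) (k : ℕ × ℕ) : TorusContDiff ∞ (sineBasisFun m n k) :=
  contDiff_const.mul (torusContDiff_torusWave _ _ _ _)

/-- The orthonormal system `2 sin (2π(k+1)x + mπ/2) sin (2π(l+1)y + nπ/2)` in `L²`. -/
def sineBasis (m n : ℕ) (k : ℕ × ℕ) : L2 := smoothL2 (torusContDiff_sineBasisFun m n k)

theorem orthonormal_sineBasis (m n : ℕ) : Orthonormal ℝ (sineBasis m n) := by
  rw [orthonormal_iff_ite]
  intro j k
  rw [sineBasis, sineBasis, inner_smoothL2]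
  have e : ∫ p, smoothL2 (torusContDiff_sineBasisFun m n j) p * sineBasisFun m n k p ∂torusMeasure =
      ∫ p, 4 * (torusWave m n ((j.1 : ℤ) + 1) ((j.2 : ℤ) + 1) p *
        torusWave m n ((k.1 : ℤ) + 1) ((k.2 : ℤ) + 1) p) ∂torusMeasure := by
    refine integral_congr_ae ?_
    filter_upwards [coeFn_smoothL2 (torusContDiff_sineBasisFun m n j)] with p hp
    rw [hp, sineBasisFun, sineBasisFun]
    ring
  rw [e, integral_const_mul, integral_torusWave_mul m n (by positivity) (by positivity)
    (by positivity) (by positivity)]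
  have : ((j.1 : ℤ) + 1 = (k.1 : ℤ) + 1 ∧ (j.2 : ℤ) + 1 = (k.2 : ℤ) + 1) ↔ j = k := by
    rw [Prod.ext_iff]; omega
  simp only [this]
  split_ifs <;> norm_num

theorem isOddOdd_sineBasisFun (k : ℕ × ℕ) : IsOddOdd (sineBasisFun 0 0 k) := by
  intro p
  simp only [sineBasisFun, torusWave, reflX, reflY, Matrix.cons_val_zero, Matrix.cons_val_one,
    circleWave_neg, circleWave_zero_neg]
  constructor <;> ring

theorem toLp_mem_L2OddOdd {f : T2 → ℝ} (hf : MemLp f 2 torusMeasure) (h : IsOddOdd f) :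
    hf.toLp f ∈ L2OddOdd := by
  rw [mem_L2OddOdd_iff]
  filter_upwards [hf.coeFn_toLp, measurePreserving_reflX.quasiMeasurePreserving.ae hf.coeFn_toLp,
    measurePreserving_reflY.quasiMeasurePreserving.ae hf.coeFn_toLp] with p h1 h2 h3
  rw [h1, h2, h3]
  exact h p

theorem sineBasis_mem (k : ℕ × ℕ) : sineBasis 0 0 k ∈ L2OddOdd :=
  toLp_mem_L2OddOdd (memLp_of_continuous (torusContDiff_sineBasisFun 0 0 k).continuous 2)
    (isOddOdd_sineBasisFun k)

theorem integral_mul_eq_zero_of_reflX {u : L2} (hu : u ∈ L2OddOdd) {f : T2 → ℝ}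
    (hf : ∀ p, f (reflX p) = f p) : ∫ p, u p * f p ∂torusMeasure = 0 := by
  have h := integral_comp_reflX fun p => u p * f p
  have e : ∫ p, u (reflX p) * f (reflX p) ∂torusMeasure = -∫ p, u p * f p ∂torusMeasure := by
    rw [← integral_neg]
    refine integral_congr_ae ?_
    filter_upwards [(mem_L2OddOdd_iff u).1 hu] with p hp
    rw [hp.1, hf, neg_mul]
  linarith

theorem integral_mul_eq_zero_of_reflY {u : L2} (hu : u ∈ L2OddOdd) {f : T2 → ℝ}
    (hf : ∀ p, f (reflY p) = f p) : ∫ p, u p * f p ∂torusMeasure = 0 := by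
  have h := integral_comp_reflY fun p => u p * f p
  have e : ∫ p, u (reflY p) * f (reflY p) ∂torusMeasure = -∫ p, u p * f p ∂torusMeasure := by
    rw [← integral_neg]
    refine integral_congr_ae ?_
    filter_upwards [(mem_L2OddOdd_iff u).1 hu] with p hp
    rw [hp.2, hf, neg_mul]
  linarith

/-- Oddness annihilates every wave with a cosine factor. A negative frequency only changes the sign
of a sine and zero frequency gives zero, so positive frequencies decide. -/
theorem eq_zero_of_inner_sineBasis {u : L2} (hu : u ∈ L2OddOdd)
    (h : ∀ k, ⟪u, sineBasis 0 0 k⟫ = 0) : u = 0 := by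
  refine eq_zero_of_integral_torusWave fun m n k l hm hn => ?_
  have hpos : ∀ k l : ℤ, 0 < k → 0 < l → ∫ p, u p * torusWave 0 0 k l p ∂torusMeasure = 0 := by
    intro k l hk hl
    have h1 := h ((k - 1).toNat, (l - 1).toNat)
    rw [sineBasis, inner_smoothL2] at h1
    simp only [sineBasisFun, Int.toNat_of_nonneg (show 0 ≤ k - 1 by omega),
      Int.toNat_of_nonneg (show 0 ≤ l - 1 by omega), sub_add_cancel, mul_left_comm _ (2 : ℝ),
      integral_const_mul] at h1
    linarith
  have hkey : ∀ k l : ℤ, 0 < l → ∫ p, u p * torusWave 0 0 k l p ∂torusMeasure = 0 := by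
    intro k l hl
    rcases lt_trichotomy k 0 with hk | rfl | hk
    · have h1 := hpos (-k) l (by omega) hl
      simp only [torusWave, circleWave_zero_neg, neg_mul, mul_neg, integral_neg] at h1
      simpa [torusWave] using h1
    · simp [torusWave, circleWave_zero_zero]
    · exact hpos k l hk hl
  interval_cases m
  · interval_cases n
    · rcases lt_trichotomy l 0 with hl | rfl | hl
      · have h1 := hkey k (-l) (by omega)
        simp only [torusWave, circleWave_zero_neg, mul_neg, integral_neg] at h1
        simpa [torusWave] using h1
      · simp [torusWave, circleWave_zero_zero]
      · exact hkey k l hl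
    · exact integral_mul_eq_zero_of_reflY hu fun p => by
        simp [torusWave, reflY, circleWave_neg, circleWave_one_neg]
  · exact integral_mul_eq_zero_of_reflX hu fun p => by
      simp [torusWave, reflX, circleWave_neg, circleWave_one_neg]

theorem isClosed_L2OddOdd : IsClosed (L2OddOdd : Set L2) := by
  have h : ∀ (r : T2 → T2) (hr : MeasurePreserving r torusMeasure torusMeasure),
      Continuous (Lp.compMeasurePreservingₗ ℝ r hr : L2 →ₗ[ℝ] L2) := fun r hr =>
    (Lp.isometry_compMeasurePreserving (E := ℝ) (p := 2) hr).continuous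
  have e : (L2OddOdd : Set L2) =
      {u | Lp.compMeasurePreservingₗ ℝ reflX measurePreserving_reflX u = -u} ∩
      {u | Lp.compMeasurePreservingₗ ℝ reflY measurePreserving_reflY u = -u} := rfl
  rw [e]
  exact (isClosed_eq (h _ _) continuous_neg).inter (isClosed_eq (h _ _) continuous_neg)

instance : CompleteSpace L2OddOdd := isClosed_L2OddOdd.completeSpace_coe

/-- The sine functions as elements of the odd-odd subspace. -/
def oddSine (k : ℕ × ℕ) : L2OddOdd := ⟨sineBasis 0 0 k, sineBasis_mem k⟩

theorem orthonormal_oddSine : Orthonormal ℝ oddSine :=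
  (orthonormal_sineBasis 0 0).codRestrict L2OddOdd sineBasis_mem

theorem span_oddSine_orthogonal : (Submodule.span ℝ (range oddSine))ᗮ = ⊥ := by
  rw [Submodule.eq_bot_iff]
  intro u hu
  rw [Submodule.mem_orthogonal'] at hu
  refine Subtype.ext (eq_zero_of_inner_sineBasis u.2 fun k => ?_)
  exact hu _ (Submodule.subset_span (mem_range_self k))

/-- The sine functions form a Hilbert basis of the odd-odd subspace of `L²`. -/
def oddBasis : HilbertBasis (ℕ × ℕ) ℝ L2OddOdd :=
  HilbertBasis.mkOfOrthogonalEqBot orthonormal_oddSine span_oddSine_orthogonal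

theorem oddBasis_apply (k : ℕ × ℕ) : (oddBasis k : L2) = sineBasis 0 0 k := by
  have : oddBasis k = oddSine k := by
    rw [oddBasis, HilbertBasis.coe_mkOfOrthogonalEqBot]
  rw [this]
  rfl

/-- The sine coefficients of an `L²` function. -/
def sineInner (u : L2) (k : ℕ × ℕ) : ℝ := ⟪u, sineBasis 0 0 k⟫

theorem oddBasis_repr (u : L2OddOdd) (k : ℕ × ℕ) : oddBasis.repr u k = sineInner u k := by
  rw [HilbertBasis.repr_apply_apply, sineInner, ← oddBasis_apply, real_inner_comm]
  rfl

theorem hasSum_sineInner {u : L2} (hu : u ∈ L2OddOdd) :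
    HasSum (fun k => sineInner u k • sineBasis 0 0 k) u := by
  have h := (oddBasis.hasSum_repr ⟨u, hu⟩).mapL L2OddOdd.subtypeL
  simpa [oddBasis_repr, oddBasis_apply] using! h

theorem summable_sineInner_sq (u : L2) : Summable fun k => sineInner u k ^ 2 := by
  have h := (orthonormal_sineBasis 0 0).inner_products_summable u
  refine h.congr fun k => ?_
  rw [sineInner, real_inner_comm, Real.norm_eq_abs, sq_abs]

theorem hasSum_inner {u : L2} (hu : u ∈ L2OddOdd) (v : L2) :
    HasSum (fun k => sineInner u k * sineInner v k) ⟪u, v⟫ := by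
  have h := (hasSum_sineInner hu).mapL (innerSL ℝ v)
  rw [real_inner_comm]
  simpa [sineInner, innerSL_apply_apply, inner_smul_right] using! h

theorem ext_sineInner {u v : L2} (hu : u ∈ L2OddOdd) (hv : v ∈ L2OddOdd)
    (h : ∀ k, sineInner u k = sineInner v k) : u = v := by
  rw [← sub_eq_zero]
  refine eq_zero_of_inner_sineBasis (L2OddOdd.sub_mem hu hv) fun k => ?_
  rw [inner_sub_left, sub_eq_zero]
  exact h k

/-! ### The Laplacian on odd-odd `H²` functions -/

theorem H2.isWeakDeriv (U : H2) (α : MultiIndex) :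
    IsWeakDeriv α.1.1 α.1.2 (H2.toL2 U) (U.1 α) := U.2 α

/-- Each weak derivative relation, tested against a fixed smooth function, is a continuous linear
equation. The resulting completeness feeds the open mapping theorem. -/
theorem isClosed_H2 : IsClosed (H2 : Set (PiLp 2 fun _ : MultiIndex => L2)) := by
  have e : (H2 : Set (PiLp 2 fun _ : MultiIndex => L2)) = ⋂ (α : MultiIndex) (φ : T2 → ℝ)
      (hφ : TorusContDiff ∞ φ), {U | ⟪U ix00, smoothL2 (hφ.pdIter α.1.1 α.1.2)⟫ =
        (-1) ^ ((α.1.1 : ℕ) + α.1.2) * ⟪U α, smoothL2 hφ⟫} := by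
    ext U
    simp only [mem_iInter, mem_ofPred_eq]
    exact forall_congr' fun α => isWeakDeriv_iff _ _ _ _
  rw [e]
  refine isClosed_iInter fun α => isClosed_iInter fun φ => isClosed_iInter fun hφ => ?_
  refine isClosed_eq ?_ ?_
  · exact (PiLp.continuous_apply 2 (fun _ : MultiIndex => L2) ix00).inner continuous_const
  · exact continuous_const.mul
      ((PiLp.continuous_apply 2 (fun _ : MultiIndex => L2) α).inner continuous_const)

instance : CompleteSpace H2 := isClosed_H2.completeSpace_coe

theorem continuous_H2_apply (α : MultiIndex) : Continuous fun U : H2 => U.1 α :=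
  (PiLp.continuous_apply 2 (fun _ : MultiIndex => L2) α).comp continuous_subtype_val

theorem continuous_toL2 : Continuous H2.toL2 := continuous_H2_apply ix00

theorem continuous_laplacian : Continuous H2.laplacian :=
  (continuous_H2_apply ix20).add (continuous_H2_apply ix02)

theorem isClosed_H2OddOdd : IsClosed (H2OddOdd : Set H2) :=
  isClosed_L2OddOdd.preimage continuous_toL2

instance : CompleteSpace H2OddOdd := isClosed_H2OddOdd.completeSpace_coe

theorem integral_laplacian_mul (U : H2) {φ : T2 → ℝ} (hφ : TorusContDiff ∞ φ) :
    ∫ p, H2.laplacian U p * φ p ∂torusMeasure =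
      ∫ p, H2.toL2 U p * (pdIter 2 0 φ p + pdIter 0 2 φ p) ∂torusMeasure := by
  have h1 : ∫ p, H2.toL2 U p * pdIter 2 0 φ p ∂torusMeasure =
      (-1) ^ (2 + 0) * ∫ p, U.1 ix20 p * φ p ∂torusMeasure := U.2 ix20 φ hφ
  have h2 : ∫ p, H2.toL2 U p * pdIter 0 2 φ p ∂torusMeasure =
      (-1) ^ (0 + 2) * ∫ p, U.1 ix02 p * φ p ∂torusMeasure := U.2 ix02 φ hφ
  have e : ∫ p, H2.laplacian U p * φ p ∂torusMeasure =
      ∫ p, (U.1 ix20 p * φ p + U.1 ix02 p * φ p) ∂torusMeasure := by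
    refine integral_congr_ae ?_
    filter_upwards [Lp.coeFn_add (U.1 ix20) (U.1 ix02)] with p hp
    have : H2.laplacian U p = U.1 ix20 p + U.1 ix02 p := hp
    rw [this, add_mul]
  simp only [mul_add]
  rw [e, integral_add (integrable_mul_of_continuous _ hφ.continuous)
    (integrable_mul_of_continuous _ hφ.continuous),
    integral_add (integrable_mul_of_continuous _ (hφ.pdIter 2 0).continuous)
    (integrable_mul_of_continuous _ (hφ.pdIter 0 2).continuous), h1, h2]
  norm_num

theorem pd_zero_comp_reflX (f : T2 → ℝ) :
    pd 0 (fun p => f (reflX p)) = fun p => -pd 0 f (reflX p) := by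
  funext p
  have : (fun t : ℝ => f (reflX (p + Pi.single 0 (t : UnitAddCircle)))) =
      fun t => (fun s : ℝ => f (reflX p + Pi.single 0 (s : UnitAddCircle))) (-t) := by
    funext t
    simp only
    congr 1
    funext j
    fin_cases j <;> simp [reflX, add_comm]
  rw [pd, this]
  refine (deriv_comp_neg (fun s : ℝ => f (reflX p + Pi.single 0 (s : UnitAddCircle))) 0).trans ?_
  rw [neg_zero, pd]

theorem pd_one_comp_reflX (f : T2 → ℝ) :
    pd 1 (fun p => f (reflX p)) = fun p => pd 1 f (reflX p) := by
  funext p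
  rw [pd, pd]
  congr 1
  funext t
  congr 1
  funext j
  fin_cases j <;> simp [reflX]

theorem pd_one_comp_reflY (f : T2 → ℝ) :
    pd 1 (fun p => f (reflY p)) = fun p => -pd 1 f (reflY p) := by
  funext p
  have : (fun t : ℝ => f (reflY (p + Pi.single 1 (t : UnitAddCircle)))) =
      fun t => (fun s : ℝ => f (reflY p + Pi.single 1 (s : UnitAddCircle))) (-t) := by
    funext t
    simp only
    congr 1
    funext j
    fin_cases j <;> simp [reflY, add_comm]
  rw [pd, this]
  refine (deriv_comp_neg (fun s : ℝ => f (reflY p + Pi.single 1 (s : UnitAddCircle))) 0).trans ?_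
  rw [neg_zero, pd]

theorem pd_zero_comp_reflY (f : T2 → ℝ) :
    pd 0 (fun p => f (reflY p)) = fun p => pd 0 f (reflY p) := by
  funext p
  rw [pd, pd]
  congr 1
  funext t
  congr 1
  funext j
  fin_cases j <;> simp [reflY]

theorem pd_neg (i : Fin 2) (f : T2 → ℝ) : pd i (fun p => -f p) = fun p => -pd i f p := by
  have := pd_const_mul i (-1) f
  simpa only [neg_one_mul] using this

theorem pdIter_comp_reflX (f : T2 → ℝ) (p : T2) :
    pdIter 2 0 (fun p => f (reflX p)) p = pdIter 2 0 f (reflX p) ∧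
    pdIter 0 2 (fun p => f (reflX p)) p = pdIter 0 2 f (reflX p) := by
  simp only [pdIter, Function.iterate_succ, Function.iterate_zero, Function.comp_apply, id,
    pd_zero_comp_reflX, pd_one_comp_reflX, pd_neg, neg_neg, and_self]

theorem pdIter_comp_reflY (f : T2 → ℝ) (p : T2) :
    pdIter 2 0 (fun p => f (reflY p)) p = pdIter 2 0 f (reflY p) ∧
    pdIter 0 2 (fun p => f (reflY p)) p = pdIter 0 2 f (reflY p) := by
  simp only [pdIter, Function.iterate_succ, Function.iterate_zero, Function.comp_apply, id,
    pd_zero_comp_reflY, pd_one_comp_reflY, pd_neg, neg_neg, and_self]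

theorem TorusContDiff.comp_reflX {n : ℕ∞ω} {f : T2 → ℝ} (hf : TorusContDiff n f) :
    TorusContDiff n fun p => f (reflX p) := by
  have : (fun x : Fin 2 → ℝ => f (reflX (proj x))) =
      (fun x : Fin 2 → ℝ => f (proj x)) ∘ fun x => ![-x 0, x 1] := by
    funext x
    simp only [Function.comp_apply]
    congr 1
    funext j
    fin_cases j <;> rfl
  unfold TorusContDiff
  rw [this]
  refine ContDiff.comp hf (contDiff_pi.2 fun j => ?_)
  fin_cases j
  · exact (contDiff_apply ℝ ℝ (0 : Fin 2)).neg
  · exact contDiff_apply ℝ ℝ (1 : Fin 2)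

theorem TorusContDiff.comp_reflY {n : ℕ∞ω} {f : T2 → ℝ} (hf : TorusContDiff n f) :
    TorusContDiff n fun p => f (reflY p) := by
  have : (fun x : Fin 2 → ℝ => f (reflY (proj x))) =
      (fun x : Fin 2 → ℝ => f (proj x)) ∘ fun x => ![x 0, -x 1] := by
    funext x
    simp only [Function.comp_apply]
    congr 1
    funext j
    fin_cases j <;> rfl
  unfold TorusContDiff
  rw [this]
  refine ContDiff.comp hf (contDiff_pi.2 fun j => ?_)
  fin_cases j
  · exact contDiff_apply ℝ ℝ (0 : Fin 2)
  · exact (contDiff_apply ℝ ℝ (1 : Fin 2)).neg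

/-- The involution moves from `v` to the test function by invariance of the measure, so oddness may
be checked weakly. -/
theorem odd_of_forall_smooth {v : L2} {r : T2 → T2}
    (hr : MeasurePreserving r torusMeasure torusMeasure)
    (hint : ∀ f : T2 → ℝ, ∫ p, f (r p) ∂torusMeasure = ∫ p, f p ∂torusMeasure)
    (hinv : ∀ p, r (r p) = p)
    (h : ∀ φ : T2 → ℝ, TorusContDiff ∞ φ →
      ∫ p, v p * φ (r p) ∂torusMeasure = -∫ p, v p * φ p ∂torusMeasure) :
    ∀ᵐ p ∂torusMeasure, v (r p) = -v p := by
  have h0 : Lp.compMeasurePreserving r hr v + v = 0 := by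
    refine eq_zero_of_forall_smooth fun φ hφ => ?_
    have e : ∫ p, (Lp.compMeasurePreserving r hr v + v : L2) p * φ p ∂torusMeasure =
        ∫ p, (Lp.compMeasurePreserving r hr v p * φ p + v p * φ p) ∂torusMeasure := by
      refine integral_congr_ae ?_
      filter_upwards [Lp.coeFn_add (Lp.compMeasurePreserving r hr v) v] with p hp
      rw [hp, Pi.add_apply, add_mul]
    have e2 : ∫ p, Lp.compMeasurePreserving r hr v p * φ p ∂torusMeasure =
        ∫ p, v (r p) * φ (r (r p)) ∂torusMeasure := by
      refine integral_congr_ae ?_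
      filter_upwards [Lp.coeFn_compMeasurePreserving v hr] with p hp
      rw [hp, hinv]
      rfl
    rw [e, integral_add (integrable_mul_of_continuous _ hφ.continuous)
      (integrable_mul_of_continuous _ hφ.continuous), e2,
      hint (fun p => v p * φ (r p)), h φ hφ]
    ring
  rw [Lp.eq_zero_iff_ae_eq_zero] at h0
  filter_upwards [h0, Lp.coeFn_add (Lp.compMeasurePreserving r hr v) v,
    Lp.coeFn_compMeasurePreserving v hr] with p h1 h2 h3
  rw [h2, Pi.add_apply, h3] at h1
  simp only [Function.comp_apply, Pi.zero_apply] at h1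
  linarith

theorem reflX_reflX (p : T2) : reflX (reflX p) = p := by funext i; fin_cases i <;> simp [reflX]

theorem reflY_reflY (p : T2) : reflY (reflY p) = p := by funext i; fin_cases i <;> simp [reflY]

theorem laplacian_mem_L2OddOdd {U : H2} (hU : U ∈ H2OddOdd) : H2.laplacian U ∈ L2OddOdd := by
  have hu : ∀ᵐ p ∂torusMeasure, H2.toL2 U (reflX p) = -H2.toL2 U p ∧
      H2.toL2 U (reflY p) = -H2.toL2 U p := (mem_L2OddOdd_iff _).1 hU
  rw [mem_L2OddOdd_iff, eventually_and]
  constructor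
  · refine odd_of_forall_smooth measurePreserving_reflX integral_comp_reflX reflX_reflX
      fun φ hφ => ?_
    rw [integral_laplacian_mul U hφ.comp_reflX, integral_laplacian_mul U hφ,
      ← integral_comp_reflX, ← integral_neg]
    refine integral_congr_ae ?_
    filter_upwards [hu] with p hp
    rw [(pdIter_comp_reflX φ _).1, (pdIter_comp_reflX φ _).2, reflX_reflX, hp.1, neg_mul]
  · refine odd_of_forall_smooth measurePreserving_reflY integral_comp_reflY reflY_reflY
      fun φ hφ => ?_
    rw [integral_laplacian_mul U hφ.comp_reflY, integral_laplacian_mul U hφ,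
      ← integral_comp_reflY, ← integral_neg]
    refine integral_congr_ae ?_
    filter_upwards [hu] with p hp
    rw [(pdIter_comp_reflY φ _).1, (pdIter_comp_reflY φ _).2, reflY_reflY, hp.2, neg_mul]

/-! ### Solving Poisson's equation by sine coefficients -/

/-- The eigenvalue `4π²((k+1)² + (l+1)²)` of `-Δ` on the sine functions. -/
def sineEigenvalue (k : ℕ × ℕ) : ℝ :=
  (2 * Real.pi * ((k.1 : ℝ) + 1)) ^ 2 + (2 * Real.pi * ((k.2 : ℝ) + 1)) ^ 2

theorem one_le_two_pi_mul (k : ℕ) : 1 ≤ 2 * Real.pi * ((k : ℝ) + 1) := by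
  nlinarith [Real.pi_gt_three, (Nat.cast_nonneg k : (0 : ℝ) ≤ k)]

theorem one_le_sineEigenvalue (k : ℕ × ℕ) : 1 ≤ sineEigenvalue k := by
  unfold sineEigenvalue
  nlinarith [one_le_two_pi_mul k.1, one_le_two_pi_mul k.2]

theorem pdIter_two_sineBasisFun (k : ℕ × ℕ) (p : T2) :
    pdIter 2 0 (sineBasisFun 0 0 k) p + pdIter 0 2 (sineBasisFun 0 0 k) p =
      -sineEigenvalue k * sineBasisFun 0 0 k p := by
  have h := pdIter_two_torusWave ((k.1 : ℤ) + 1) ((k.2 : ℤ) + 1) p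
  simp only [pdIter, Function.iterate_zero, id] at h
  have e : sineBasisFun 0 0 k = fun p => 2 * torusWave 0 0 ((k.1 : ℤ) + 1) ((k.2 : ℤ) + 1) p := rfl
  simp only [pdIter, Function.iterate_zero, id]
  rw [e, pd_iterate_const_mul, pd_iterate_const_mul]
  simp only
  rw [h.1, h.2, sineEigenvalue]
  push_cast
  ring

theorem sineInner_eq_integral (u : L2) (k : ℕ × ℕ) :
    sineInner u k = ∫ p, u p * sineBasisFun 0 0 k p ∂torusMeasure := inner_smoothL2 _ _

theorem sineInner_laplacian (U : H2) (k : ℕ × ℕ) :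
    sineInner (H2.laplacian U) k = -sineEigenvalue k * sineInner (H2.toL2 U) k := by
  rw [sineInner_eq_integral, sineInner_eq_integral,
    integral_laplacian_mul U (torusContDiff_sineBasisFun 0 0 k), ← integral_const_mul]
  refine integral_congr_ae (ae_of_all _ fun p => ?_)
  simp only
  rw [pdIter_two_sineBasisFun]
  ring

theorem summable_smul_of_orthonormal {ι : Type*} {v : ι → L2} (hv : Orthonormal ℝ v) {c : ι → ℝ}
    (hc : Summable fun i => c i ^ 2) : Summable fun i => c i • v i := by
  have h := (hv.orthogonalFamily.summable_iff_norm_sq_summable c).2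
    (by simpa only [Real.norm_eq_abs, sq_abs] using hc)
  simpa using h

/-- The frequency factor of the derivative `∂₁^m ∂₂^n` of a sine function. -/
def freqFactor (m n : ℕ) (k : ℕ × ℕ) : ℝ :=
  (2 * Real.pi * ((k.1 : ℝ) + 1)) ^ m * (2 * Real.pi * ((k.2 : ℝ) + 1)) ^ n

/-- All frequencies are at least `1`, so lower order derivatives never exceed second order ones, and
control of the Laplacian controls the full `H²` norm. -/
theorem abs_freqFactor_le {m n : ℕ} (h : m + n ≤ 2) (k : ℕ × ℕ) :
    |freqFactor m n k| ≤ sineEigenvalue k := by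
  have h1 := one_le_two_pi_mul k.1
  have h2 := one_le_two_pi_mul k.2
  unfold freqFactor sineEigenvalue
  generalize 2 * Real.pi * ((k.1 : ℝ) + 1) = a at *
  generalize 2 * Real.pi * ((k.2 : ℝ) + 1) = b at *
  rw [abs_of_pos (by positivity)]
  have key : ∀ c : ℝ, 1 ≤ c → a ≤ c → b ≤ c → a ^ m * b ^ n ≤ c ^ 2 := fun c hc ha hb =>
    calc a ^ m * b ^ n ≤ c ^ m * c ^ n := by gcongr
      _ = c ^ (m + n) := by rw [pow_add]
      _ ≤ c ^ 2 := pow_le_pow_right₀ hc h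
  rcases le_total a b with h3 | h3
  · linarith [key b h2 h3 le_rfl, sq_nonneg a]
  · linarith [key a h1 le_rfl h3, sq_nonneg b]

theorem inner_sineBasis_pdIter (m n : ℕ) (k : ℕ × ℕ) {φ : T2 → ℝ} (hφ : TorusContDiff ∞ φ) :
    ⟪sineBasis 0 0 k, smoothL2 (hφ.pdIter m n)⟫ =
      (-1) ^ (m + n) * (freqFactor m n k * ⟪sineBasis m n k, smoothL2 hφ⟫) := by
  have e : ∀ (a b : ℕ) {χ : T2 → ℝ} (hχ : TorusContDiff ∞ χ), ⟪sineBasis a b k, smoothL2 hχ⟫ =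
      2 * ∫ p, torusWave a b ((k.1 : ℤ) + 1) ((k.2 : ℤ) + 1) p * χ p ∂torusMeasure := by
    intro a b χ hχ
    rw [inner_smoothL2, ← integral_const_mul]
    refine integral_congr_ae ?_
    filter_upwards [coeFn_smoothL2 (torusContDiff_sineBasisFun a b k)] with p hp
    rw [sineBasis, hp, sineBasisFun]
    ring
  rw [e, e, integral_torusWave_mul_pdIter m n _ _ hφ, freqFactor]
  push_cast
  ring

/-- Every sequence with `∑ λ_k² c_k² < ∞` is the sequence of sine coefficients of an odd-odd
function in `H²`. -/
theorem exists_H2_of_summable {c : ℕ × ℕ → ℝ}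
    (hc : Summable fun k => (sineEigenvalue k * c k) ^ 2) :
    ∃ U ∈ H2OddOdd, ∀ k, sineInner (H2.toL2 U) k = c k := by
  have hs : ∀ {m n : ℕ}, m + n ≤ 2 →
      Summable fun k => (c k * freqFactor m n k) • sineBasis m n k := fun {m n} hmn => by
    refine summable_smul_of_orthonormal (orthonormal_sineBasis m n)
      (Summable.of_nonneg_of_le (fun _ => sq_nonneg _) (fun k => ?_) hc)
    rw [sq_le_sq, abs_mul, abs_mul, mul_comm |sineEigenvalue k|]
    exact mul_le_mul_of_nonneg_left ((abs_freqFactor_le hmn k).trans (le_abs_self _))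
      (abs_nonneg _)
  let v : ∀ _ : MultiIndex, L2 := fun α =>
    ∑' k, (c k * freqFactor α.1.1 α.1.2 k) • sineBasis α.1.1 α.1.2 k
  have hv : ∀ α : MultiIndex,
      HasSum (fun k => (c k * freqFactor α.1.1 α.1.2 k) • sineBasis α.1.1 α.1.2 k) (v α) :=
    fun α => (hs α.2).hasSum
  have h0 : HasSum (fun k => c k • sineBasis 0 0 k) (v ix00) := by
    refine (hv ix00).congr_fun fun k => ?_
    simp [ix00, freqFactor]
  have hin : ∀ (α : MultiIndex) (w : L2), HasSum (fun k => c k * freqFactor α.1.1 α.1.2 k *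
      ⟪sineBasis α.1.1 α.1.2 k, w⟫) ⟪v α, w⟫ := fun α w => by
    have h := (hv α).mapL (innerSL ℝ w)
    rw [real_inner_comm]
    refine h.congr_fun fun k => ?_
    rw [innerSL_apply_apply, inner_smul_right, real_inner_comm]
  -- The weak derivative relation holds for each sine function, and both sides are sums of
  -- convergent series of inner products.
  let U : H2 := ⟨WithLp.toLp 2 v, fun α => by
    rw [isWeakDeriv_iff]
    intro φ hφ
    have h1 := (hin ix00 (smoothL2 (hφ.pdIter α.1.1 α.1.2)))
    have h2 := (hin α (smoothL2 hφ)).mul_left ((-1) ^ ((α.1.1 : ℕ) + α.1.2))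
    refine h1.unique (h2.congr_fun fun k => ?_)
    have h3 := inner_sineBasis_pdIter α.1.1 α.1.2 k hφ
    simp only [ix00, Fin.val_zero, freqFactor, pow_zero, mul_one] at h3 ⊢
    rw [h3]
    ring⟩
  have hU : H2.toL2 U = v ix00 := rfl
  refine ⟨U, ?_, fun k => ?_⟩
  · change H2.toL2 U ∈ L2OddOdd
    rw [hU]
    exact isClosed_L2OddOdd.mem_of_tendsto h0 (Eventually.of_forall fun s =>
      L2OddOdd.sum_mem fun k _ => L2OddOdd.smul_mem _ (sineBasis_mem k))
  · rw [hU, sineInner]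
    have h := hin ix00 (sineBasis 0 0 k)
    refine h.unique ((hasSum_ite_eq k (c k)).congr_fun fun j => ?_)
    have h3 := orthonormal_iff_ite.1 (orthonormal_sineBasis 0 0) j k
    simp only [ix00, Fin.val_zero, freqFactor, pow_zero, mul_one]
    rw [h3]
    split_ifs with h4 <;> simp [h4]

/-- Weak derivatives are unique, so the stored family carries no information beyond the underlying
function. -/
theorem H2_ext {U V : H2} (h : H2.toL2 U = H2.toL2 V) : U = V := by
  refine Subtype.ext (PiLp.ext fun α => ?_)
  rw [← sub_eq_zero]
  refine eq_zero_of_forall_smooth fun φ hφ => ?_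
  have h1 := (isWeakDeriv_iff _ _ _ _).1 (H2.isWeakDeriv U α) φ hφ
  have h2 := (isWeakDeriv_iff _ _ _ _).1 (H2.isWeakDeriv V α) φ hφ
  rw [h, h2] at h1
  rw [← inner_smoothL2 _ hφ, inner_sub_left, sub_eq_zero]
  exact (mul_left_cancel₀ (pow_ne_zero _ (by norm_num)) h1).symm

theorem eq_of_laplacian_eq {U V : H2} (hU : U ∈ H2OddOdd) (hV : V ∈ H2OddOdd)
    (h : H2.laplacian U = H2.laplacian V) : U = V := by
  refine H2_ext (ext_sineInner hU hV fun k => ?_)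
  have h1 := sineInner_laplacian U k
  rw [h, sineInner_laplacian V k] at h1
  have := one_le_sineEigenvalue k
  exact (mul_left_cancel₀ (by linarith) h1).symm

/-- Divide the sine coefficients by the eigenvalues; Bessel's inequality for `f` is exactly the
summability needed to land in `H²`. -/
theorem exists_laplacian_eq {f : L2} (hf : f ∈ L2OddOdd) : ∃ U ∈ H2OddOdd, H2.laplacian U = f := by
  obtain ⟨U, hU, hc⟩ := exists_H2_of_summable (c := fun k => -(sineInner f k / sineEigenvalue k))
    ((summable_sineInner_sq f).congr fun k => by
      have := one_le_sineEigenvalue k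
      field_simp)
  refine ⟨U, hU, ext_sineInner (laplacian_mem_L2OddOdd hU) hf fun k => ?_⟩
  have := one_le_sineEigenvalue k
  rw [sineInner_laplacian, hc]
  field_simp

/-- The Laplacian as a linear isomorphism between the odd-odd subspaces of `H²` and `L²`. -/
def laplacianEquiv : H2OddOdd ≃ₗ[ℝ] L2OddOdd :=
  LinearEquiv.ofBijective
    ((H2.laplacian.comp H2OddOdd.subtype).codRestrict L2OddOdd fun U => laplacian_mem_L2OddOdd U.2)
    ⟨fun U V h => Subtype.ext (eq_of_laplacian_eq U.2 V.2 (congrArg Subtype.val h)), fun f => by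
      obtain ⟨U, hU, h⟩ := exists_laplacian_eq f.2
      exact ⟨⟨U, hU⟩, Subtype.ext h⟩⟩

theorem laplacianEquiv_apply (U : H2OddOdd) :
    (laplacianEquiv U : L2) = H2.laplacian (U : H2) := rfl

/-- The Dirichlet form `⟨-ΔU, U⟩` in terms of sine coefficients. -/
theorem hasSum_dirichlet {U : H2} (hU : U ∈ H2OddOdd) :
    HasSum (fun k => sineEigenvalue k * sineInner (H2.toL2 U) k ^ 2)
      (-⟪H2.laplacian U, H2.toL2 U⟫) := by
  refine (hasSum_inner (laplacian_mem_L2OddOdd hU) (H2.toL2 U)).neg.congr_fun fun k => ?_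
  rw [sineInner_laplacian]
  ring

/-! ### Multiplication operators on `L²` -/

/-- Multiplication by a bounded function on `L²`. -/
def mulL2 {w : T2 → ℝ} (hw : MemLp w ∞ torusMeasure) : L2 →L[ℝ] L2 :=
  (ContinuousLinearMap.mul ℝ ℝ).holderL torusMeasure ∞ 2 2 (hw.toLp w)

theorem coeFn_mulL2 {w : T2 → ℝ} (hw : MemLp w ∞ torusMeasure) (u : L2) :
    mulL2 hw u =ᵐ[torusMeasure] fun p => w p * u p := by
  have h := (ContinuousLinearMap.mul ℝ ℝ).coeFn_holder (r := 2) (hw.toLp w) u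
  filter_upwards [h, hw.coeFn_toLp] with p h1 h2
  have h3 : mulL2 hw u p = (ContinuousLinearMap.mul ℝ ℝ) (hw.toLp w p) (u p) := h1
  rw [h3, h2]
  rfl

theorem inner_mulL2 {w : T2 → ℝ} (hw : MemLp w ∞ torusMeasure) (u v : L2) :
    ⟪mulL2 hw u, v⟫ = ∫ p, w p * (u p * v p) ∂torusMeasure := by
  rw [inner_eq_integral]
  refine integral_congr_ae ?_
  filter_upwards [coeFn_mulL2 hw u] with p hp
  rw [hp, mul_assoc]

theorem integrable_mul_mul {w : T2 → ℝ} (hw : MemLp w ∞ torusMeasure) (u v : L2) :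
    Integrable (fun p => w p * (u p * v p)) torusMeasure := by
  have h := L2.integrable_inner (𝕜 := ℝ) (mulL2 hw u) v
  refine h.congr ?_
  filter_upwards [coeFn_mulL2 hw u] with p hp
  simp [hp]
  ring

/-! ### Poincaré inequality in a strip around the zero set -/

/-- Cauchy–Schwarz, obtained by expanding `∫ (g' - c)² ≥ 0` with `c` the mean slope. -/
theorem sq_sub_le_mul_integral_deriv_sq {g g' : ℝ → ℝ} (hg : ∀ x, HasDerivAt g (g' x) x)
    (hg' : Continuous g') {a b : ℝ} (hab : a ≤ b) :
    (g b - g a) ^ 2 ≤ (b - a) * ∫ s in a..b, g' s ^ 2 := by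
  rcases hab.eq_or_lt with rfl | hlt
  · simp
  have hpos : 0 < b - a := sub_pos.2 hlt
  set c := (g b - g a) / (b - a) with hc
  have hftc : ∫ s in a..b, g' s = g b - g a :=
    intervalIntegral.integral_eq_sub_of_hasDerivAt (fun x _ => hg x) (hg'.intervalIntegrable _ _)
  have h0 : 0 ≤ ∫ s in a..b, (g' s - c) ^ 2 :=
    intervalIntegral.integral_nonneg hab fun _ _ => sq_nonneg _
  have i1 : IntervalIntegrable (fun s => g' s ^ 2) volume a b :=
    (hg'.pow 2).intervalIntegrable _ _
  have i2 : IntervalIntegrable (fun s => 2 * c * g' s) volume a b :=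
    (hg'.const_mul _).intervalIntegrable _ _
  have e : ∀ s, (g' s - c) ^ 2 = g' s ^ 2 - 2 * c * g' s + c ^ 2 := fun s => by ring
  simp only [e] at h0
  rw [intervalIntegral.integral_add (i1.sub i2) (by simp), intervalIntegral.integral_sub i1 i2,
    intervalIntegral.integral_const_mul, hftc, intervalIntegral.integral_const, smul_eq_mul] at h0
  have hcb : c * (b - a) = g b - g a := by rw [hc]; field_simp
  rw [← hcb] at h0 ⊢
  nlinarith

theorem haarAddCircle_eq_volume :
    (AddCircle.haarAddCircle : Measure UnitAddCircle) = volume := by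
  rw [AddCircle.volume_eq_smul_haarAddCircle, ENNReal.ofReal_one, one_smul]

theorem measurableSet_nearHalfLattice (τ : ℝ) : MeasurableSet (nearHalfLattice τ) :=
  Metric.isClosed_closedBall.measurableSet.union Metric.isClosed_closedBall.measurableSet

theorem measureReal_nearHalfLattice_le {τ : ℝ} (hτ : 0 ≤ τ) :
    (AddCircle.haarAddCircle : Measure UnitAddCircle).real (nearHalfLattice τ) ≤ 4 * τ := by
  have h : ∀ θ : UnitAddCircle,
      (AddCircle.haarAddCircle : Measure UnitAddCircle).real (Metric.closedBall θ τ) ≤ 2 * τ := by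
    intro θ
    rw [haarAddCircle_eq_volume, Measure.real, AddCircle.volume_closedBall,
      ENNReal.toReal_ofReal (le_min zero_le_one (by positivity))]
    exact min_le_right _ _
  refine (measureReal_union_le _ _).trans ?_
  linarith [h 0, h ((1 / 2 : ℝ) : UnitAddCircle)]

/-- A point near the half-lattice is within `min τ (1/2)` of a half-lattice point. -/
theorem exists_rep_of_mem_nearHalfLattice {θ : UnitAddCircle} {τ : ℝ} (hθ : θ ∈ nearHalfLattice τ) :
    ∃ x a : ℝ, θ = (x : UnitAddCircle) ∧ -(a : UnitAddCircle) = (a : UnitAddCircle) ∧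
      |x - a| ≤ τ ∧ |x - a| ≤ 1 / 2 := by
  have key : ∀ a : ℝ, θ ∈ Metric.closedBall (a : UnitAddCircle) τ →
      ∃ x : ℝ, θ = (x : UnitAddCircle) ∧ |x - a| ≤ τ ∧ |x - a| ≤ 1 / 2 := by
    intro a ha
    rw [Metric.mem_closedBall, dist_eq_norm] at ha
    obtain ⟨y, hy⟩ := QuotientAddGroup.mk_surjective (θ - (a : UnitAddCircle))
    have hy' : θ - (a : UnitAddCircle) = (y : UnitAddCircle) := hy.symm
    rw [hy', UnitAddCircle.norm_eq] at ha
    refine ⟨y - round y + a, ?_, by simpa using ha, by simpa using abs_sub_round y⟩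
    have hz : (((round y : ℤ) : ℝ) : UnitAddCircle) = 0 := by
      rw [AddCircle.coe_eq_zero_iff]
      exact ⟨round y, by simp⟩
    rw [AddCircle.coe_add, AddCircle.coe_sub, hz, sub_zero, ← hy', sub_add_cancel]
  rcases hθ with h | h
  · obtain ⟨x, h1, h2, h3⟩ := key 0 h
    exact ⟨x, 0, h1, by simp, h2, h3⟩
  · obtain ⟨x, h1, h2, h3⟩ := key (1 / 2) h
    exact ⟨x, 1 / 2, h1, coe_one_half_neg, h2, h3⟩

/-- The function vanishes at a half-lattice point `a` within `τ`, so Cauchy–Schwarz along the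
segment applies. Its length is also at most `1/2`, hence it lies in one period centred at `a` and
its energy is at most that of the whole circle. -/
theorem sq_le_integral_pd_sq {f : T2 → ℝ} (hf : TorusContDiff ∞ f) (hodd : IsOddOdd f) {τ : ℝ}
    {p : T2} (hp : p 0 ∈ nearHalfLattice τ) :
    f p ^ 2 ≤ τ * ∫ θ, pd 0 f ![θ, p 1] ^ 2 ∂AddCircle.haarAddCircle := by
  obtain ⟨x, a, hx, ha, h1, h2⟩ := exists_rep_of_mem_nearHalfLattice hp
  have hline : ∀ s : ℝ, (![0, p 1] : T2) + Pi.single 0 (s : UnitAddCircle) =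
      ![(s : UnitAddCircle), p 1] := fun s => by
    funext j; fin_cases j <;> simp
  have hd : ∀ s : ℝ, HasDerivAt (fun s : ℝ => f ![(s : UnitAddCircle), p 1])
      (pd 0 f ![(s : UnitAddCircle), p 1]) s := fun s => by
    simpa only [hline] using hasDerivAt_translate hf.one_of_top 0 ![0, p 1] s
  have hcc : Continuous fun θ : UnitAddCircle => (![θ, p 1] : T2) :=
    continuous_pi fun j => by fin_cases j <;> simp <;> fun_prop
  have hcθ : Continuous fun θ : UnitAddCircle => pd 0 f ![θ, p 1] := (hf.pd 0).continuous.comp hcc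
  have hc : Continuous fun s : ℝ => pd 0 f ![(s : UnitAddCircle), p 1] :=
    hcθ.comp (AddCircle.continuous_mk' 1)
  have hfa : f ![(a : UnitAddCircle), p 1] = 0 := hodd.eq_zero 0 ha
  have hfx : f ![(x : UnitAddCircle), p 1] = f p := by
    congr 1
    funext j; fin_cases j
    · exact hx.symm
    · rfl
  have hJ : ∫ θ, pd 0 f ![θ, p 1] ^ 2 ∂AddCircle.haarAddCircle =
      ∫ s in (a - 1 / 2)..(a - 1 / 2 + 1), pd 0 f ![(s : UnitAddCircle), p 1] ^ 2 := by
    rw [haarAddCircle_eq_volume]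
    exact (UnitAddCircle.intervalIntegral_preimage (a - 1 / 2) fun θ => pd 0 f ![θ, p 1] ^ 2).symm
  have hmono : ∀ c d : ℝ, c ≤ d → a - 1 / 2 ≤ c → d ≤ a - 1 / 2 + 1 →
      ∫ s in c..d, pd 0 f ![(s : UnitAddCircle), p 1] ^ 2 ≤
        ∫ θ, pd 0 f ![θ, p 1] ^ 2 ∂AddCircle.haarAddCircle := by
    intro c d hcd hc1 hd1
    rw [hJ]
    exact intervalIntegral.integral_mono_interval hc1 hcd hd1
      (ae_of_all _ fun s => sq_nonneg _) ((hc.pow 2).intervalIntegrable _ _)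
  have hJ0 : 0 ≤ ∫ θ, pd 0 f ![θ, p 1] ^ 2 ∂AddCircle.haarAddCircle :=
    integral_nonneg fun _ => sq_nonneg _
  rw [abs_le] at h1 h2
  rcases le_total a x with hax | hax
  · have h := sq_sub_le_mul_integral_deriv_sq hd hc hax
    rw [hfa, hfx, sub_zero] at h
    have h3 := hmono a x hax (by linarith) (by linarith)
    calc f p ^ 2 ≤ _ := h
      _ ≤ (x - a) * ∫ θ, pd 0 f ![θ, p 1] ^ 2 ∂AddCircle.haarAddCircle :=
        mul_le_mul_of_nonneg_left h3 (by linarith)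
      _ ≤ _ := mul_le_mul_of_nonneg_right h1.2 hJ0
  · have h := sq_sub_le_mul_integral_deriv_sq hd hc hax
    rw [hfa, hfx, zero_sub, neg_sq] at h
    have h3 := hmono x a hax (by linarith) (by linarith)
    calc f p ^ 2 ≤ _ := h
      _ ≤ (a - x) * ∫ θ, pd 0 f ![θ, p 1] ^ 2 ∂AddCircle.haarAddCircle :=
        mul_le_mul_of_nonneg_left h3 (by linarith)
      _ ≤ _ := mul_le_mul_of_nonneg_right (by linarith [h1.1]) hJ0

theorem integral_torus_eq_iterated {h : T2 → ℝ} (hh : Continuous h) :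
    ∫ p, h p ∂torusMeasure =
      ∫ η, ∫ θ, h ![θ, η] ∂AddCircle.haarAddCircle ∂AddCircle.haarAddCircle := by
  have hm := (measurePreserving_piFinTwo
    (fun _ : Fin 2 => (AddCircle.haarAddCircle : Measure UnitAddCircle))).symm
  have e := hm.integral_comp (MeasurableEquiv.measurableEmbedding _) h
  rw [← e]
  have hc : Continuous fun q : UnitAddCircle × UnitAddCircle => h ![q.1, q.2] :=
    hh.comp (continuous_pi fun j => by fin_cases j <;> simp <;> fun_prop)
  obtain ⟨C, hC⟩ := exists_norm_le_of_continuous hh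
  have hi : Integrable (fun q : UnitAddCircle × UnitAddCircle => h ![q.1, q.2])
      ((AddCircle.haarAddCircle : Measure UnitAddCircle).prod AddCircle.haarAddCircle) :=
    Integrable.of_bound hc.aestronglyMeasurable C (ae_of_all _ fun q => hC _)
  have e2 : ∀ q : UnitAddCircle × UnitAddCircle,
      h ((MeasurableEquiv.piFinTwo fun _ : Fin 2 => UnitAddCircle).symm q) = h ![q.1, q.2] :=
    fun q => rfl
  exact (integral_congr_ae (ae_of_all _ e2)).trans (integral_prod_symm _ hi)

/-- The pointwise bound is `τ` times a function of `y` alone; integrating it over the strip in `x`,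
of measure at most `4τ`, produces the second factor `τ`. -/
theorem integral_indicator_sq_le {f : T2 → ℝ} (hf : TorusContDiff ∞ f) (hodd : IsOddOdd f) {τ : ℝ}
    (hτ : 0 ≤ τ) :
    ∫ p, (nearHalfLattice τ).indicator 1 (p 0) * f p ^ 2 ∂torusMeasure ≤
      4 * τ ^ 2 * ∫ p, pd 0 f p ^ 2 ∂torusMeasure := by
  let χ : UnitAddCircle → ℝ := (nearHalfLattice τ).indicator 1
  let J : UnitAddCircle → ℝ := fun η => ∫ θ, pd 0 f ![θ, η] ^ 2 ∂AddCircle.haarAddCircle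
  have hχ : Measurable χ := measurable_one.indicator (measurableSet_nearHalfLattice τ)
  have hχ1 : ∀ θ, 0 ≤ χ θ ∧ χ θ ≤ 1 := fun θ =>
    ⟨indicator_nonneg (fun _ _ => zero_le_one) θ, indicator_le_self' (fun _ _ => zero_le_one) θ⟩
  have hcsq : Continuous fun p => pd 0 f p ^ 2 := (hf.pd 0).continuous.pow 2
  obtain ⟨C, hC⟩ := exists_norm_le_of_continuous hcsq
  have hcc : Continuous fun q : UnitAddCircle × UnitAddCircle => (![q.2, q.1] : T2) :=
    continuous_pi fun j => by fin_cases j <;> simp <;> fun_prop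
  have hJm : StronglyMeasurable J :=
    StronglyMeasurable.integral_prod_right'
      (f := fun q : UnitAddCircle × UnitAddCircle => pd 0 f ![q.2, q.1] ^ 2)
      (hcsq.comp hcc).stronglyMeasurable
  have hJb : ∀ η, ‖J η‖ ≤ C := fun η => by
    have := norm_integral_le_of_norm_le_const (μ := (AddCircle.haarAddCircle : Measure UnitAddCircle))
      (f := fun θ => pd 0 f ![θ, η] ^ 2) (ae_of_all _ fun θ => hC _)
    simpa using this
  have hprod : ∫ p : T2, χ (p 0) * J (p 1) ∂torusMeasure =
      (AddCircle.haarAddCircle : Measure UnitAddCircle).real (nearHalfLattice τ) *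
        ∫ p, pd 0 f p ^ 2 ∂torusMeasure := by
    rw [integral_torus_mul χ J, integral_torus_eq_iterated hcsq]
    congr 1
    exact integral_indicator_one (measurableSet_nearHalfLattice τ)
  have hχp : Measurable fun p : T2 => χ (p 0) := hχ.comp (measurable_pi_apply 0)
  have hJp : Measurable fun p : T2 => J (p 1) := hJm.measurable.comp (measurable_pi_apply 1)
  obtain ⟨D, hD⟩ := exists_norm_le_of_continuous (hf.continuous.pow 2)
  have i1 : Integrable (fun p : T2 => χ (p 0) * f p ^ 2) torusMeasure := by
    refine Integrable.of_bound (hχp.mul (hf.continuous.pow 2).measurable).aestronglyMeasurable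
      (1 * D) (ae_of_all _ fun p => ?_)
    rw [norm_mul]
    refine mul_le_mul ?_ (hD p) (norm_nonneg _) zero_le_one
    rw [Real.norm_of_nonneg (hχ1 _).1]
    exact (hχ1 _).2
  have i2 : Integrable (fun p : T2 => χ (p 0) * J (p 1)) torusMeasure := by
    refine Integrable.of_bound (hχp.mul hJp).aestronglyMeasurable
      (1 * C) (ae_of_all _ fun p => ?_)
    rw [norm_mul]
    refine mul_le_mul ?_ (hJb _) (norm_nonneg _) zero_le_one
    rw [Real.norm_of_nonneg (hχ1 _).1]
    exact (hχ1 _).2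
  calc ∫ p, χ (p 0) * f p ^ 2 ∂torusMeasure
      ≤ ∫ p, τ * (χ (p 0) * J (p 1)) ∂torusMeasure := by
        refine integral_mono i1 (i2.const_mul τ) fun p => ?_
        by_cases hp : p 0 ∈ nearHalfLattice τ
        · have := sq_le_integral_pd_sq hf hodd hp
          simp only [χ, indicator_of_mem hp, Pi.one_apply, one_mul]
          exact this
        · simp only [χ, indicator_of_notMem hp, zero_mul, mul_zero, le_refl]
    _ = τ * ((AddCircle.haarAddCircle : Measure UnitAddCircle).real (nearHalfLattice τ) *
        ∫ p, pd 0 f p ^ 2 ∂torusMeasure) := by rw [integral_const_mul, hprod]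
    _ ≤ τ * (4 * τ * ∫ p, pd 0 f p ^ 2 ∂torusMeasure) :=
        mul_le_mul_of_nonneg_left (mul_le_mul_of_nonneg_right (measureReal_nearHalfLattice_le hτ)
          (integral_nonneg fun p => sq_nonneg (pd 0 f p))) hτ
    _ = _ := by ring

theorem swapXY_swapXY (p : T2) : swapXY (swapXY p) = p := by funext i; fin_cases i <;> simp [swapXY]

theorem TorusContDiff.comp_swapXY {n : ℕ∞ω} {f : T2 → ℝ} (hf : TorusContDiff n f) :
    TorusContDiff n fun p => f (swapXY p) := by
  have : (fun x : Fin 2 → ℝ => f (swapXY (proj x))) =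
      (fun x : Fin 2 → ℝ => f (proj x)) ∘ fun x => ![x 1, x 0] := by
    funext x
    simp only [Function.comp_apply]
    congr 1
    funext j
    fin_cases j <;> rfl
  unfold TorusContDiff
  rw [this]
  refine ContDiff.comp hf (contDiff_pi.2 fun j => ?_)
  fin_cases j
  · exact contDiff_apply ℝ ℝ (1 : Fin 2)
  · exact contDiff_apply ℝ ℝ (0 : Fin 2)

theorem pd_zero_comp_swapXY (f : T2 → ℝ) :
    pd 0 (fun p => f (swapXY p)) = fun p => pd 1 f (swapXY p) := by
  funext p
  rw [pd, pd]
  congr 1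
  funext t
  congr 1
  funext j
  fin_cases j <;> simp [swapXY]

theorem IsOddOdd.comp_swapXY {f : T2 → ℝ} (hf : IsOddOdd f) : IsOddOdd fun p => f (swapXY p) := by
  intro p
  have h1 : swapXY (reflX p) = reflY (swapXY p) := by
    funext j; fin_cases j <;> simp [swapXY, reflX, reflY]
  have h2 : swapXY (reflY p) = reflX (swapXY p) := by
    funext j; fin_cases j <;> simp [swapXY, reflX, reflY]
  simp only
  rw [h1, h2]
  exact ⟨(hf _).2, (hf _).1⟩

theorem isClosed_strip (τ : ℝ) : IsClosed (strip τ) := by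
  have e : strip τ = ⋃ i : Fin 2, (fun p : T2 => p i) ⁻¹' nearHalfLattice τ := by
    ext p; simp [strip]
  rw [e]
  exact isClosed_iUnion_of_finite fun i => IsClosed.preimage (continuous_apply i)
    (Metric.isClosed_closedBall.union Metric.isClosed_closedBall)

theorem memLp_strip (τ : ℝ) : MemLp ((strip τ).indicator (1 : T2 → ℝ)) ∞ torusMeasure :=
  memLp_indicator_const ∞ (isClosed_strip τ).measurableSet (1 : ℝ) (Or.inr (measure_ne_top _ _))

/-- The strip is the union of a vertical and a horizontal one, and the coordinate exchange carries
one estimate to the other. -/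
theorem integral_strip_sq_le {f : T2 → ℝ} (hf : TorusContDiff ∞ f) (hodd : IsOddOdd f) {τ : ℝ}
    (hτ : 0 ≤ τ) :
    ∫ p, (strip τ).indicator 1 p * f p ^ 2 ∂torusMeasure ≤
      4 * τ ^ 2 * (∫ p, pd 0 f p ^ 2 ∂torusMeasure + ∫ p, pd 1 f p ^ 2 ∂torusMeasure) := by
  let χ : UnitAddCircle → ℝ := (nearHalfLattice τ).indicator 1
  have hχ : Measurable χ := measurable_one.indicator (measurableSet_nearHalfLattice τ)
  have hχ1 : ∀ θ, 0 ≤ χ θ ∧ χ θ ≤ 1 := fun θ =>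
    ⟨indicator_nonneg (fun _ _ => zero_le_one) θ, indicator_le_self' (fun _ _ => zero_le_one) θ⟩
  have h0 := integral_indicator_sq_le hf hodd hτ
  have h1 := integral_indicator_sq_le hf.comp_swapXY hodd.comp_swapXY hτ
  rw [pd_zero_comp_swapXY, integral_comp_swapXY fun p => pd 1 f p ^ 2] at h1
  have e1 := integral_comp_swapXY fun p => χ (p 1) * f p ^ 2
  have e2 : ∫ p, χ (swapXY p 1) * f (swapXY p) ^ 2 ∂torusMeasure =
      ∫ p, (nearHalfLattice τ).indicator 1 (p 0) * f (swapXY p) ^ 2 ∂torusMeasure := rfl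
  rw [← e2, e1] at h1
  obtain ⟨D, hD⟩ := exists_norm_le_of_continuous (hf.continuous.pow 2)
  have hi : ∀ (w : T2 → ℝ), Measurable w → (∀ p, 0 ≤ w p ∧ w p ≤ 1) →
      Integrable (fun p => w p * f p ^ 2) torusMeasure := fun w hw hb => by
    refine Integrable.of_bound (hw.mul (hf.continuous.pow 2).measurable).aestronglyMeasurable
      (1 * D) (ae_of_all _ fun p => ?_)
    rw [norm_mul]
    refine mul_le_mul ?_ (hD p) (norm_nonneg _) zero_le_one
    rw [Real.norm_of_nonneg (hb _).1]
    exact (hb _).2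
  have i0 := hi (fun p => χ (p 0)) (hχ.comp (measurable_pi_apply 0)) fun p => hχ1 _
  have i1 := hi (fun p => χ (p 1)) (hχ.comp (measurable_pi_apply 1)) fun p => hχ1 _
  have is := hi ((strip τ).indicator 1) (measurable_one.indicator (isClosed_strip τ).measurableSet)
    fun p => ⟨indicator_nonneg (fun _ _ => zero_le_one) p,
      indicator_le_self' (fun _ _ => zero_le_one) p⟩
  have hle : ∫ p, (strip τ).indicator 1 p * f p ^ 2 ∂torusMeasure ≤
      ∫ p, (χ (p 0) * f p ^ 2 + χ (p 1) * f p ^ 2) ∂torusMeasure := by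
    refine integral_mono is (i0.add i1) fun p => ?_
    have hsq := sq_nonneg (f p)
    by_cases hp : p ∈ strip τ
    · simp only [indicator_of_mem hp, Pi.one_apply, one_mul]
      obtain ⟨i, hpi⟩ := hp
      fin_cases i
      · have : χ (p 0) = 1 := indicator_of_mem hpi 1
        rw [this, one_mul]
        linarith [mul_nonneg (hχ1 (p 1)).1 hsq]
      · have : χ (p 1) = 1 := indicator_of_mem hpi 1
        rw [this, one_mul]
        linarith [mul_nonneg (hχ1 (p 0)).1 hsq]
    · simp only [indicator_of_notMem hp, zero_mul]
      exact add_nonneg (mul_nonneg (hχ1 _).1 hsq) (mul_nonneg (hχ1 _).1 hsq)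
  rw [integral_add i0 i1] at hle
  linarith

/-! ### Finite sine sums and passage to the limit -/

theorem coeFn_sum_sineBasis (m n : ℕ) (c : ℕ × ℕ → ℝ) (s : Finset (ℕ × ℕ)) :
    (∑ k ∈ s, c k • sineBasis m n k : L2) =ᵐ[torusMeasure]
      fun p => ∑ k ∈ s, c k * sineBasisFun m n k p := by
  classical
  induction s using Finset.induction_on with
  | empty =>
    filter_upwards [Lp.coeFn_zero ℝ 2 torusMeasure] with p hp
    simp
  | insert k s hk ih =>
    rw [Finset.sum_insert hk]
    filter_upwards [Lp.coeFn_add (c k • sineBasis m n k) (∑ k ∈ s, c k • sineBasis m n k),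
      Lp.coeFn_smul (c k) (sineBasis m n k),
      coeFn_smoothL2 (torusContDiff_sineBasisFun m n k), ih] with p h1 h2 h3 h4
    rw [h1, Pi.add_apply, h2, Pi.smul_apply, sineBasis, h3, h4, Finset.sum_insert hk, smul_eq_mul]

theorem integral_sum_sineBasisFun_sq (m n : ℕ) (c : ℕ × ℕ → ℝ) (s : Finset (ℕ × ℕ)) :
    ∫ p, (∑ k ∈ s, c k * sineBasisFun m n k p) ^ 2 ∂torusMeasure = ∑ k ∈ s, c k ^ 2 := by
  have h := (orthonormal_sineBasis m n).inner_sum c c s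
  rw [inner_eq_integral] at h
  rw [← Finset.sum_congr rfl fun k _ => (show (starRingEnd ℝ) (c k) * c k = c k ^ 2 by simp [sq]), ← h]
  refine integral_congr_ae ?_
  filter_upwards [coeFn_sum_sineBasis m n c s] with p hp
  rw [hp, sq]

theorem torusContDiff_sum (c : ℕ × ℕ → ℝ) (s : Finset (ℕ × ℕ)) (m n : ℕ) :
    TorusContDiff ∞ fun p => ∑ k ∈ s, c k * sineBasisFun m n k p :=
  ContDiff.sum fun k _ => contDiff_const.mul (torusContDiff_sineBasisFun m n k)

theorem pd_sum_sineBasisFun (i : Fin 2) (c : ℕ × ℕ → ℝ) (s : Finset (ℕ × ℕ)) :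
    pd i (fun p => ∑ k ∈ s, c k * sineBasisFun 0 0 k p) =
      fun p => ∑ k ∈ s, c k * pd i (sineBasisFun 0 0 k) p := by
  funext p
  have h : ∀ k ∈ s, HasDerivAt (fun t : ℝ => c k * sineBasisFun 0 0 k
      (p + Pi.single i (t : UnitAddCircle))) (c k * pd i (sineBasisFun 0 0 k) p) 0 := fun k _ => by
    have := (hasDerivAt_translate (torusContDiff_sineBasisFun 0 0 k).one_of_top i p 0).const_mul (c k)
    simpa using this
  exact (HasDerivAt.fun_sum h).deriv

theorem integral_strip_sum_sq_le {τ : ℝ} (hτ : 0 ≤ τ) (c : ℕ × ℕ → ℝ) (s : Finset (ℕ × ℕ)) :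
    ∫ p, (strip τ).indicator 1 p * (∑ k ∈ s, c k * sineBasisFun 0 0 k p) ^ 2 ∂torusMeasure ≤
      4 * τ ^ 2 * ∑ k ∈ s, sineEigenvalue k * c k ^ 2 := by
  have hodd : IsOddOdd fun p => ∑ k ∈ s, c k * sineBasisFun 0 0 k p := fun p => by
    simp only [(isOddOdd_sineBasisFun _ p).1, (isOddOdd_sineBasisFun _ p).2, mul_neg,
      Finset.sum_neg_distrib, and_self]
  refine (integral_strip_sq_le (torusContDiff_sum c s 0 0) hodd hτ).trans (le_of_eq ?_)
  congr 1
  have e0 : ∀ k p, c k * pd 0 (sineBasisFun 0 0 k) p =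
      (c k * (2 * Real.pi * ((k.1 : ℝ) + 1))) * sineBasisFun 1 0 k p := fun k p => by
    have : pd 0 (sineBasisFun 0 0 k) p = _ := congrFun (pd_const_mul 0 2 _) p
    rw [this, pd_zero_torusWave, sineBasisFun]
    push_cast
    ring
  have e1 : ∀ k p, c k * pd 1 (sineBasisFun 0 0 k) p =
      (c k * (2 * Real.pi * ((k.2 : ℝ) + 1))) * sineBasisFun 0 1 k p := fun k p => by
    have : pd 1 (sineBasisFun 0 0 k) p = _ := congrFun (pd_const_mul 1 2 _) p
    rw [this, pd_one_torusWave, sineBasisFun]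
    push_cast
    ring
  rw [pd_sum_sineBasisFun, pd_sum_sineBasisFun]
  simp only [e0, e1]
  rw [integral_sum_sineBasisFun_sq, integral_sum_sineBasisFun_sq, ← Finset.sum_add_distrib]
  refine Finset.sum_congr rfl fun k _ => ?_
  rw [sineEigenvalue]
  ring

/-- The mass of an odd-odd function near its zero set is controlled by the Dirichlet form. -/
theorem integral_strip_le_dirichlet {U : H2} (hU : U ∈ H2OddOdd) {τ : ℝ} (hτ : 0 ≤ τ) :
    ∫ p, (strip τ).indicator 1 p * (H2.toL2 U p * H2.toL2 U p) ∂torusMeasure ≤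
      4 * τ ^ 2 * -⟪H2.laplacian U, H2.toL2 U⟫ := by
  rw [← inner_mulL2 (memLp_strip τ)]
  have hu : HasSum _ (H2.toL2 U) := hasSum_sineInner hU
  have hcont : Continuous fun v : L2 => ⟪mulL2 (memLp_strip τ) v, v⟫ :=
    (mulL2 (memLp_strip τ)).continuous.inner continuous_id
  -- Truncate the sine series: the left side is a continuous quadratic form on `L²`, and the
  -- Dirichlet form of a partial sum is at most the full one because its terms are non-negative.
  refine le_of_tendsto ((hcont.tendsto _).comp hu) (Eventually.of_forall fun s => ?_)
  simp only [Function.comp_apply]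
  rw [inner_mulL2]
  have e : ∫ p, (strip τ).indicator 1 p *
      ((∑ k ∈ s, sineInner (H2.toL2 U) k • sineBasis 0 0 k : L2) p *
        (∑ k ∈ s, sineInner (H2.toL2 U) k • sineBasis 0 0 k : L2) p) ∂torusMeasure =
      ∫ p, (strip τ).indicator 1 p *
        (∑ k ∈ s, sineInner (H2.toL2 U) k * sineBasisFun 0 0 k p) ^ 2 ∂torusMeasure := by
    refine integral_congr_ae ?_
    filter_upwards [coeFn_sum_sineBasis 0 0 (sineInner (H2.toL2 U)) s] with p hp
    rw [hp, sq]
  rw [e]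
  refine (integral_strip_sum_sq_le hτ _ s).trans ?_
  gcongr
  refine sum_le_hasSum s (fun k _ => ?_) (hasSum_dirichlet hU)
  have := one_le_sineEigenvalue k
  positivity

/-! ### Inverting a relatively small perturbation of the Laplacian -/

theorem toL2_eq_zero_of_dirichlet_nonpos {U : H2} (hU : U ∈ H2OddOdd)
    (h : -⟪H2.laplacian U, H2.toL2 U⟫ ≤ 0) : H2.toL2 U = 0 := by
  have hs := hasSum_dirichlet hU
  have hnn : ∀ k, 0 ≤ sineEigenvalue k * sineInner (H2.toL2 U) k ^ 2 := fun k =>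
    mul_nonneg (zero_le_one.trans (one_le_sineEigenvalue k)) (sq_nonneg _)
  rw [le_antisymm h (hs.nonneg hnn), hasSum_zero_iff_of_nonneg hnn] at hs
  refine ext_sineInner hU (Submodule.zero_mem _) fun k => ?_
  have hk := congrFun hs k
  have := one_le_sineEigenvalue k
  simp only [Pi.zero_apply, mul_eq_zero, pow_eq_zero_iff, ne_eq, OfNat.ofNat_ne_zero,
    not_false_eq_true] at hk
  rcases hk with hk | hk
  · linarith
  · rw [hk, sineInner, inner_zero_left]

theorem mulL2_mem_L2OddOdd {w : T2 → ℝ} (hw : MemLp w ∞ torusMeasure)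
    (hx : ∀ p, w (reflX p) = w p) (hy : ∀ p, w (reflY p) = w p) {u : L2} (hu : u ∈ L2OddOdd) :
    mulL2 hw u ∈ L2OddOdd := by
  rw [mem_L2OddOdd_iff] at hu ⊢
  filter_upwards [hu, coeFn_mulL2 hw u,
    measurePreserving_reflX.quasiMeasurePreserving.ae (coeFn_mulL2 hw u),
    measurePreserving_reflY.quasiMeasurePreserving.ae (coeFn_mulL2 hw u)] with p h1 h2 h3 h4
  rw [h2, h3, h4, hx, hy, h1.1, h1.2, mul_neg]
  exact ⟨rfl, rfl⟩

theorem inner_mulL2_comm {w : T2 → ℝ} (hw : MemLp w ∞ torusMeasure) (u v : L2) :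
    ⟪mulL2 hw u, v⟫ = ⟪u, mulL2 hw v⟫ := by
  rw [← real_inner_comm u, inner_mulL2, inner_mulL2]
  simp only [mul_comm]

theorem norm_mulL2_sq {s w : T2 → ℝ} (hs : MemLp s ∞ torusMeasure) (h : ∀ p, s p * s p = w p)
    (u : L2) : ‖mulL2 hs u‖ ^ 2 = ∫ p, w p * (u p * u p) ∂torusMeasure := by
  rw [← real_inner_self_eq_norm_sq, inner_eq_integral]
  refine integral_congr_ae ?_
  filter_upwards [coeFn_mulL2 hs u] with p hp
  rw [hp, ← h]
  ring

/-- The operator `Δ - V` from `H²` to `L²`. -/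
def laplacianSub {V : T2 → ℝ} (hV : MemLp V ∞ torusMeasure) : H2 →L[ℝ] L2 :=
  (⟨H2.laplacian, continuous_laplacian⟩ : H2 →L[ℝ] L2) -
    (mulL2 hV).comp (⟨H2.toL2, continuous_toL2⟩ : H2 →L[ℝ] L2)

theorem laplacianSub_apply {V : T2 → ℝ} (hV : MemLp V ∞ torusMeasure) (U : H2) :
    laplacianSub hV U = H2.laplacian U - mulL2 hV (H2.toL2 U) := rfl

theorem laplacianSub_mem_L2OddOdd {V : T2 → ℝ} (hV : MemLp V ∞ torusMeasure)
    (hx : ∀ p, V (reflX p) = V p) (hy : ∀ p, V (reflY p) = V p) {U : H2} (hU : U ∈ H2OddOdd) :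
    laplacianSub hV U ∈ L2OddOdd :=
  L2OddOdd.sub_mem (laplacian_mem_L2OddOdd hU) (mulL2_mem_L2OddOdd hV hx hy hU)

/-- Completeness of both subspaces allows the open mapping theorem to supply continuity of the
inverse. -/
theorem exists_continuousLinearEquiv_of_bijective {E F : Type*} [NormedAddCommGroup E]
    [NormedSpace ℝ E] [NormedAddCommGroup F] [NormedSpace ℝ F] (T : E →L[ℝ] F)
    {X : Submodule ℝ E} {Y : Submodule ℝ F} [CompleteSpace X] [CompleteSpace Y]
    (hmaps : ∀ U ∈ X, T U ∈ Y) (hinj : ∀ U ∈ X, T U = 0 → U = 0)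
    (hsurj : ∀ f ∈ Y, ∃ U ∈ X, T U = f) : ∃ e : X ≃L[ℝ] Y, ∀ U : X, (e U : F) = T U := by
  let T' : X →L[ℝ] Y := (T.comp X.subtypeL).codRestrict Y fun U => hmaps U U.2
  have hker : T'.ker = ⊥ := by
    rw [LinearMap.ker_eq_bot']
    intro U hU
    exact Subtype.ext (hinj U U.2 (congrArg Subtype.val hU))
  have hrange : T'.range = ⊤ := by
    rw [LinearMap.range_eq_top]
    intro f
    obtain ⟨U, hU, h⟩ := hsurj f f.2
    exact ⟨⟨U, hU⟩, Subtype.ext h⟩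
  refine ⟨ContinuousLinearEquiv.ofBijective T' hker hrange, fun U => ?_⟩
  rw [ContinuousLinearEquiv.coeFn_ofBijective]
  rfl

/-- A bijection between complete subspaces given by `Δ - V` is an isomorphism. -/
theorem isIsoLaplacianSub_of_bijective {V : T2 → ℝ} (hV : MemLp V ∞ torusMeasure)
    {X : Submodule ℝ H2} {Y : Submodule ℝ L2} [CompleteSpace X] [CompleteSpace Y]
    (hmaps : ∀ U ∈ X, laplacianSub hV U ∈ Y)
    (hinj : ∀ U ∈ X, laplacianSub hV U = 0 → U = 0)
    (hsurj : ∀ f ∈ Y, ∃ U ∈ X, laplacianSub hV U = f) : IsIsoLaplacianSub V X Y := by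
  obtain ⟨e, he⟩ := exists_continuousLinearEquiv_of_bijective _ hmaps hinj hsurj
  refine ⟨e, fun U => ?_⟩
  rw [he, laplacianSub_apply]
  filter_upwards [Lp.coeFn_sub (H2.laplacian (U : H2)) (mulL2 hV (H2.toL2 (U : H2))),
    coeFn_mulL2 hV (H2.toL2 (U : H2))] with p h1 h2
  rw [h1, Pi.sub_apply, h2]

/-- Pairing `ΔU = VU` with `U` equates the Dirichlet form with the potential energy, which is at
most half of it; so the form vanishes. -/
theorem eq_zero_of_laplacianSub_eq_zero {V : T2 → ℝ} (hV : MemLp V ∞ torusMeasure)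
    (hform : ∀ U ∈ H2OddOdd,
      ∫ p, -V p * (H2.toL2 U p * H2.toL2 U p) ∂torusMeasure ≤
        1 / 2 * -⟪H2.laplacian U, H2.toL2 U⟫) {U : H2} (hU : U ∈ H2OddOdd)
    (h : laplacianSub hV U = 0) : U = 0 := by
  rw [laplacianSub_apply, sub_eq_zero] at h
  have h1 := hform U hU
  simp only [neg_mul] at h1
  rw [integral_neg, ← inner_mulL2 hV, ← h] at h1
  refine H2_ext ?_
  rw [toL2_eq_zero_of_dirichlet_nonpos hU (by linarith), map_zero]

/-- Inverting `Δ - V` by a Neumann series for `√(-V) (-Δ)⁻¹ √(-V)`. -/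
theorem exists_laplacianSub_eq {V : T2 → ℝ} (hV : MemLp V ∞ torusMeasure) (hVc : Continuous V) (hV0 : ∀ p, V p ≤ 0)
    (hx : ∀ p, V (reflX p) = V p) (hy : ∀ p, V (reflY p) = V p)
    (hform : ∀ U ∈ H2OddOdd, ∫ p, -V p * (H2.toL2 U p * H2.toL2 U p) ∂torusMeasure ≤
        1 / 2 * -⟪H2.laplacian U, H2.toL2 U⟫) {f : L2} (hf : f ∈ L2OddOdd) :
    ∃ U ∈ H2OddOdd, laplacianSub hV U = f := by
  let s : T2 → ℝ := fun p => √(-V p)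
  have hs : MemLp s ∞ torusMeasure := memLp_of_continuous hVc.neg.sqrt ∞
  have hss : ∀ p, s p * s p = -V p := fun p => Real.mul_self_sqrt (neg_nonneg.2 (hV0 p))
  have hSmem : ∀ u ∈ L2OddOdd, mulL2 hs u ∈ L2OddOdd := fun u hu =>
    mulL2_mem_L2OddOdd hs (fun p => by simp only [s, hx]) (fun p => by simp only [s, hy]) hu
  let S : L2OddOdd →ₗ[ℝ] L2OddOdd := (mulL2 hs : L2 →ₗ[ℝ] L2).restrict hSmem
  -- `B` is `(-Δ)⁻¹`, viewed from odd-odd `L²` to itself.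
  let B : L2OddOdd →ₗ[ℝ] L2OddOdd :=
    -((H2.toL2.restrict fun U hU => hU : H2OddOdd →ₗ[ℝ] L2OddOdd) ∘ₗ
      (laplacianEquiv.symm : L2OddOdd →ₗ[ℝ] H2OddOdd))
  have hS : ∀ u, (S u : L2) = mulL2 hs u := fun _ => rfl
  have hB : ∀ g, (B g : L2) = -H2.toL2 (laplacianEquiv.symm g : H2) := fun _ => rfl
  have hL : ∀ g, H2.laplacian (laplacianEquiv.symm g : H2) = g := fun g => by
    rw [← laplacianEquiv_apply, LinearEquiv.apply_symm_apply]
  -- For `ΔU = S g` the form bound reads `‖S U‖² ≤ -½ ⟨S g, U⟩ = -½ ⟨g, S U⟩`, so `‖S U‖ ≤ ½ ‖g‖` by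
  -- Cauchy–Schwarz.
  have hbound : ∀ g, ‖(S ∘ₗ B ∘ₗ S) g‖ ≤ 1 / 2 * ‖g‖ := by
    intro g
    set U := laplacianEquiv.symm (S g) with hU
    have e1 : ‖(S ∘ₗ B ∘ₗ S) g‖ = ‖mulL2 hs (H2.toL2 (U : H2))‖ := by
      change ‖(S (B (S g)) : L2)‖ = _
      rw [hS, hB, map_neg, norm_neg]
    have h1 := hform U U.2
    rw [← norm_mulL2_sq hs hss, hL, hS, inner_mulL2_comm] at h1
    have h2 := abs_real_inner_le_norm (g : L2) (mulL2 hs (H2.toL2 (U : H2)))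
    rw [e1]
    have h3 : ‖g‖ = ‖(g : L2)‖ := rfl
    rw [h3]
    have h4 := (neg_le_abs _).trans h2
    have h5 := norm_nonneg (mulL2 hs (H2.toL2 (U : H2)))
    rcases h5.eq_or_lt with h6 | h6
    · rw [← h6]; positivity
    · nlinarith
  let N : L2OddOdd →L[ℝ] L2OddOdd := (S ∘ₗ B ∘ₗ S).mkContinuous (1 / 2) hbound
  have hN : ‖N‖ < 1 :=
    (LinearMap.mkContinuous_norm_le _ (by norm_num) hbound).trans_lt (by norm_num)
  obtain ⟨u, hu⟩ := isUnit_one_sub_of_norm_lt_one (R := L2OddOdd →L[ℝ] L2OddOdd) hN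
  let z : L2OddOdd := (u⁻¹ : (L2OddOdd →L[ℝ] L2OddOdd)ˣ).1 (S (B ⟨f, hf⟩))
  have hz : z - S (B (S z)) = S (B ⟨f, hf⟩) := by
    have h : (u.1 * u⁻¹.1) (S (B ⟨f, hf⟩)) = S (B ⟨f, hf⟩) := by rw [u.mul_inv]; rfl
    rw [hu] at h
    exact h
  -- With `ΔU = f + S z`, the equation for `z` says `z = -S U`; hence `S z = -S² U = V U` and the
  -- extra term is exactly the potential.
  refine ⟨laplacianEquiv.symm (⟨f, hf⟩ + S z), Subtype.property _, ?_⟩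
  have hz2 : z = S (B (⟨f, hf⟩ + S z)) := by
    rw [map_add, map_add, ← hz]
    abel
  have h3 := congrArg (fun v : L2OddOdd => mulL2 hs (v : L2)) hz2
  simp only [hS, hB] at h3
  have h4 : ∀ v : L2, mulL2 hs (mulL2 hs v) = -mulL2 hV v := fun v => by
    refine Lp.ext ?_
    filter_upwards [coeFn_mulL2 hs (mulL2 hs v), coeFn_mulL2 hs v, coeFn_mulL2 hV v,
      Lp.coeFn_neg (mulL2 hV v)] with p h1 h2 h3 h4
    rw [h1, h2, h4, Pi.neg_apply, h3, ← mul_assoc, hss, neg_mul]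
  rw [h4, map_neg, neg_neg] at h3
  rw [laplacianSub_apply, hL, ← h3, Submodule.coe_add, hS, add_sub_cancel_right]

/-! ### Symmetry under exchange of the coordinates -/

theorem sineBasisFun_swapXY (k : ℕ × ℕ) (p : T2) :
    sineBasisFun 0 0 k (swapXY p) = sineBasisFun 0 0 k.swap p := by
  simp [sineBasisFun, torusWave, swapXY, mul_comm]

theorem sineEigenvalue_swap (k : ℕ × ℕ) : sineEigenvalue k.swap = sineEigenvalue k :=
  add_comm _ _

theorem integral_comp_swapXY_mul_sine (f : T2 → ℝ) (k : ℕ × ℕ) :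
    ∫ p, f (swapXY p) * sineBasisFun 0 0 k p ∂torusMeasure =
      ∫ p, f p * sineBasisFun 0 0 k.swap p ∂torusMeasure := by
  rw [← integral_comp_swapXY]
  simp only [swapXY_swapXY, sineBasisFun_swapXY]

/-- Composition with the exchange of the coordinates. -/
def swapL2 : L2 →ₗ[ℝ] L2 := Lp.compMeasurePreservingₗ ℝ swapXY measurePreserving_swapXY

theorem coeFn_swapL2 (u : L2) : swapL2 u =ᵐ[torusMeasure] fun p => u (swapXY p) :=
  Lp.coeFn_compMeasurePreserving u measurePreserving_swapXY

theorem mem_L2Sym {u : L2} : u ∈ L2Sym ↔ u ∈ L2OddOdd ∧ swapL2 u = u := Iff.rfl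

theorem isClosed_L2Sym : IsClosed (L2Sym : Set L2) := by
  have h : Continuous swapL2 :=
    (Lp.isometry_compMeasurePreserving measurePreserving_swapXY).continuous
  exact isClosed_L2OddOdd.inter (isClosed_eq h continuous_id)

instance : CompleteSpace L2Sym := isClosed_L2Sym.completeSpace_coe

instance : CompleteSpace H2Sym :=
  (IsClosed.preimage continuous_toL2 isClosed_L2Sym : IsClosed (H2Sym : Set H2)).completeSpace_coe

theorem swapL2_mem_L2OddOdd {u : L2} (hu : u ∈ L2OddOdd) : swapL2 u ∈ L2OddOdd := by
  rw [mem_L2OddOdd_iff] at hu ⊢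
  filter_upwards [measurePreserving_swapXY.quasiMeasurePreserving.ae hu, coeFn_swapL2 u,
    measurePreserving_reflX.quasiMeasurePreserving.ae (coeFn_swapL2 u),
    measurePreserving_reflY.quasiMeasurePreserving.ae (coeFn_swapL2 u)] with p h1 h2 h3 h4
  rw [h2, h3, h4]
  have e1 : swapXY (reflX p) = reflY (swapXY p) := by
    funext j; fin_cases j <;> simp [swapXY, reflX, reflY]
  have e2 : swapXY (reflY p) = reflX (swapXY p) := by
    funext j; fin_cases j <;> simp [swapXY, reflX, reflY]
  rw [e1, e2]
  exact h1.symm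

theorem sineInner_swapL2 (u : L2) (k : ℕ × ℕ) : sineInner (swapL2 u) k = sineInner u k.swap := by
  rw [sineInner_eq_integral, sineInner_eq_integral, ← integral_comp_swapXY_mul_sine]
  refine integral_congr_ae ?_
  filter_upwards [coeFn_swapL2 u] with p hp
  rw [hp]

/-- The exchange of coordinates acts on odd-odd `H²` functions and commutes with the Laplacian. -/
theorem exists_swap {U : H2} (hU : U ∈ H2OddOdd) : ∃ U' ∈ H2OddOdd,
    H2.toL2 U' = swapL2 (H2.toL2 U) ∧ H2.laplacian U' = swapL2 (H2.laplacian U) := by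
  -- The exchanged function is built by inverting the Laplacian and identified by its sine
  -- coefficients, so no second derivatives have to be transported.
  obtain ⟨U', hU', h⟩ := exists_laplacian_eq (swapL2_mem_L2OddOdd (laplacian_mem_L2OddOdd hU))
  refine ⟨U', hU', ext_sineInner hU' (swapL2_mem_L2OddOdd hU) fun k => ?_, h⟩
  have h1 := sineInner_laplacian U' k
  rw [h, sineInner_swapL2, sineInner_laplacian, sineEigenvalue_swap] at h1
  have := one_le_sineEigenvalue k
  rw [sineInner_swapL2]
  exact (mul_left_cancel₀ (by linarith) h1).symm

theorem swapL2_mulL2 {w : T2 → ℝ} (hw : MemLp w ∞ torusMeasure)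
    (hs : ∀ p, w (swapXY p) = w p) (u : L2) : swapL2 (mulL2 hw u) = mulL2 hw (swapL2 u) := by
  refine Lp.ext ?_
  filter_upwards [coeFn_swapL2 (mulL2 hw u), coeFn_mulL2 hw (swapL2 u), coeFn_swapL2 u,
    measurePreserving_swapXY.quasiMeasurePreserving.ae (coeFn_mulL2 hw u)] with p h1 h2 h3 h4
  rw [h1, h2, h3, h4, hs]

theorem isIsoLaplacianSub_of_form {V : T2 → ℝ} (hVc : Continuous V) (hV0 : ∀ p, V p ≤ 0)
    (hx : ∀ p, V (reflX p) = V p) (hy : ∀ p, V (reflY p) = V p) (hs : ∀ p, V (swapXY p) = V p)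
    (hform : ∀ U ∈ H2OddOdd, ∫ p, -V p * (H2.toL2 U p * H2.toL2 U p) ∂torusMeasure ≤
        1 / 2 * -⟪H2.laplacian U, H2.toL2 U⟫) :
    IsIsoLaplacianSub V H2OddOdd L2OddOdd ∧ IsIsoLaplacianSub V H2Sym L2Sym := by
  have hV : MemLp V ∞ torusMeasure := memLp_of_continuous hVc ∞
  have hinj : ∀ U ∈ H2OddOdd, laplacianSub hV U = 0 → U = 0 := fun U hU h =>
    eq_zero_of_laplacianSub_eq_zero hV hform hU h
  -- If the image is symmetric, `U` and its exchange have the same image, so injectivity on the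
  -- larger class makes `U` symmetric. This yields surjectivity in (b).
  have hsymm : ∀ U ∈ H2OddOdd, swapL2 (laplacianSub hV U) = laplacianSub hV U →
      swapL2 (H2.toL2 U) = H2.toL2 U ∧ swapL2 (H2.laplacian U) = H2.laplacian U := by
    intro U hU h
    obtain ⟨U', hU', h1, h2⟩ := exists_swap hU
    have : U' - U = 0 := by
      refine hinj _ (H2OddOdd.sub_mem hU' hU) ?_
      rw [map_sub, laplacianSub_apply hV U', h1, h2, ← swapL2_mulL2 hV hs, ← map_sub,
        ← laplacianSub_apply, h, sub_self]
    rw [sub_eq_zero] at this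
    rw [← h1, ← h2, this]
    exact ⟨rfl, rfl⟩
  refine ⟨isIsoLaplacianSub_of_bijective hV
    (fun U hU => laplacianSub_mem_L2OddOdd hV hx hy hU) hinj
    (fun f hf => exists_laplacianSub_eq hV hVc hV0 hx hy hform hf),
    isIsoLaplacianSub_of_bijective hV (fun U hU => ?_) (fun U hU => hinj U (mem_L2Sym.1 hU).1)
      fun f hf => ?_⟩
  · obtain ⟨h1, h2⟩ := mem_L2Sym.1 (show H2.toL2 U ∈ L2Sym from hU)
    refine mem_L2Sym.2 ⟨laplacianSub_mem_L2OddOdd hV hx hy h1, ?_⟩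
    obtain ⟨U', hU', h3, h4⟩ := exists_swap h1
    have : U' = U := H2_ext (h3.trans h2)
    rw [laplacianSub_apply, map_sub, swapL2_mulL2 hV hs, h2, ← h4, this]
  · obtain ⟨h1, h2⟩ := mem_L2Sym.1 hf
    obtain ⟨U, hU, h⟩ := exists_laplacianSub_eq hV hVc hV0 hx hy hform h1
    refine ⟨U, mem_L2Sym.2 ⟨hU, (hsymm U hU ?_).1⟩, h⟩
    rw [h, h2]

/-! ### Symmetry of the nonlinear solution -/

theorem exists_sub_eq_deriv_mul {F F' : ℝ → ℝ} (hF : ∀ x, HasDerivAt F (F' x) x) (a b : ℝ) :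
    ∃ ξ ∈ uIcc a b, F a - F b = F' ξ * (a - b) := by
  have key : ∀ a b, a < b → ∃ ξ ∈ Icc a b, F b - F a = F' ξ * (b - a) := fun a b hab => by
    obtain ⟨ξ, hξ, h⟩ := exists_hasDerivAt_eq_slope F F' hab
      (fun x _ => (hF x).continuousAt.continuousWithinAt) fun x _ => hF x
    refine ⟨ξ, Ioo_subset_Icc_self hξ, ?_⟩
    have : b - a ≠ 0 := by linarith
    rw [h]
    field_simp
  rcases lt_trichotomy a b with h | rfl | h
  · obtain ⟨ξ, hξ, e⟩ := key a b h
    exact ⟨ξ, by rwa [uIcc_of_le h.le], by linarith⟩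
  · exact ⟨a, left_mem_uIcc, by simp⟩
  · obtain ⟨ξ, hξ, e⟩ := key b a h
    exact ⟨ξ, by rwa [uIcc_of_ge h.le], e⟩

theorem swapXY_mem_strip {τ : ℝ} {p : T2} : swapXY p ∈ strip τ ↔ p ∈ strip τ := by
  simp [strip, swapXY, or_comm]

theorem integrable_mul (u v : L2) : Integrable (fun p => u p * v p) torusMeasure :=
  (Lp.memLp u).integrable_mul (Lp.memLp v)

/-- An odd-odd solution of `Δψ = F(ψ)` is symmetric if `F'` vanishes near the values of `ψ` away
from a narrow strip and is not too negative inside the strip. -/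
theorem comp_swapXY_eq {ψ : T2 → ℝ} (hc : Continuous ψ) (hodd : IsOddOdd ψ) {F F' : ℝ → ℝ}
    (hF : ∀ x, HasDerivAt F (F' x) x) (hFodd : ∀ x, F (-x) = -F x)
    (hweak : IsWeakLaplacian ψ fun p => F (ψ p)) {τ B : ℝ} (hτ : 0 ≤ τ) (hB : 0 ≤ B)
    (hBτ : B * (4 * τ ^ 2) ≤ 1 / 2) (hF' : ∀ x, -B ≤ F' x)
    (hoff : ∀ p ∉ strip τ, ∀ ξ ∈ uIcc (ψ p) (ψ (swapXY p)), F' ξ = 0) (p : T2) :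
    ψ (swapXY p) = ψ p := by
  have hsc : Continuous swapXY :=
    continuous_pi fun j => by fin_cases j <;> simp [swapXY] <;> fun_prop
  have hFc : Continuous F := continuous_iff_continuousAt.2 fun x => (hF x).continuousAt
  let d : T2 → ℝ := fun p => ψ p - ψ (swapXY p)
  let g : T2 → ℝ := fun p => F (ψ p) - F (ψ (swapXY p))
  have hψs := hodd.comp_swapXY
  have hdc : Continuous d := hc.sub (hc.comp hsc)
  have hgc : Continuous g := (hFc.comp hc).sub (hFc.comp (hc.comp hsc))
  have hd : IsOddOdd d := fun p => by
    simp only [d, (hodd p).1, (hodd p).2, (hψs p).1, (hψs p).2]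
    constructor <;> ring
  have hg : IsOddOdd g := fun p => by
    simp only [g, (hodd p).1, (hodd p).2, (hψs p).1, (hψs p).2, hFodd]
    constructor <;> ring
  have hdL := memLp_of_continuous hdc 2
  have hgL := memLp_of_continuous hgc 2
  -- The solution is merely continuous here, so `d` is not known to be in `H²`. `U` is the `H²`
  -- solution of `ΔU = g`; testing the weak equation against sines shows that it is `d`.
  obtain ⟨U, hU, hUg⟩ := exists_laplacian_eq (toLp_mem_L2OddOdd hgL hg)
  have hcoef : ∀ (f : T2 → ℝ) (hf : MemLp f 2 torusMeasure) (k : ℕ × ℕ),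
      sineInner (hf.toLp f) k = ∫ p, f p * sineBasisFun 0 0 k p ∂torusMeasure := fun f hf k => by
    rw [sineInner_eq_integral]
    refine integral_congr_ae ?_
    filter_upwards [hf.coeFn_toLp] with p hp
    rw [hp]
  have hweak' : ∀ k, ∫ p, F (ψ p) * sineBasisFun 0 0 k p ∂torusMeasure =
      -sineEigenvalue k * ∫ p, ψ p * sineBasisFun 0 0 k p ∂torusMeasure := fun k => by
    rw [← hweak _ (torusContDiff_sineBasisFun 0 0 k), ← integral_const_mul]
    simp only [pdIter_two_sineBasisFun]
    refine integral_congr_ae (ae_of_all _ fun p => ?_)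
    simp only
    ring
  have hdiff : ∀ (f : T2 → ℝ), Continuous f → ∀ k,
      ∫ p, (f p - f (swapXY p)) * sineBasisFun 0 0 k p ∂torusMeasure =
        ∫ p, f p * sineBasisFun 0 0 k p ∂torusMeasure -
          ∫ p, f p * sineBasisFun 0 0 k.swap p ∂torusMeasure := fun f hf k => by
    have hsk := (torusContDiff_sineBasisFun 0 0 k).continuous
    have i1 : Integrable (fun p => f p * sineBasisFun 0 0 k p) torusMeasure :=
      integrable_of_continuous (hf.mul hsk)
    have i2 : Integrable (fun p => f (swapXY p) * sineBasisFun 0 0 k p) torusMeasure :=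
      integrable_of_continuous ((hf.comp hsc).mul hsk)
    rw [← integral_comp_swapXY_mul_sine, ← integral_sub i1 i2]
    simp only [sub_mul]
  have hUd : H2.toL2 U = hdL.toLp d := by
    refine ext_sineInner hU (toLp_mem_L2OddOdd hdL hd) fun k => ?_
    have h1 := sineInner_laplacian U k
    have h2 := hdiff (fun p => F (ψ p)) (hFc.comp hc) k
    rw [hUg, hcoef, h2, hweak' k, hweak' k.swap, sineEigenvalue_swap,
      ← mul_sub, ← hdiff _ hc] at h1
    have := one_le_sineEigenvalue k
    rw [hcoef]
    exact (mul_left_cancel₀ (by linarith) h1).symm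
  -- By the mean value theorem `g = F'(ξ) d`, with `ξ` between the two values of `ψ`; off the strip
  -- `hoff` removes this term.
  have hpt : ∀ p, -(g p * d p) ≤ B * ((strip τ).indicator 1 p * (d p * d p)) := fun p => by
    obtain ⟨ξ, hξ, e⟩ := exists_sub_eq_deriv_mul hF (ψ p) (ψ (swapXY p))
    have e' : g p = F' ξ * d p := e
    rw [e']
    by_cases hp : p ∈ strip τ
    · rw [indicator_of_mem hp, Pi.one_apply, one_mul]
      nlinarith [mul_self_nonneg (d p), hF' ξ]
    · rw [indicator_of_notMem hp, hoff p hp ξ hξ]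
      simp
  have hform := integral_strip_le_dirichlet hU hτ
  have hle : -⟪H2.laplacian U, H2.toL2 U⟫ ≤
      B * ∫ p, (strip τ).indicator 1 p * (H2.toL2 U p * H2.toL2 U p) ∂torusMeasure := by
    rw [inner_eq_integral, ← integral_neg, ← integral_const_mul]
    have h1 := hgL.coeFn_toLp
    have h2 := hdL.coeFn_toLp
    rw [← hUg] at h1
    rw [← hUd] at h2
    refine integral_mono_ae (integrable_mul (H2.laplacian U) (H2.toL2 U)).neg
      ((integrable_mul_mul (memLp_strip τ) (H2.toL2 U) (H2.toL2 U)).const_mul B) ?_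
    filter_upwards [h1, h2] with p h1 h2
    have h3 := hpt p
    rw [← h1, ← h2] at h3
    exact h3
  -- Together, `hle`, `hform` and `hBτ` bound the Dirichlet form by half of itself.
  have hzero := toL2_eq_zero_of_dirichlet_nonpos hU (by nlinarith [mul_le_mul_of_nonneg_left hform hB])
  have hae : d =ᵐ[torusMeasure] 0 := hdL.coeFn_toLp.symm.trans (by
    rw [← hUd, hzero]
    exact Lp.coeFn_zero ℝ 2 torusMeasure)
  have := (hdc.ae_eq_iff_eq torusMeasure continuous_const).1 hae
  have hdp : ψ p - ψ (swapXY p) = 0 := congrFun this p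
  linarith

/-! ### Values of the stream function away from the strip -/

/-- Stronger than `ε ≤ |ψ p|`: it also fixes the sign of `ψ` to be that of `psi0`, which is needed
when two values of `ψ` are joined by a segment. -/
theorem abs_sub_psi0_add_le {ψ : T2 → ℝ} (hψ : TorusContDiff 1 ψ) (hodd : IsOddOdd ψ)
    {δ τ ε : ℝ} (hτ : 0 ≤ τ) (hδ : c1Norm (fun p => ψ p - psi0 p) < ENNReal.ofReal δ)
    (hdom : ∀ n m : ℝ, τ < n → n ≤ m → m ≤ 1 / 4 →
      δ * n + ε ≤ 1 / 13 * (n * m * -Real.log (128 / 9 * m ^ 2))) {p : T2} (hp : p ∉ strip τ) :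
    |ψ p - psi0 p| + ε ≤ |psi0 p| := by
  obtain ⟨n, m, h1, h2, h3, h4, h5⟩ := exists_bounds_of_notMem_strip hψ hodd hτ hδ hp
  linarith [hdom n m h1 h2 h3]

/-- The common reference value `c` places `a` and `b` on the same side of zero, so the segment
between them does not cross `(-ε, ε)`. -/
theorem le_abs_of_mem_uIcc {a b c ξ ε : ℝ} (ha : |a - c| + ε ≤ |c|) (hb : |b - c| + ε ≤ |c|)
    (hξ : ξ ∈ uIcc a b) : ε ≤ |ξ| := by
  have h : ∀ a b, |a - c| + ε ≤ |c| → |b - c| + ε ≤ |c| → ξ ∈ Icc a b → ε ≤ |ξ| := by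
    intro a b ha hb hξ
    rcases le_total 0 c with hc | hc
    · rw [abs_of_nonneg hc] at ha
      linarith [neg_abs_le (a - c), le_abs_self ξ, hξ.1]
    · rw [abs_of_nonpos hc] at hb
      linarith [le_abs_self (b - c), neg_abs_le ξ, hξ.2]
  rcases le_total a b with hab | hab
  · exact h a b ha hb (by rwa [uIcc_of_le hab] at hξ)
  · exact h b a hb ha (by rwa [uIcc_of_ge hab] at hξ)

/-- A potential which is small compared with the width of the strip supporting it is small
relative to the Dirichlet form. -/
theorem integral_potential_le {V : T2 → ℝ} (hV : MemLp V ∞ torusMeasure) {τ B : ℝ} (hτ : 0 ≤ τ)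
    (hB : 0 ≤ B) (hBτ : B * (4 * τ ^ 2) ≤ 1 / 2) (hVB : ∀ p, -B ≤ V p)
    (hoff : ∀ p ∉ strip τ, V p = 0) {U : H2} (hU : U ∈ H2OddOdd) :
    ∫ p, -V p * (H2.toL2 U p * H2.toL2 U p) ∂torusMeasure ≤
      1 / 2 * -⟪H2.laplacian U, H2.toL2 U⟫ := by
  have hform := integral_strip_le_dirichlet hU hτ
  have hnn : 0 ≤ -⟪H2.laplacian U, H2.toL2 U⟫ := (hasSum_dirichlet hU).nonneg fun k =>
    mul_nonneg (zero_le_one.trans (one_le_sineEigenvalue k)) (sq_nonneg _)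
  have hle : ∫ p, -V p * (H2.toL2 U p * H2.toL2 U p) ∂torusMeasure ≤
      B * ∫ p, (strip τ).indicator 1 p * (H2.toL2 U p * H2.toL2 U p) ∂torusMeasure := by
    rw [← integral_const_mul]
    refine integral_mono (integrable_mul_mul hV.neg (H2.toL2 U) (H2.toL2 U))
      ((integrable_mul_mul (memLp_strip τ) (H2.toL2 U) (H2.toL2 U)).const_mul B) fun p => ?_
    have h := mul_self_nonneg (H2.toL2 U p)
    by_cases hp : p ∈ strip τ
    · simp only [indicator_of_mem hp, Pi.one_apply, one_mul]
      exact mul_le_mul_of_nonneg_right (by linarith [hVB p]) h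
    · simp only [indicator_of_notMem hp, hoff p hp, neg_zero, zero_mul, mul_zero, le_refl]
  calc _ ≤ _ := hle
    _ ≤ B * (4 * τ ^ 2 * -⟪H2.laplacian U, H2.toL2 U⟫) := mul_le_mul_of_nonneg_left hform hB
    _ = B * (4 * τ ^ 2) * -⟪H2.laplacian U, H2.toL2 U⟫ := by ring
    _ ≤ _ := mul_le_mul_of_nonneg_right hBτ hnn

end TorusEuler

end

/-! ### The theorem -/

theorem mainTheorem5 (K : ℝ → ℝ) (hK : IsMollifier K) (C₁ : ℝ) (hC₁ : 0 < C₁) :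
    ∃ ε₀ : ℝ, 0 < ε₀ ∧ ∀ ε : ℝ, 0 < ε → ε < ε₀ →
      ∀ ψ : T2 → ℝ, TorusContDiff 1 ψ → IsOddOdd ψ →
        IsWeakLaplacian ψ (fun p => nonlin K ε (ψ p)) →
        c1Norm (fun p => ψ p - psi0 p) <
          ENNReal.ofReal (C₁ * Real.sqrt ε * Real.sqrt (-Real.log ε) *
            Real.log (-Real.log ε)) →
        IsIsoLaplacianSub (fun p => deriv (nonlin K ε) (ψ p)) H2OddOdd L2OddOdd ∧
          IsIsoLaplacianSub (fun p => deriv (nonlin K ε) (ψ p)) H2Sym L2Sym := by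
  obtain ⟨M, hM0, hM⟩ := hK.exists_bound
  -- The potential is at least `-B` with `B = 2M/ε`, and `B · 4τ² = 8Mτ²/ε ≤ 1/2` means `16 M τ² ≤
  -- ε`.
  obtain ⟨ε₀, hε₀, H⟩ := exists_strip_width C₁ (16 * M)
  refine ⟨ε₀, hε₀, fun ε hε hlt ψ hψ hodd hweak hnorm => ?_⟩
  obtain ⟨τ, hτ, hAτ, hdom⟩ := H ε hε hlt
  have hB : 0 ≤ 2 * (M / ε) := by positivity
  have hBτ : 2 * (M / ε) * (4 * τ ^ 2) ≤ 1 / 2 := by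
    have e : 2 * (M / ε) * (4 * τ ^ 2) = 1 / 2 * (16 * M * τ ^ 2 / ε) := by ring
    have := (div_le_one hε).2 hAτ
    linarith
  have hder : ∀ x, -(2 * (M / ε)) ≤ -(2 * rescale K ε x) := fun x => by
    linarith [rescale_le (K := K) hε hM x]
  have hval : ∀ p ∉ strip τ, |ψ p - psi0 p| + ε ≤ |psi0 p| := fun p hp =>
    abs_sub_psi0_add_le hψ hodd hτ.le hnorm hdom hp
  -- Stated for all `ξ` between the values at `p` and at its mirror image: the symmetry of `ψ` uses
  -- the whole segment, the linearized operator only the endpoint `ψ p`.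
  have hoff : ∀ p ∉ strip τ, ∀ ξ ∈ uIcc (ψ p) (ψ (swapXY p)), -(2 * rescale K ε ξ) = 0 := by
    intro p hp ξ hξ
    have hs := hval (swapXY p) (mt swapXY_mem_strip.1 hp)
    rw [psi0_swapXY] at hs
    rw [rescale_eq_zero hK hε (le_abs_of_mem_uIcc (hval p hp) hs hξ), mul_zero, neg_zero]
  have hswap := comp_swapXY_eq hψ.continuous hodd (hasDerivAt_nonlin hK hε) (nonlin_neg hK hε) hweak
    hτ.le hB hBτ hder hoff
  have hVc : Continuous fun p => -(2 * rescale K ε (ψ p)) :=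
    (((continuous_rescale hK ε).comp hψ.continuous).const_mul 2).neg
  simp only [deriv_nonlin hK hε]
  refine isIsoLaplacianSub_of_form hVc
    (fun p => by linarith [rescale_nonneg hK hε (ψ p)])
    (fun p => by rw [(hodd p).1, rescale_neg hK]) (fun p => by rw [(hodd p).2, rescale_neg hK])
    (fun p => by rw [hswap]) fun U hU => ?_
  exact integral_potential_le (memLp_of_continuous hVc ∞) hτ.le hB hBτ (fun p => hder _)
    (fun p hp => hoff p hp _ left_mem_uIcc) hU
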